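/- Let $\mathbb S^2\subset\mathbb R^3$ be the unit sphere, let $s>\tfrac32$, and let $\Psi\in H^s(\mathbb S^2)$ (identified with its continuous representative) be even and strictly positive on $\mathbb S^2$. Set $$W(x)=\frac1{|x|}\,\Psi\!\left(\frac{x}{|x|}\right)\quad (x\neq 0),\qquad W(0)=+\infty .$$ The Fourier transform $\widehat W$ of the tempered distribution $W$ (with $\widehat f(\xi)=(2\pi)^{-3/2}\int_{\mathbb R^3} f(x)e^{-i\xi\cdot x}\,dx$ on Schwartz functions) is a function that is continuous on $\mathbb R^3\setminus\{0\}$; assume that $\widehat W\ge 0$ on $\mathbb S^2$. For a Borel probability measure $\mu$ on $\mathbb R^3$ let $$I(\mu)=\int_{\mathbb R^3}(W*\mu)(x)\,d\mu(x)+\int_{\mathbb R^3}|x|^2\,d\mu(x)\in[0,+\infty],\qquad (W*\mu)(x)=\int_{\mathbb R^3}W(x-y)\,d\mu(y).$$ Then $I$ has a unique minimiser $\mu_0$ among the Borel probability measures on $\mathbb R^3$, and $\mu_0$ has compact support. Moreover, a Borel probability measure $\mu_0$ on $\mathbb R^3$ is the minimiser of $I$ if and only if it satisfies the Euler–Lagrange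 conditions: there are a constant $C\in\mathbb R$ and a Borel set $N\subset\mathbb R^3$ with $\operatorname{Cap}(N)=0$ such that $$(W*\mu_0)(x)+\tfrac12|x|^2=C\quad\text{for }\mu_0\text{-a.e. }x\in\operatorname{supp}\mu_0,$$ $$(W*\mu_0)(x)+\tfrac12|x|^2\ge C\quad\text{for every }x\in\mathbb R^3\setminus N.$$ Here $\operatorname{Cap}$ is the Coulomb (Newtonian) capacity: for a Borel set $N$, $\operatorname{Cap}(N)$ is the supremum of $\big(\iint|x-y|^{-1}\,d\nu(x)\,d\nu(y)\big)^{-1}$ over the Borel probability measures $\nu$ that are carried by a compact subset of $N$ (and $0$ if there are none). -/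

import Mathlib

open MeasureTheory Filter Topology
open scoped ENNReal NNReal SchwartzMap

noncomputable section

namespace AnisotropicEnergy

/-- The Euclidean space `ℝ³`. -/
abbrev E3 : Type := EuclideanSpace ℝ (Fin 3)

/-- The unit sphere `𝕊²` of `ℝ³`. -/
abbrev S2 : Type := Metric.sphere (0 : E3) 1

/-- The surface measure on `𝕊²` (total mass `4π`). -/
def surfaceMeasure : Measure S2 := (volume : Measure E3).toSphere

/-! ### Sobolev spaces on the sphere -/

/-- `Y` is a spherical harmonic of degree `k`: the restriction to `𝕊²` of a homogeneous harmonic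
polynomial of degree `k` (the zero function is allowed). -/
def IsSphericalHarmonic (k : ℕ) (Y : S2 → ℝ) : Prop :=
  ∃ p : MvPolynomial (Fin 3) ℝ, p.IsHomogeneous k ∧
    ∑ i, MvPolynomial.pderiv i (MvPolynomial.pderiv i p) = 0 ∧
    ∀ ω : S2, Y ω = MvPolynomial.eval (fun i => (ω : E3) i) p

/-- `φ ∈ Hˢ(𝕊²)`: the function `φ` is in `L²(𝕊²)` and, in its expansion `φ = ∑ₖ Yₖ` into spherical
harmonics `Yₖ` of degree `k` (converging in `L²(𝕊²)`), one has
`∑ₖ (1 + √(k(k+1)))^(2s) ‖Yₖ‖²_{L²(𝕊²)} < ∞`. The expansion exists and is unique for every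
`φ ∈ L²(𝕊²)`; in the notation `φ = ∑ₖ aₖ Φₖ` with `‖Φₖ‖ = 1` one has `Yₖ = aₖ Φₖ` and
`‖Yₖ‖ = |aₖ|`. -/
def MemSobolevSphere (s : ℝ) (φ : S2 → ℝ) : Prop :=
  MemLp φ 2 surfaceMeasure ∧
  ∃ Y : ℕ → S2 → ℝ, (∀ k, IsSphericalHarmonic k (Y k)) ∧
    Tendsto (fun n : ℕ => eLpNorm (fun ω => φ ω - ∑ k ∈ Finset.range n, Y k ω) 2 surfaceMeasure)
      atTop (𝓝 0) ∧
    Summable (fun k : ℕ =>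
      (1 + Real.sqrt ((k : ℝ) * ((k : ℝ) + 1))) ^ (2 * s) * ∫ ω, (Y k ω) ^ 2 ∂surfaceMeasure)

/-! ### The interaction potential and its Fourier transform -/

/-- The direction `x / |x| ∈ 𝕊²` of a nonzero vector. -/
def direction (x : E3) (hx : x ≠ 0) : S2 :=
  ⟨‖x‖⁻¹ • x, by simp [norm_smul, hx]⟩

/-- The potential `W(x) = Ψ(x/|x|) / |x|` for `x ≠ 0`, and `W(0) = +∞`, with values in `[0, ∞]`
(the profile `Ψ` is positive). -/
def potential (Ψ : S2 → ℝ) (x : E3) : ℝ≥0∞ :=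
  if hx : x = 0 then ⊤ else ENNReal.ofReal (‖x‖⁻¹ * Ψ (direction x hx))

/-- `φ̂(ξ) = (2π)^(-3/2) ∫ φ(x) e^{-i ξ·x} dx`. -/
def fourier (φ : E3 → ℂ) (ξ : E3) : ℂ :=
  (((2 * Real.pi) ^ (-(3 / 2) : ℝ) : ℝ) : ℂ) *
    ∫ x, φ x * Complex.exp (-(Complex.I * ((inner ℝ ξ x : ℝ) : ℂ)))

/-- The function `F` is the Fourier transform of the function `f` in the sense of tempered
distributions: `∫ f φ̂ = ∫ F φ` for every Schwartz function `φ`, all these integrals being absolutely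
convergent. -/
def IsFourierTransform (f F : E3 → ℝ) : Prop :=
  ∀ φ : 𝓢(E3, ℂ),
    Integrable (fun x => (f x : ℂ) * fourier φ x) ∧
    Integrable (fun ξ => (F ξ : ℂ) * φ ξ) ∧
    ∫ x, (f x : ℂ) * fourier φ x = ∫ ξ, (F ξ : ℂ) * φ ξ

/-- `Ŵ ≥ 0` on `𝕊²`. Here `Ŵ` is the function, continuous on `ℝ³ ∖ {0}` and hence unique there, that
represents the Fourier transform of the tempered distribution `W`. The existence of such a function
is not part of this condition. -/
def FourierNonnegOnSphere (Ψ : S2 → ℝ) : Prop :=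
  ∀ F : E3 → ℝ, ContinuousOn F {0}ᶜ →
    IsFourierTransform (fun x => (potential Ψ x).toReal) F → ∀ ω : S2, 0 ≤ F ω

/-! ### The energy -/

/-- `(W * μ)(x) = ∫ W(x - y) dμ(y)`, with values in `[0, ∞]`. -/
def potentialConv (Ψ : S2 → ℝ) (μ : Measure E3) (x : E3) : ℝ≥0∞ :=
  ∫⁻ y, potential Ψ (x - y) ∂μ

/-- `I(μ) = ∫ (W * μ) dμ + ∫ |x|² dμ`, with values in `[0, ∞]`. -/
def energy (Ψ : S2 → ℝ) (μ : ProbabilityMeasure E3) : ℝ≥0∞ :=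
  (∫⁻ x, potentialConv Ψ μ x ∂(μ : Measure E3)) +
    ∫⁻ x, ENNReal.ofReal (‖x‖ ^ 2) ∂(μ : Measure E3)

/-- `μ` minimises `I` over all Borel probability measures on `ℝ³`. -/
def IsMinimiser (Ψ : S2 → ℝ) (μ : ProbabilityMeasure E3) : Prop :=
  ∀ ν : ProbabilityMeasure E3, energy Ψ μ ≤ energy Ψ ν

/-! ### Capacity and the Euler–Lagrange conditions -/

/-- The Coulomb energy `∬ |x - y|⁻¹ dν(y) dν(x)`, with `|0|⁻¹ = +∞`. -/
def coulombEnergy (ν : Measure E3) : ℝ≥0∞ :=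
  ∫⁻ x, ∫⁻ y, (ENNReal.ofReal ‖x - y‖)⁻¹ ∂ν ∂ν

/-- The (Coulomb, or Newtonian) capacity of a Borel set `N ⊆ ℝ³`: the supremum of the reciprocal of
the Coulomb energy over the probability measures that are carried by a compact subset of `N`. -/
def capacity (N : Set E3) : ℝ≥0∞ :=
  ⨆ (ν : ProbabilityMeasure E3)
    (_ : ∃ K : Set E3, IsCompact K ∧ K ⊆ N ∧ (ν : Measure E3) Kᶜ = 0),
    (coulombEnergy (ν : Measure E3))⁻¹

/-- The Euler–Lagrange conditions for `μ`: there is a (finite) constant `C` such that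
`W * μ + |x|²/2 = C` at `μ`-almost every point of the support of `μ`, and `W * μ + |x|²/2 ≥ C`
outside a Borel set of capacity zero. As `W * μ + |x|²/2 ≥ 0`, only `C ≥ 0` can occur. -/
def EulerLagrange (Ψ : S2 → ℝ) (μ : ProbabilityMeasure E3) : Prop :=
  ∃ C : ℝ≥0,
    (∀ᵐ x ∂(μ : Measure E3), x ∈ (μ : Measure E3).support →
      potentialConv Ψ μ x + ENNReal.ofReal (‖x‖ ^ 2 / 2) = C) ∧
    ∃ N : Set E3, MeasurableSet N ∧ capacity N = 0 ∧
      ∀ x ∉ N, (C : ℝ≥0∞) ≤ potentialConv Ψ μ x + ENNReal.ofReal (‖x‖ ^ 2 / 2)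

end AnisotropicEnergy

end

noncomputable section

namespace AnisotropicEnergy

/-! ### Lower semicontinuity of integrals under weak convergence -/

/-! Write `J(μ, ν)` for the mutual energy `∬ W(x - y) dμ dν`. Everything rests on the positive
definiteness of `J`. If `F ≥ 0` represents the Fourier transform of `W`, then `J(μ, μ) + J(ν, ν) - 2
J(μ, ν)` is bounded below by a positive multiple of `∫ F(ξ) exp (-|ξ|² / 2) |μ̂(ξ) - ν̂(ξ)|² dξ`
whenever `J(μ, μ)` and `J(ν, ν)` are finite (`HasFourierProfile.defect_add_interaction_le`). As `W`
is singular and `F` is not integrable, the identity is first proved for the Gaussian averages of `W`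
at scale `s`, whose transform is the integrable function `F(ξ) exp (-s² |ξ|² / 2)`. In the limit `s
→ 0` dominated convergence handles the diagonal terms and Fatou's lemma the mixed term.

The function `F` is built explicitly in `exists_hasFourierProfile`. Expand `Ψ = ∑ Yₖ` into spherical
harmonics. Hecke's identity, integrated over Gaussian scales, shows that `Yₖ(x/|x|) / |x|` has
transform `(-i)ᵏ cₖ Yₖ(ξ/|ξ|) / |ξ|²` with `cₖ ≤ √(k + 1)`. Rotation invariance gives `sup |Yₖ| ≤ C
√(k + 1) ‖Yₖ‖₂`, so the transformed series converges uniformly on the sphere once `∑ (k + 1) ‖Yₖ‖₂ <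
∞`; by Cauchy–Schwarz this follows from membership in `Hˢ` with `s > 3/2`. Evenness removes the odd
degrees and makes `F` real. The sign hypothesis on the sphere extends to all of `ℝ³` because `F` is
homogeneous of degree `-2`.

The rest is potential theory. Existence is the direct method: the energy is weakly lower
semicontinuous and the confinement gives tightness. The first variation at a minimiser yields the
Euler–Lagrange conditions, because measures of finite energy do not charge sets of capacity zero.
Equality on the support then bounds `|x|² / 2` by `C`, so the support is compact. Conversely,
positive definiteness turns the Euler–Lagrange conditions into minimality
(`EulerLagrange.isMinimiser`). For two minimisers the Fourier defect vanishes, so their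
characteristic functions agree on the nonempty open set `{F > 0}`, away from the origin. Both
measures have bounded support, so the characteristic functions are analytic along lines and coincide
(`measure_eq_of_charFun_eqOn`). -/

theorem lowerSemicontinuous_lintegral {X : Type*} [TopologicalSpace X] [MeasurableSpace X]
    [OpensMeasurableSpace X] {f : X → ℝ≥0∞} (hf : Continuous f) :
    LowerSemicontinuous (fun μ : ProbabilityMeasure X => ∫⁻ x, f x ∂(μ : Measure X)) := by
  -- The truncations `min f n` are bounded and continuous, so their integrals depend continuously on
  -- `μ`; a supremum of continuous functions is lower semicontinuous.
  have key : ∀ μ : ProbabilityMeasure X, ∫⁻ x, f x ∂(μ : Measure X) =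
      ⨆ n : ℕ, ∫⁻ x, min (f x) n ∂(μ : Measure X) := by
    intro μ
    rw [← lintegral_iSup (fun n => (hf.measurable.min measurable_const))]
    · congr 1
      ext x
      have : (⨆ n : ℕ, min (f x) (n : ℝ≥0∞)) = min (f x) (⨆ n : ℕ, (n : ℝ≥0∞)) :=
        (inf_iSup_eq _ _).symm
      rw [this, ENNReal.iSup_natCast, min_top_right]
    · intro n m hnm x
      exact min_le_min le_rfl (by exact_mod_cast hnm)
  simp_rw [key]
  refine lowerSemicontinuous_iSup fun n => Continuous.lowerSemicontinuous ?_
  have hfin : ∀ x, min (f x) (n : ℝ≥0∞) ≠ ⊤ := fun x =>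
    ne_top_of_le_ne_top (ENNReal.natCast_ne_top n) (min_le_right _ _)
  let g : BoundedContinuousFunction X ℝ≥0 := BoundedContinuousFunction.mkOfBound
    ⟨fun x => (min (f x) (n : ℝ≥0∞)).toNNReal, by
      refine continuous_iff_continuousAt.2 fun x => ?_
      exact (ENNReal.tendsto_toNNReal (hfin x)).comp
        ((hf.min continuous_const).continuousAt)⟩ (2 * n) (by
      intro x y
      have h : ∀ z, (((min (f z) (n : ℝ≥0∞)).toNNReal : ℝ≥0) : ℝ) ≤ n := by
        intro z
        have : (min (f z) (n : ℝ≥0∞)).toNNReal ≤ (n : ℝ≥0) := by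
          have := ENNReal.toNNReal_mono (ENNReal.natCast_ne_top n) (min_le_right (f z) (n : ℝ≥0∞))
          simpa using this
        exact_mod_cast this
      have hx := h x
      have hy := h y
      rw [NNReal.dist_eq]
      simp only [ContinuousMap.coe_mk]
      rw [abs_le]
      constructor <;> linarith [NNReal.coe_nonneg (min (f x) (n : ℝ≥0∞)).toNNReal,
        NNReal.coe_nonneg (min (f y) (n : ℝ≥0∞)).toNNReal])
  have hg : ∀ μ : ProbabilityMeasure X, ∫⁻ x, min (f x) n ∂(μ : Measure X) =
      ((μ.toFiniteMeasure.testAgainstNN g : ℝ≥0) : ℝ≥0∞) := by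
    intro μ
    rw [FiniteMeasure.testAgainstNN_coe_eq]
    refine lintegral_congr fun x => ?_
    exact (ENNReal.coe_toNNReal (hfin x)).symm
  simp_rw [hg]
  exact ENNReal.continuous_coe.comp (ProbabilityMeasure.continuous_testAgainstNN_eval g)

/-! ### The potential -/

variable {Ψ : S2 → ℝ}

theorem exists_profile_bounds (hcont : Continuous Ψ) (hpos : ∀ ω, 0 < Ψ ω) :
    ∃ m M : ℝ, 0 < m ∧ 0 < M ∧ ∀ ω, m ≤ Ψ ω ∧ Ψ ω ≤ M := by
  have : Nonempty S2 := (NormedSpace.sphere_nonempty.2 zero_le_one).to_subtype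
  obtain ⟨a, -, ha⟩ := isCompact_univ.exists_isMinOn Set.univ_nonempty hcont.continuousOn
  obtain ⟨b, -, hb⟩ := isCompact_univ.exists_isMaxOn Set.univ_nonempty hcont.continuousOn
  exact ⟨Ψ a, Ψ b, hpos a, hpos b, fun ω => ⟨ha (Set.mem_univ ω), hb (Set.mem_univ ω)⟩⟩

theorem potential_zero : potential Ψ 0 = ⊤ := by simp [potential]

theorem potential_of_ne {x : E3} (hx : x ≠ 0) :
    potential Ψ x = ENNReal.ofReal (‖x‖⁻¹ * Ψ (direction x hx)) := by
  simp [potential, hx]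

theorem potential_neg (heven : ∀ ω, Ψ (-ω) = Ψ ω) (x : E3) :
    potential Ψ (-x) = potential Ψ x := by
  by_cases hx : x = 0
  · simp [hx]
  · rw [potential_of_ne hx, potential_of_ne (neg_ne_zero.2 hx), ← heven (direction x hx)]
    have : direction (-x) (neg_ne_zero.2 hx) = -direction x hx := by
      apply Subtype.ext
      simp [direction]
    rw [this, norm_neg]

theorem mul_inv_norm_le_potential {m : ℝ} (hm : 0 < m) (h : ∀ ω, m ≤ Ψ ω) (x : E3) :
    ENNReal.ofReal m * (ENNReal.ofReal ‖x‖)⁻¹ ≤ potential Ψ x := by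
  by_cases hx : x = 0
  · simp [hx, potential_zero]
  · have hx' : 0 < ‖x‖ := norm_pos_iff.2 hx
    rw [potential_of_ne hx, ← ENNReal.ofReal_inv_of_pos hx', ← ENNReal.ofReal_mul hm.le, mul_comm]
    exact ENNReal.ofReal_le_ofReal (mul_le_mul_of_nonneg_left (h _) (inv_nonneg.2 hx'.le))

theorem potential_le_mul_inv_norm {M : ℝ} (hM : 0 < M) (h : ∀ ω, Ψ ω ≤ M) (x : E3) :
    potential Ψ x ≤ ENNReal.ofReal M * (ENNReal.ofReal ‖x‖)⁻¹ := by
  by_cases hx : x = 0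
  · simp [hx, potential_zero, ENNReal.mul_top, hM]
  · have hx' : 0 < ‖x‖ := norm_pos_iff.2 hx
    rw [potential_of_ne hx, ← ENNReal.ofReal_inv_of_pos hx', ← ENNReal.ofReal_mul hM.le, mul_comm M]
    exact ENNReal.ofReal_le_ofReal (mul_le_mul_of_nonneg_left (h _) (inv_nonneg.2 hx'.le))

theorem continuous_direction : Continuous fun x : {x : E3 // x ≠ 0} => direction x.1 x.2 := by
  refine Continuous.subtype_mk ?_ _
  exact (continuous_subtype_val.norm.inv₀ fun x => norm_ne_zero_iff.2 x.2).smul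
    continuous_subtype_val

/-- The value `⊤` at the origin is the limit there, because `W ≥ m / |x|` with `m > 0`. Continuity
as a map into `ℝ≥0∞` is what makes the energy weakly lower semicontinuous. -/
theorem continuous_potential (hcont : Continuous Ψ) (hpos : ∀ ω, 0 < Ψ ω) :
    Continuous (potential Ψ) := by
  refine continuous_iff_continuousAt.2 fun x => ?_
  by_cases hx : x = 0
  · subst hx
    obtain ⟨m, _, hm, _, h⟩ := exists_profile_bounds hcont hpos
    rw [ContinuousAt, potential_zero]
    have hg : Continuous fun x : E3 => ENNReal.ofReal m * (ENNReal.ofReal ‖x‖)⁻¹ :=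
      (ENNReal.continuous_const_mul ENNReal.ofReal_ne_top).comp
        (continuous_inv.comp (ENNReal.continuous_ofReal.comp continuous_norm))
    have h0 : Tendsto (fun x : E3 => ENNReal.ofReal m * (ENNReal.ofReal ‖x‖)⁻¹) (𝓝 0) (𝓝 ⊤) := by
      have := hg.tendsto 0
      simpa [ENNReal.mul_top, hm] using this
    exact tendsto_nhds_top_mono' h0 (mul_inv_norm_le_potential hm fun ω => (h ω).1)
  · have hopen : IsOpen {x : E3 | x ≠ 0} := isOpen_ne
    refine ContinuousOn.continuousAt (s := {x : E3 | x ≠ 0}) ?_ (hopen.mem_nhds hx)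
    rw [continuousOn_iff_continuous_domRestrict]
    have : Set.domRestrict {x : E3 | x ≠ 0} (potential Ψ) = fun x : {x : E3 // x ≠ 0} =>
        ENNReal.ofReal (‖x.1‖⁻¹ * Ψ (direction x.1 x.2)) := by
      ext x
      exact potential_of_ne x.2
    rw [this]
    exact ENNReal.continuous_ofReal.comp
      ((continuous_subtype_val.norm.inv₀ fun x => norm_ne_zero_iff.2 x.2).mul
        (hcont.comp continuous_direction))

theorem continuous_potential_sub (hcont : Continuous Ψ) (hpos : ∀ ω, 0 < Ψ ω) :
    Continuous fun z : E3 × E3 => potential Ψ (z.1 - z.2) :=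
  (continuous_potential hcont hpos).comp (continuous_fst.sub continuous_snd)

theorem measurable_potentialConv (hcont : Continuous Ψ) (hpos : ∀ ω, 0 < Ψ ω) (μ : Measure E3)
    [SFinite μ] : Measurable (potentialConv Ψ μ) :=
  (continuous_potential_sub hcont hpos).measurable.lintegral_prod_right'

/-! ### The energy as a quadratic form plus a linear term -/

/-- The mutual interaction energy `∬ W(x - y) dμ(y) dν(x)`. -/
def interaction (Ψ : S2 → ℝ) (μ ν : Measure E3) : ℝ≥0∞ := ∫⁻ x, potentialConv Ψ μ x ∂ν

/-- The confinement energy `∫ |x|² dμ(x)`. -/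
def confinement (μ : Measure E3) : ℝ≥0∞ := ∫⁻ x, ENNReal.ofReal (‖x‖ ^ 2) ∂μ

theorem energy_eq (μ : ProbabilityMeasure E3) :
    energy Ψ μ = interaction Ψ μ μ + confinement (μ : Measure E3) := rfl

theorem interaction_eq_prod (hcont : Continuous Ψ) (hpos : ∀ ω, 0 < Ψ ω) (μ ν : Measure E3)
    [SFinite μ] [SFinite ν] :
    interaction Ψ μ ν = ∫⁻ z, potential Ψ (z.1 - z.2) ∂(ν.prod μ) :=
  (lintegral_prod _ (continuous_potential_sub hcont hpos).measurable.aemeasurable).symm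

theorem interaction_comm (hcont : Continuous Ψ) (hpos : ∀ ω, 0 < Ψ ω) (heven : ∀ ω, Ψ (-ω) = Ψ ω)
    (μ ν : Measure E3) [SFinite μ] [SFinite ν] : interaction Ψ μ ν = interaction Ψ ν μ := by
  unfold interaction potentialConv
  rw [lintegral_lintegral_swap (continuous_potential_sub hcont hpos).measurable.aemeasurable]
  refine lintegral_congr fun y => lintegral_congr fun x => ?_
  rw [← potential_neg heven, neg_sub]

/-- The map `μ ↦ μ ⊗ μ` is weakly continuous, and the interaction integrates a continuous function
against `μ ⊗ μ`. -/
theorem lowerSemicontinuous_energy (hcont : Continuous Ψ) (hpos : ∀ ω, 0 < Ψ ω) :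
    LowerSemicontinuous (energy Ψ) := by
  have h1 := (lowerSemicontinuous_lintegral (continuous_potential_sub hcont hpos)).comp
    (ProbabilityMeasure.continuous_prod.comp
      (continuous_id.prodMk continuous_id : Continuous fun μ : ProbabilityMeasure E3 => (μ, μ)))
  have h2 : LowerSemicontinuous fun μ : ProbabilityMeasure E3 => confinement (μ : Measure E3) :=
    lowerSemicontinuous_lintegral (ENNReal.continuous_ofReal.comp (continuous_norm.pow 2))
  have h3 : energy Ψ = fun μ : ProbabilityMeasure E3 =>
      (∫⁻ z, potential Ψ (z.1 - z.2) ∂((μ.prod μ : ProbabilityMeasure (E3 × E3)) :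
        Measure (E3 × E3))) + confinement (μ : Measure E3) := by
    ext μ
    rw [energy_eq, interaction_eq_prod hcont hpos]
    rfl
  rw [h3]
  exact h1.add h2

/-! ### Existence of minimisers -/

theorem finrank_E3 : Module.finrank ℝ E3 = 3 := by simp

theorem integrableOn_inv_norm_ball (r : ℝ) :
    IntegrableOn (fun x : E3 => ‖x‖⁻¹) (Metric.ball 0 r) := by
  rw [integrableOn_fun_norm_addHaar volume (f := fun t : ℝ => t⁻¹), finrank_E3]
  have h : IntegrableOn (fun y : ℝ => y) (Set.Ioo 0 r) :=
    (continuous_id.integrableOn_Icc (a := 0) (b := r)).mono_set Set.Ioo_subset_Icc_self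
  refine h.congr_fun (fun y hy => ?_) measurableSet_Ioo
  have : y ≠ 0 := hy.1.ne'
  simp only [smul_eq_mul]
  field_simp

theorem inv_ofReal_norm_eq {x : E3} (hx : x ≠ 0) :
    (ENNReal.ofReal ‖x‖)⁻¹ = ENNReal.ofReal ‖x‖⁻¹ :=
  (ENNReal.ofReal_inv_of_pos (norm_pos_iff.2 hx)).symm

theorem lintegral_inv_norm_ball_lt_top (r : ℝ) :
    ∫⁻ x in Metric.ball (0 : E3) r, (ENNReal.ofReal ‖x‖)⁻¹ < ⊤ := by
  have h := (integrableOn_inv_norm_ball r).lintegral_lt_top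
  refine lt_of_le_of_lt (le_of_eq (lintegral_congr_ae ?_)) h
  filter_upwards [ae_restrict_of_ae (Measure.ae_ne (volume : Measure E3) 0)] with x hx
  exact inv_ofReal_norm_eq hx

/-- The Newtonian potential of a measure with density at most `1` and finite mass is bounded. -/
theorem lintegral_inv_norm_sub_le (s : Set E3) (x : E3) :
    ∫⁻ y in s, (ENNReal.ofReal ‖x - y‖)⁻¹ ≤
      (∫⁻ y in Metric.ball (0 : E3) 1, (ENNReal.ofReal ‖y‖)⁻¹) + volume s := by
  have h1 : ∀ y, (ENNReal.ofReal ‖x - y‖)⁻¹ ≤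
      (Metric.ball (0 : E3) 1).indicator (fun y => (ENNReal.ofReal ‖y‖)⁻¹) (x - y) + 1 := by
    intro y
    by_cases hy : x - y ∈ Metric.ball (0 : E3) 1
    · rw [Set.indicator_of_mem hy]
      exact le_self_add
    · rw [Set.indicator_of_notMem hy, zero_add, ENNReal.inv_le_one, ENNReal.one_le_ofReal]
      simpa using hy
  calc ∫⁻ y in s, (ENNReal.ofReal ‖x - y‖)⁻¹
      ≤ ∫⁻ y in s, ((Metric.ball (0 : E3) 1).indicator (fun y => (ENNReal.ofReal ‖y‖)⁻¹) (x - y)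
          + 1) := lintegral_mono h1
    _ = (∫⁻ y in s, (Metric.ball (0 : E3) 1).indicator (fun y => (ENNReal.ofReal ‖y‖)⁻¹) (x - y))
          + volume s := by
        rw [lintegral_add_right _ measurable_const]
        simp
    _ ≤ (∫⁻ y, (Metric.ball (0 : E3) 1).indicator (fun y => (ENNReal.ofReal ‖y‖)⁻¹) (x - y))
          + volume s := by
        gcongr
        exact Measure.restrict_le_self
    _ = _ := by
        rw [lintegral_sub_left_eq_self (μ := (volume : Measure E3)) (fun y =>
          (Metric.ball (0 : E3) 1).indicator (fun y => (ENNReal.ofReal ‖y‖)⁻¹) y) x,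
          lintegral_indicator measurableSet_ball]

/-- The uniform measure on the unit ball works: `|x|⁻¹` is locally integrable in dimension three, so
its potential is bounded. -/
theorem exists_energy_lt_top (hcont : Continuous Ψ) (hpos : ∀ ω, 0 < Ψ ω) :
    ∃ μ : ProbabilityMeasure E3, energy Ψ μ < ⊤ := by
  obtain ⟨m, M, hm, hM, h⟩ := exists_profile_bounds hcont hpos
  let B : Set E3 := Metric.ball 0 1
  have hB0 : volume B ≠ 0 := (Metric.measure_ball_pos _ _ one_pos).ne'
  have hBt : volume B ≠ ⊤ := measure_ball_lt_top.ne
  let μ : Measure E3 := (volume B)⁻¹ • volume.restrict B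
  have hμ : IsProbabilityMeasure μ := ⟨by
    simp only [μ, Measure.smul_apply, Measure.restrict_apply_univ, smul_eq_mul]
    exact ENNReal.inv_mul_cancel hB0 hBt⟩
  refine ⟨(⟨μ, hμ⟩ : ProbabilityMeasure E3), ?_⟩
  change interaction Ψ μ μ + confinement μ < ⊤
  refine ENNReal.add_lt_top.2 ⟨?_, ?_⟩
  · let L : ℝ≥0∞ := ENNReal.ofReal M * ((volume B)⁻¹ *
      ((∫⁻ y in Metric.ball (0 : E3) 1, (ENNReal.ofReal ‖y‖)⁻¹) + volume B))
    have hL : L < ⊤ := ENNReal.mul_lt_top ENNReal.ofReal_lt_top (ENNReal.mul_lt_top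
      (ENNReal.inv_lt_top.2 hB0.bot_lt) (ENNReal.add_lt_top.2
        ⟨lintegral_inv_norm_ball_lt_top 1, hBt.lt_top⟩))
    have hle : ∀ x, potentialConv Ψ μ x ≤ L := by
      intro x
      calc potentialConv Ψ μ x ≤ ∫⁻ y, ENNReal.ofReal M * (ENNReal.ofReal ‖x - y‖)⁻¹ ∂μ :=
            lintegral_mono fun y => potential_le_mul_inv_norm hM (fun ω => (h ω).2) _
        _ = ENNReal.ofReal M * ((volume B)⁻¹ * ∫⁻ y in B, (ENNReal.ofReal ‖x - y‖)⁻¹) := by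
            rw [lintegral_const_mul' _ _ ENNReal.ofReal_ne_top,
              lintegral_smul_measure, smul_eq_mul]
        _ ≤ L := by
            exact mul_le_mul' le_rfl (mul_le_mul' le_rfl (lintegral_inv_norm_sub_le B x))
    calc interaction Ψ μ μ ≤ ∫⁻ _, L ∂μ := lintegral_mono hle
      _ = L := by simp
      _ < ⊤ := hL
  · have hae : ∀ᵐ x ∂μ, ENNReal.ofReal (‖x‖ ^ 2) ≤ 1 := by
      refine Measure.ae_smul_measure ?_ _
      filter_upwards [ae_restrict_mem measurableSet_ball] with x hx
      rw [ENNReal.ofReal_le_one]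
      have : ‖x‖ < 1 := by simpa [B] using hx
      nlinarith [norm_nonneg x]
    calc confinement μ ≤ ∫⁻ _, 1 ∂μ := lintegral_mono_ae hae
      _ < ⊤ := by simp

/-- Chebyshev's inequality bounds the mass outside the ball of radius `r` by `K / r²`. -/
theorem isTightMeasureSet_confinement_le (K : ℝ≥0∞) (hK : K ≠ ⊤) :
    IsTightMeasureSet {μ : Measure E3 | confinement μ ≤ K} := by
  refine isTightMeasureSet_of_tendsto_measure_norm_gt ?_
  have hlim : Tendsto (fun r : ℝ => K / ENNReal.ofReal (r ^ 2)) atTop (𝓝 0) := by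
    have h1 : Tendsto (fun r : ℝ => ENNReal.ofReal (r ^ 2)) atTop (𝓝 ⊤) :=
      ENNReal.tendsto_ofReal_atTop.comp (tendsto_pow_atTop two_ne_zero)
    have h2 := ENNReal.Tendsto.const_mul (a := K) (tendsto_inv_iff.2 h1) (Or.inr hK)
    simpa [div_eq_mul_inv] using h2
  refine tendsto_of_tendsto_of_tendsto_of_le_of_le' tendsto_const_nhds hlim
    (Eventually.of_forall fun _ => zero_le) ?_
  filter_upwards [eventually_gt_atTop 0] with r hr
  refine iSup₂_le fun μ hμ => ?_
  have hr2 : 0 < r ^ 2 := by positivity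
  calc μ {x | r < ‖x‖} ≤ μ {x | ENNReal.ofReal (r ^ 2) ≤ ENNReal.ofReal (‖x‖ ^ 2)} := by
        refine measure_mono fun x hx => ENNReal.ofReal_le_ofReal ?_
        have : r < ‖x‖ := hx
        gcongr
    _ ≤ confinement μ / ENNReal.ofReal (r ^ 2) :=
        meas_ge_le_lintegral_div (by fun_prop) (ENNReal.ofReal_pos.2 hr2).ne' ENNReal.ofReal_ne_top
    _ ≤ K / ENNReal.ofReal (r ^ 2) := by exact ENNReal.div_le_div_right hμ _

theorem exists_isMinimiser (hcont : Continuous Ψ) (hpos : ∀ ω, 0 < Ψ ω) :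
    ∃ μ : ProbabilityMeasure E3, IsMinimiser Ψ μ := by
  obtain ⟨μ₁, h₁⟩ := exists_energy_lt_top hcont hpos
  -- By Prokhorov's theorem `S` is weakly compact. It contains `μ₁`, and outside `S` the confinement
  -- alone already exceeds the energy of `μ₁`, so a minimiser over `S` is global.
  let S : Set (ProbabilityMeasure E3) := {μ | confinement (μ : Measure E3) ≤ energy Ψ μ₁}
  have hclosed : IsClosed S := by
    have h : LowerSemicontinuous fun μ : ProbabilityMeasure E3 => confinement (μ : Measure E3) :=
      lowerSemicontinuous_lintegral (ENNReal.continuous_ofReal.comp (continuous_norm.pow 2))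
    exact h.isClosed_preimage _
  have hcompact : IsCompact S := by
    rw [← hclosed.closure_eq]
    refine isCompact_closure_of_isTightMeasureSet
      ((isTightMeasureSet_confinement_le _ h₁.ne).subset ?_)
    rintro _ ⟨μ, hμ, rfl⟩
    exact hμ
  obtain ⟨μ, -, hμ⟩ := LowerSemicontinuousOn.exists_isMinOn (s := S)
    ⟨μ₁, (self_le_add_left _ _).trans_eq (energy_eq μ₁).symm⟩ hcompact
    ((lowerSemicontinuous_energy hcont hpos).lowerSemicontinuousOn _)
  refine ⟨μ, fun ν => ?_⟩
  by_cases hν : ν ∈ S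
  · exact hμ hν
  · have h2 : energy Ψ μ₁ < confinement (ν : Measure E3) := not_le.1 hν
    have h3 : energy Ψ μ ≤ energy Ψ μ₁ :=
      hμ (show μ₁ ∈ S from (self_le_add_left _ _).trans_eq (energy_eq μ₁).symm)
    exact h3.trans (h2.le.trans ((self_le_add_left _ _).trans_eq (energy_eq ν).symm))

/-! ### Capacity -/

/-- With its converse below, this lets the Coulomb capacity, which ignores `Ψ`, control the measures
of finite interaction energy: `W` is comparable to `|x|⁻¹`. -/
theorem coulombEnergy_le (hcont : Continuous Ψ) (hpos : ∀ ω, 0 < Ψ ω) :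
    ∃ c : ℝ≥0∞, c ≠ ⊤ ∧ ∀ μ : Measure E3, coulombEnergy μ ≤ c * interaction Ψ μ μ := by
  obtain ⟨m, _, hm, -, h⟩ := exists_profile_bounds hcont hpos
  have hm0 : ENNReal.ofReal m ≠ 0 := (ENNReal.ofReal_pos.2 hm).ne'
  have hc : (ENNReal.ofReal m)⁻¹ ≠ ⊤ := ENNReal.inv_ne_top.2 hm0
  refine ⟨(ENNReal.ofReal m)⁻¹, hc, fun μ => ?_⟩
  unfold coulombEnergy interaction potentialConv
  rw [← lintegral_const_mul' _ _ hc]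
  refine lintegral_mono fun x => ?_
  rw [← lintegral_const_mul' _ _ hc]
  refine lintegral_mono fun y => ?_
  calc (ENNReal.ofReal ‖x - y‖)⁻¹
      = (ENNReal.ofReal m)⁻¹ * (ENNReal.ofReal m * (ENNReal.ofReal ‖x - y‖)⁻¹) := by
        rw [← mul_assoc, ENNReal.inv_mul_cancel hm0 ENNReal.ofReal_ne_top, one_mul]
    _ ≤ _ := mul_le_mul' le_rfl (mul_inv_norm_le_potential hm (fun ω => (h ω).1) _)

theorem interaction_le_coulombEnergy (hcont : Continuous Ψ) (hpos : ∀ ω, 0 < Ψ ω) :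
    ∃ c : ℝ≥0∞, c ≠ ⊤ ∧ ∀ μ : Measure E3, interaction Ψ μ μ ≤ c * coulombEnergy μ := by
  obtain ⟨_, M, -, hM, h⟩ := exists_profile_bounds hcont hpos
  refine ⟨ENNReal.ofReal M, ENNReal.ofReal_ne_top, fun μ => ?_⟩
  unfold coulombEnergy interaction potentialConv
  rw [← lintegral_const_mul' _ _ ENNReal.ofReal_ne_top]
  refine lintegral_mono fun x => ?_
  rw [← lintegral_const_mul' _ _ ENNReal.ofReal_ne_top]
  exact lintegral_mono fun y => potential_le_mul_inv_norm hM (fun ω => (h ω).2) _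

/-- A measure of finite interaction energy does not charge sets of capacity zero. -/
theorem measure_eq_zero_of_capacity_eq_zero (hcont : Continuous Ψ) (hpos : ∀ ω, 0 < Ψ ω)
    {μ : Measure E3} [IsFiniteMeasure μ] (hμ : interaction Ψ μ μ ≠ ⊤) {N : Set E3}
    (hN : MeasurableSet N) (hcap : capacity N = 0) : μ N = 0 := by
  by_contra hne
  -- Normalising the restriction of `μ` to a compact subset of positive mass gives a competitor of
  -- finite Coulomb energy, which forces the capacity of `N` to be positive.
  obtain ⟨K, hKN, hK, hμK⟩ := hN.exists_lt_isCompact (μ := μ) (r := 0) (pos_iff_ne_zero.2 hne)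
  have hKt : μ K ≠ ⊤ := measure_ne_top _ _
  let ν : Measure E3 := (μ K)⁻¹ • μ.restrict K
  have hν : IsProbabilityMeasure ν := ⟨by
    simp only [ν, Measure.smul_apply, Measure.restrict_apply_univ, smul_eq_mul]
    exact ENNReal.inv_mul_cancel hμK.ne' hKt⟩
  obtain ⟨c, hc, hcoul⟩ := coulombEnergy_le hcont hpos
  have hfin : coulombEnergy μ ≠ ⊤ :=
    ne_top_of_le_ne_top (ENNReal.mul_ne_top hc hμ) (hcoul μ)
  have hcarry : ∃ K : Set E3, IsCompact K ∧ K ⊆ N ∧ ν Kᶜ = 0 := by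
    refine ⟨K, hK, hKN, ?_⟩
    simp [ν, Measure.restrict_apply hK.measurableSet.compl]
  have hle : coulombEnergy ν ≤ (μ K)⁻¹ * ((μ K)⁻¹ * coulombEnergy μ) := by
    unfold coulombEnergy
    simp only [ν, lintegral_smul_measure, smul_eq_mul]
    have hi : (μ K)⁻¹ ≠ ⊤ := ENNReal.inv_ne_top.2 hμK.ne'
    rw [lintegral_const_mul' _ _ hi]
    refine mul_le_mul' le_rfl (mul_le_mul' le_rfl ?_)
    calc _ ≤ ∫⁻ x in K, ∫⁻ y, (ENNReal.ofReal ‖x - y‖)⁻¹ ∂μ ∂μ :=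
          lintegral_mono fun x => lintegral_mono' Measure.restrict_le_self le_rfl
      _ ≤ _ := lintegral_mono' Measure.restrict_le_self le_rfl
  have hνfin : coulombEnergy ν ≠ ⊤ := by
    have hi : (μ K)⁻¹ ≠ ⊤ := ENNReal.inv_ne_top.2 hμK.ne'
    exact ne_top_of_le_ne_top (ENNReal.mul_ne_top hi (ENNReal.mul_ne_top hi hfin)) hle
  have hcapN : (coulombEnergy ν)⁻¹ ≤ capacity N :=
    le_iSup₂_of_le (f := fun (ν : ProbabilityMeasure E3)
      (_ : ∃ K : Set E3, IsCompact K ∧ K ⊆ N ∧ (ν : Measure E3) Kᶜ = 0) =>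
        (coulombEnergy (ν : Measure E3))⁻¹) (⟨ν, hν⟩ : ProbabilityMeasure E3) hcarry le_rfl
  rw [hcap, le_zero_iff, ENNReal.inv_eq_zero] at hcapN
  exact hνfin hcapN

/-! ### The energy along segments of measures and its first variation -/

theorem interaction_add_smul (hcont : Continuous Ψ) (hpos : ∀ ω, 0 < Ψ ω)
    (heven : ∀ ω, Ψ (-ω) = Ψ ω) (μ ν : Measure E3) [IsFiniteMeasure μ] [IsFiniteMeasure ν]
    (a b : ℝ≥0∞) (ha : a ≠ ⊤) (hb : b ≠ ⊤) :
    interaction Ψ (a • μ + b • ν) (a • μ + b • ν) =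
      a * a * interaction Ψ μ μ + 2 * (a * b * interaction Ψ μ ν) + b * b * interaction Ψ ν ν := by
  have hmμ := measurable_potentialConv hcont hpos μ
  have hmν := measurable_potentialConv hcont hpos ν
  have h : ∀ x, potentialConv Ψ (a • μ + b • ν) x =
      a * potentialConv Ψ μ x + b * potentialConv Ψ ν x := by
    intro x
    simp [potentialConv, lintegral_add_measure, lintegral_smul_measure]
  have h2 : ∀ κ : Measure E3, ∫⁻ x, potentialConv Ψ (a • μ + b • ν) x ∂κ =
      a * interaction Ψ μ κ + b * interaction Ψ ν κ := by
    intro κ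
    simp_rw [h]
    rw [lintegral_add_left (hmμ.const_mul a), lintegral_const_mul' _ _ ha,
      lintegral_const_mul' _ _ hb]
    rfl
  have h3 : interaction Ψ (a • μ + b • ν) (a • μ + b • ν) =
      a * (a * interaction Ψ μ μ + b * interaction Ψ ν μ) +
      b * (a * interaction Ψ μ ν + b * interaction Ψ ν ν) := by
    rw [← h2, ← h2]
    simp [interaction, lintegral_add_measure, lintegral_smul_measure]
  rw [h3, interaction_comm hcont hpos heven ν μ]
  ring

theorem confinement_add_smul (μ ν : Measure E3) (a b : ℝ≥0∞) :
    confinement (a • μ + b • ν) = a * confinement μ + b * confinement ν := by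
  simp [confinement, lintegral_add_measure, lintegral_smul_measure]

/-- The effective potential `W * μ + |x|² / 2`. -/
def effective (Ψ : S2 → ℝ) (μ : Measure E3) (x : E3) : ℝ≥0∞ :=
  potentialConv Ψ μ x + ENNReal.ofReal (‖x‖ ^ 2 / 2)

/-- The derivative of the quadratic energy at `μ` is `2 (W * μ) + |x|²`, twice the effective
potential; hence the `1/2` in front of `|x|²`. -/
theorem lintegral_effective (μ ν : Measure E3) :
    2 * ∫⁻ x, effective Ψ μ x ∂ν = 2 * interaction Ψ μ ν + confinement ν := by
  have h : ∀ r : ℝ, ENNReal.ofReal r = 2 * ENNReal.ofReal (r / 2) := by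
    intro r
    rw [show (2 : ℝ≥0∞) = ENNReal.ofReal 2 by simp, ← ENNReal.ofReal_mul two_pos.le]
    congr 1
    ring
  unfold effective
  rw [lintegral_add_right _ (by fun_prop), mul_add]
  congr 1
  unfold confinement
  rw [← lintegral_const_mul' _ _ (by simp)]
  exact lintegral_congr fun x => (h _).symm

/-- First variation of the energy at a minimiser. -/
theorem IsMinimiser.first_variation (hcont : Continuous Ψ) (hpos : ∀ ω, 0 < Ψ ω)
    (heven : ∀ ω, Ψ (-ω) = Ψ ω) {μ : ProbabilityMeasure E3} (hμ : IsMinimiser Ψ μ)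
    (hfin : energy Ψ μ ≠ ⊤) (ν : ProbabilityMeasure E3) (hν : energy Ψ ν ≠ ⊤) :
    ∫⁻ x, effective Ψ μ x ∂(μ : Measure E3) ≤ ∫⁻ x, effective Ψ μ x ∂(ν : Measure E3) := by
  rw [← ENNReal.mul_le_mul_iff_right (a := 2) (by simp) (by simp), lintegral_effective,
    lintegral_effective]
  by_cases hK : interaction Ψ (μ : Measure E3) ν = ⊤
  · rw [hK]; simp
  rw [energy_eq] at hfin hν
  have hJ := (ENNReal.add_ne_top.1 hfin).1
  have hV := (ENNReal.add_ne_top.1 hfin).2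
  have hL := (ENNReal.add_ne_top.1 hν).1
  have hU := (ENNReal.add_ne_top.1 hν).2
  -- Minimality is tested against `(1 - t) μ + t ν`. All the energies involved are finite, so the
  -- comparison can be made in `ℝ`, where subtraction is available.
  have hmix : ∀ t : ℝ, 0 < t → t < 1 →
      (interaction Ψ μ μ).toReal + (confinement μ).toReal ≤
      (1 - t) * (1 - t) * (interaction Ψ μ μ).toReal
        + 2 * ((1 - t) * t * (interaction Ψ μ ν).toReal) + t * t * (interaction Ψ ν ν).toReal
        + ((1 - t) * (confinement μ).toReal + t * (confinement ν).toReal) := by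
    intro t ht0 ht1
    let κ : Measure E3 := ENNReal.ofReal (1 - t) • (μ : Measure E3) +
      ENNReal.ofReal t • (ν : Measure E3)
    have hκ : IsProbabilityMeasure κ := ⟨by
      simp only [κ, Measure.add_apply, Measure.smul_apply, measure_univ, smul_eq_mul, mul_one]
      rw [← ENNReal.ofReal_add (by linarith) ht0.le]
      simp⟩
    have hle : energy Ψ μ ≤ energy Ψ (⟨κ, hκ⟩ : ProbabilityMeasure E3) := hμ _
    have hE : energy Ψ (⟨κ, hκ⟩ : ProbabilityMeasure E3) =
        interaction Ψ κ κ + confinement κ := rfl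
    rw [hE, energy_eq, interaction_add_smul hcont hpos heven _ _ _ _ ENNReal.ofReal_ne_top
      ENNReal.ofReal_ne_top, confinement_add_smul] at hle
    generalize interaction Ψ μ μ = J at *
    generalize interaction Ψ μ ν = K at *
    generalize interaction Ψ ν ν = L at *
    generalize confinement (μ : Measure E3) = V at *
    generalize confinement (ν : Measure E3) = U at *
    lift J to ℝ≥0 using hJ
    lift K to ℝ≥0 using hK
    lift L to ℝ≥0 using hL
    lift V to ℝ≥0 using hV
    lift U to ℝ≥0 using hU
    have h1 : ENNReal.ofReal (1 - t) = ((1 - t).toNNReal : ℝ≥0∞) := rfl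
    have h2 : ENNReal.ofReal t = (t.toNNReal : ℝ≥0∞) := rfl
    rw [h1, h2] at hle
    norm_cast at hle
    have hle' : ((J + V : ℝ≥0) : ℝ) ≤ _ := NNReal.coe_le_coe.2 hle
    push_cast at hle'
    rw [Real.coe_toNNReal _ (by linarith : (0 : ℝ) ≤ 1 - t), Real.coe_toNNReal _ ht0.le] at hle'
    simpa using hle'
  generalize interaction Ψ μ μ = J at *
  generalize interaction Ψ μ ν = K at *
  generalize interaction Ψ ν ν = L at *
  generalize confinement (μ : Measure E3) = V at *
  generalize confinement (ν : Measure E3) = U at *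
  lift J to ℝ≥0 using hJ
  lift K to ℝ≥0 using hK
  lift L to ℝ≥0 using hL
  lift V to ℝ≥0 using hV
  lift U to ℝ≥0 using hU
  norm_cast
  simp only [ENNReal.coe_toReal] at hmix
  rw [← NNReal.coe_le_coe]
  push_cast
  -- The constant term cancels and a factor `t` divides out; the limit `t → 0⁺` isolates the linear
  -- coefficient.
  have hlin : ∀ t : ℝ, 0 < t → t < 1 →
      0 ≤ (-2 * (J : ℝ) + 2 * K - V + U) + t * ((J : ℝ) - 2 * K + L) := by
    intro t ht0 ht1
    have := hmix t ht0 ht1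
    have h3 : 0 ≤ t * ((-2 * (J : ℝ) + 2 * K - V + U) + t * ((J : ℝ) - 2 * K + L)) := by
      nlinarith
    exact nonneg_of_mul_nonneg_right h3 ht0
  have hlim : Tendsto (fun t : ℝ => (-2 * (J : ℝ) + 2 * K - V + U) + t * ((J : ℝ) - 2 * K + L))
      (𝓝[>] 0) (𝓝 (-2 * (J : ℝ) + 2 * K - V + U)) := by
    have : Continuous fun t : ℝ => (-2 * (J : ℝ) + 2 * K - V + U) + t * ((J : ℝ) - 2 * K + L) := by
      fun_prop
    have h := this.tendsto 0
    simp only [zero_mul, add_zero] at h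
    exact h.mono_left nhdsWithin_le_nhds
  have h0 : 0 ≤ -2 * (J : ℝ) + 2 * K - V + U := by
    refine ge_of_tendsto hlim ?_
    filter_upwards [Ioo_mem_nhdsGT (zero_lt_one' ℝ)] with t ht
    exact hlin t ht.1 ht.2
  linarith

/-! ### The Euler–Lagrange conditions -/

theorem measurable_effective (hcont : Continuous Ψ) (hpos : ∀ ω, 0 < Ψ ω) (μ : Measure E3)
    [SFinite μ] : Measurable (effective Ψ μ) :=
  (measurable_potentialConv hcont hpos μ).add (by fun_prop)

theorem lintegral_effective_le (μ ν : Measure E3) :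
    ∫⁻ x, effective Ψ μ x ∂ν ≤ interaction Ψ μ ν + confinement ν := by
  rw [← ENNReal.mul_le_mul_iff_right (a := 2) (by simp) (by simp), lintegral_effective, mul_add]
  gcongr
  exact le_mul_of_one_le_left zero_le (by simp)

theorem energy_isMinimiser_ne_top (hcont : Continuous Ψ) (hpos : ∀ ω, 0 < Ψ ω)
    {μ : ProbabilityMeasure E3} (hμ : IsMinimiser Ψ μ) : energy Ψ μ ≠ ⊤ := by
  obtain ⟨μ₁, h₁⟩ := exists_energy_lt_top hcont hpos
  exact ((hμ μ₁).trans_lt h₁).ne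

/-- The constant `C` is the `μ`-average of the effective potential, and the exceptional set is where
the potential drops below it. A compactly carried measure of finite energy on that set would
contradict the first variation, so the set has capacity zero and `μ` does not charge it. A function
that is at least its own average almost everywhere equals it almost everywhere. -/
theorem IsMinimiser.eulerLagrange (hcont : Continuous Ψ) (hpos : ∀ ω, 0 < Ψ ω)
    (heven : ∀ ω, Ψ (-ω) = Ψ ω) {μ : ProbabilityMeasure E3} (hμ : IsMinimiser Ψ μ) :
    EulerLagrange Ψ μ := by
  have hfin := energy_isMinimiser_ne_top hcont hpos hμ
  have hmeas := measurable_effective hcont hpos (μ : Measure E3)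
  have hJV : interaction Ψ μ μ + confinement (μ : Measure E3) ≠ ⊤ := hfin
  have hC : ∫⁻ x, effective Ψ μ x ∂(μ : Measure E3) ≠ ⊤ :=
    ne_top_of_le_ne_top hJV (lintegral_effective_le _ _)
  have hvar := fun ν hν => hμ.first_variation hcont hpos heven hfin ν hν
  obtain ⟨C, hCeq⟩ : ∃ C : ℝ≥0, (C : ℝ≥0∞) = ∫⁻ x, effective Ψ μ x ∂(μ : Measure E3) :=
    ⟨_, ENNReal.coe_toNNReal hC⟩
  rw [← hCeq] at hvar
  let N : Set E3 := {x | effective Ψ μ x < C}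
  have hN : MeasurableSet N := measurableSet_lt hmeas measurable_const
  have hcap : capacity N = 0 := by
    unfold capacity
    simp only [ENNReal.iSup_eq_zero]
    -- If `ν` had finite Coulomb energy, compactness of `K` would make its confinement finite too,
    -- so `ν` would be an admissible competitor.
    rintro ν ⟨K, hK, hKN, hνK⟩
    by_contra hne
    have hcoul : coulombEnergy (ν : Measure E3) ≠ ⊤ := fun h => hne (by rw [h, ENNReal.inv_top])
    have hνN : ∀ᵐ x ∂(ν : Measure E3), x ∈ K := by
      rw [ae_iff]; exact hνK
    obtain ⟨c, hc, hle⟩ := interaction_le_coulombEnergy hcont hpos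
    have hνJ : interaction Ψ ν ν ≠ ⊤ := ne_top_of_le_ne_top (ENNReal.mul_ne_top hc hcoul) (hle _)
    obtain ⟨R, hR⟩ := hK.isBounded.exists_norm_le
    have hνV : confinement (ν : Measure E3) ≠ ⊤ := by
      refine ne_top_of_le_ne_top (b := ∫⁻ _, ENNReal.ofReal (R ^ 2) ∂(ν : Measure E3))
        (by simp) (lintegral_mono_ae ?_)
      filter_upwards [hνN] with x hx
      exact ENNReal.ofReal_le_ofReal (pow_le_pow_left₀ (norm_nonneg _) (hR x hx) 2)
    have h1 := hvar ν (by rw [energy_eq]; exact ENNReal.add_ne_top.2 ⟨hνJ, hνV⟩)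
    have hlt : ∀ᵐ x ∂(ν : Measure E3), effective Ψ μ x < C := by
      filter_upwards [hνN] with x hx using hKN hx
    have h2 : ∫⁻ x, effective Ψ μ x ∂(ν : Measure E3) < ∫⁻ _, (C : ℝ≥0∞) ∂(ν : Measure E3) := by
      refine lintegral_strict_mono (IsProbabilityMeasure.ne_zero _) (by fun_prop) ?_ hlt
      refine ne_top_of_le_ne_top (b := ∫⁻ _, (C : ℝ≥0∞) ∂(ν : Measure E3)) (by simp) ?_
      exact lintegral_mono_ae (hlt.mono fun _ h => h.le)
    simp only [lintegral_const, measure_univ, mul_one] at h2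
    exact absurd h1 (not_le.2 h2)
  have hμN : (μ : Measure E3) N = 0 := measure_eq_zero_of_capacity_eq_zero hcont hpos
    (ENNReal.add_ne_top.1 hJV).1 hN hcap
  have hge : ∀ᵐ x ∂(μ : Measure E3), (C : ℝ≥0∞) ≤ effective Ψ μ x := by
    have : ∀ᵐ x ∂(μ : Measure E3), x ∉ N := measure_eq_zero_iff_ae_notMem.1 hμN
    filter_upwards [this] with x hx using not_lt.1 hx
  have heq : (fun _ => (C : ℝ≥0∞)) =ᵐ[(μ : Measure E3)] effective Ψ μ := by
    refine ae_eq_of_ae_le_of_lintegral_le hge (by simp) hmeas.aemeasurable ?_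
    simp [hCeq]
  exact ⟨C, heq.mono fun x hx _ => hx.symm, N, hN, hcap, fun x hx => not_lt.1 hx⟩

theorem EulerLagrange.ae_eq {μ : ProbabilityMeasure E3} {C : ℝ≥0}
    (h : ∀ᵐ x ∂(μ : Measure E3), x ∈ (μ : Measure E3).support →
      potentialConv Ψ μ x + ENNReal.ofReal (‖x‖ ^ 2 / 2) = C) :
    ∀ᵐ x ∂(μ : Measure E3), effective Ψ μ x = C := by
  have hs : ∀ᵐ x ∂(μ : Measure E3), x ∈ (μ : Measure E3).support := Measure.support_mem_ae
  filter_upwards [h, hs] with x hx hxs using hx hxs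

/-- As `W * μ ≥ 0`, equality with `C` forces `|x|² / 2 ≤ C`. -/
theorem EulerLagrange.exists_ae_norm_le {μ : ProbabilityMeasure E3} (h : EulerLagrange Ψ μ) :
    ∃ R : ℝ, ∀ᵐ x ∂(μ : Measure E3), ‖x‖ ≤ R := by
  obtain ⟨C, hC, -⟩ := h
  refine ⟨Real.sqrt (2 * C), ?_⟩
  filter_upwards [EulerLagrange.ae_eq hC] with x hx
  have h1 : ENNReal.ofReal (‖x‖ ^ 2 / 2) ≤ ENNReal.ofReal C := by
    rw [ENNReal.ofReal_coe_nnreal, ← hx]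
    exact le_add_self
  have h2 := (ENNReal.ofReal_le_ofReal_iff C.coe_nonneg).1 h1
  exact Real.le_sqrt_of_sq_le (by linarith)

theorem isCompact_support_of_ae_norm_le {μ : Measure E3} {R : ℝ} (h : ∀ᵐ x ∂μ, ‖x‖ ≤ R) :
    IsCompact μ.support := by
  refine (isCompact_closedBall (0 : E3) R).of_isClosed_subset Measure.isClosed_support ?_
  refine Measure.support_subset_of_isClosed Metric.isClosed_closedBall ?_
  filter_upwards [h] with x hx
  simpa using hx

/-- Integrating the conditions against `μ` and against a competitor `ν` of finite energy, which
ignores `N`, gives `2 J(μ, μ) + V(μ) = 2C ≤ 2 J(μ, ν) + V(ν)`, where `V` is the confinement.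
Convexity bounds the right side by `J(μ, μ) + J(ν, ν) + V(ν)`, and one `J(μ, μ)` cancels. -/
theorem EulerLagrange.isMinimiser (hcont : Continuous Ψ) (hpos : ∀ ω, 0 < Ψ ω)
    (hconv : ∀ μ ν : ProbabilityMeasure E3, interaction Ψ μ μ ≠ ⊤ → interaction Ψ ν ν ≠ ⊤ →
      2 * interaction Ψ μ ν ≤ interaction Ψ μ μ + interaction Ψ ν ν)
    {μ : ProbabilityMeasure E3} (h : EulerLagrange Ψ μ) : IsMinimiser Ψ μ := by
  intro ν
  by_cases hν : energy Ψ ν = ⊤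
  · rw [hν]; exact le_top
  have hνJV : interaction Ψ ν ν + confinement (ν : Measure E3) ≠ ⊤ := hν
  obtain ⟨C, hC, N, hN, hcap, hge⟩ := h
  have hae := EulerLagrange.ae_eq hC
  have hint : ∫⁻ x, effective Ψ μ x ∂(μ : Measure E3) = C := by
    rw [lintegral_congr_ae hae]; simp
  have h2C : 2 * interaction Ψ μ μ + confinement (μ : Measure E3) = 2 * (C : ℝ≥0∞) := by
    rw [← lintegral_effective, hint]
  have hJV : 2 * interaction Ψ μ μ + confinement (μ : Measure E3) ≠ ⊤ := by
    rw [h2C]; exact ENNReal.mul_ne_top (by simp) (by simp)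
  have hJ : interaction Ψ μ μ ≠ ⊤ := fun h => (ENNReal.add_ne_top.1 hJV).1 (by rw [h]; simp)
  have hνN : (ν : Measure E3) N = 0 := measure_eq_zero_of_capacity_eq_zero hcont hpos
    (ENNReal.add_ne_top.1 hνJV).1 hN hcap
  have hCν : (C : ℝ≥0∞) ≤ ∫⁻ x, effective Ψ μ x ∂(ν : Measure E3) := by
    have h1 : ∀ᵐ x ∂(ν : Measure E3), (C : ℝ≥0∞) ≤ effective Ψ μ x := by
      filter_upwards [measure_eq_zero_iff_ae_notMem.1 hνN] with x hx using hge x hx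
    calc (C : ℝ≥0∞) = ∫⁻ _, (C : ℝ≥0∞) ∂(ν : Measure E3) := by simp
      _ ≤ _ := lintegral_mono_ae h1
  have h2Cν : 2 * (C : ℝ≥0∞) ≤ 2 * interaction Ψ μ ν + confinement (ν : Measure E3) := by
    rw [← lintegral_effective]
    exact mul_le_mul' le_rfl hCν
  rw [energy_eq, energy_eq]
  refine (ENNReal.add_le_add_iff_left hJ).1 ?_
  calc interaction Ψ μ μ + (interaction Ψ μ μ + confinement (μ : Measure E3))
      = 2 * (C : ℝ≥0∞) := by rw [← h2C]; ring
    _ ≤ 2 * interaction Ψ μ ν + confinement (ν : Measure E3) := h2Cν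
    _ ≤ interaction Ψ μ μ + interaction Ψ ν ν + confinement (ν : Measure E3) :=
        add_le_add (hconv μ ν hJ (ENNReal.add_ne_top.1 hνJV).1) le_rfl
    _ = _ := by ring

/-- At the midpoint of two minimisers the mutual energy dominates the mean of the energies. -/
theorem IsMinimiser.add_interaction_le (hcont : Continuous Ψ) (hpos : ∀ ω, 0 < Ψ ω)
    (heven : ∀ ω, Ψ (-ω) = Ψ ω) {μ ν : ProbabilityMeasure E3} (hμ : IsMinimiser Ψ μ)
    (hν : IsMinimiser Ψ ν) :
    interaction Ψ μ μ + interaction Ψ ν ν ≤ 2 * interaction Ψ μ ν := by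
  have hμfin : interaction Ψ μ μ + confinement (μ : Measure E3) ≠ ⊤ :=
    energy_isMinimiser_ne_top hcont hpos hμ
  have hνfin : interaction Ψ ν ν + confinement (ν : Measure E3) ≠ ⊤ :=
    energy_isMinimiser_ne_top hcont hpos hν
  have hμν : interaction Ψ μ μ + confinement (μ : Measure E3) ≤
    interaction Ψ ν ν + confinement (ν : Measure E3) := hμ ν
  have hνμ : interaction Ψ ν ν + confinement (ν : Measure E3) ≤
    interaction Ψ μ μ + confinement (μ : Measure E3) := hν μ
  have h1 := hμ.first_variation hcont hpos heven hμfin ν hνfin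
  have h2 := hν.first_variation hcont hpos heven hνfin μ hμfin
  rw [← ENNReal.mul_le_mul_iff_right (a := 2) (by simp) (by simp), lintegral_effective,
    lintegral_effective] at h1 h2
  rw [interaction_comm hcont hpos heven (ν : Measure E3) μ] at h2
  have hV := (ENNReal.add_ne_top.1 hμfin).2
  have hU := (ENNReal.add_ne_top.1 hνfin).2
  -- Adding the first variation at `μ` towards `ν` to the one at `ν` towards `μ` puts the same
  -- confinement terms on both sides.
  have hsum : 2 * (interaction Ψ μ μ + interaction Ψ ν ν) +
      (confinement (μ : Measure E3) + confinement (ν : Measure E3)) ≤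
      2 * (2 * interaction Ψ μ ν) +
      (confinement (μ : Measure E3) + confinement (ν : Measure E3)) := by
    calc _ = (2 * interaction Ψ μ μ + confinement (μ : Measure E3)) +
          (2 * interaction Ψ ν ν + confinement (ν : Measure E3)) := by ring
      _ ≤ _ := add_le_add h1 h2
      _ = _ := by ring
  rw [ENNReal.add_le_add_iff_right (ENNReal.add_ne_top.2 ⟨hV, hU⟩)] at hsum
  exact (ENNReal.mul_le_mul_iff_right (by simp) (by simp)).1 hsum

/-! ### Gaussian regularisation of the potential -/

/-- The Gaussian `exp (-|z|² / 2)`. -/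
def gaussian (z : E3) : ℝ := Real.exp (-(‖z‖ ^ 2 / 2))

/-- The (unnormalised) Gaussian measure on `ℝ³`. -/
def gaussianMeasure : Measure E3 := volume.withDensity fun z => ENNReal.ofReal (gaussian z)

theorem continuous_gaussian : Continuous gaussian := by unfold gaussian; fun_prop

theorem gaussian_pos (z : E3) : 0 < gaussian z := Real.exp_pos _

theorem integrable_exp_neg_mul_norm_sq {b : ℝ} (hb : 0 < b) :
    Integrable fun z : E3 => Real.exp (-(b * ‖z‖ ^ 2)) := by
  have h := (GaussianFourier.integrable_cexp_neg_mul_sq_norm_add (V := E3) (b := (b : ℂ))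
    (by simpa using hb) 0 0).norm
  refine h.congr (Eventually.of_forall fun z => ?_)
  simp only [Complex.norm_exp]
  congr 1
  simp [← Complex.ofReal_pow]

theorem integrable_gaussian : Integrable gaussian := by
  refine (integrable_exp_neg_mul_norm_sq (b := 1 / 2) (by norm_num)).congr
    (Eventually.of_forall fun z => ?_)
  simp only [gaussian]
  congr 1
  ring

theorem measurable_ofReal_gaussian : Measurable fun z => ENNReal.ofReal (gaussian z) :=
  ENNReal.measurable_ofReal.comp continuous_gaussian.measurable

theorem lintegral_gaussianMeasure (f : E3 → ℝ≥0∞) :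
    ∫⁻ z, f z ∂gaussianMeasure = ∫⁻ z, ENNReal.ofReal (gaussian z) * f z := by
  unfold gaussianMeasure
  rw [lintegral_withDensity_eq_lintegral_mul_non_measurable _
    measurable_ofReal_gaussian
    (Eventually.of_forall fun _ => ENNReal.ofReal_lt_top)]
  rfl

instance : IsFiniteMeasure gaussianMeasure := by
  refine ⟨?_⟩
  have := lintegral_gaussianMeasure (fun _ => 1)
  simp only [lintegral_one, mul_one] at this
  rw [this]
  exact integrable_gaussian.lintegral_lt_top

theorem gaussianMeasure_univ_ne_zero : gaussianMeasure Set.univ ≠ 0 := by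
  have h := lintegral_gaussianMeasure (fun _ => 1)
  simp only [lintegral_one, mul_one] at h
  rw [h]
  refine (lintegral_pos_iff_support measurable_ofReal_gaussian).2 ?_ |>.ne'
  have : Function.support (fun z : E3 => ENNReal.ofReal (gaussian z)) = Set.univ := by
    ext z
    simp [gaussian_pos z]
  rw [this]
  simp

theorem lintegral_inv_norm_sq_ball_lt_top (r : ℝ) :
    ∫⁻ x in Metric.ball (0 : E3) r, (ENNReal.ofReal (‖x‖ ^ 2))⁻¹ < ⊤ := by
  have hi : IntegrableOn (fun x : E3 => (‖x‖ ^ 2)⁻¹) (Metric.ball 0 r) := by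
    rw [integrableOn_fun_norm_addHaar volume (f := fun t : ℝ => (t ^ 2)⁻¹), finrank_E3]
    have h : IntegrableOn (fun _ : ℝ => (1 : ℝ)) (Set.Ioo 0 r) := by simp
    refine h.congr_fun (fun y hy => ?_) measurableSet_Ioo
    have : y ≠ 0 := hy.1.ne'
    simp only [smul_eq_mul]
    field_simp
  refine lt_of_le_of_lt (le_of_eq (lintegral_congr_ae ?_)) hi.lintegral_lt_top
  filter_upwards [ae_restrict_of_ae (Measure.ae_ne (volume : Measure E3) 0)] with x hx
  have : 0 < ‖x‖ := norm_pos_iff.2 hx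
  exact (ENNReal.ofReal_inv_of_pos (by positivity)).symm

theorem mul_exp_neg_le {t b : ℝ} (hb : 0 < b) : t * Real.exp (-(b * t)) ≤ b⁻¹ := by
  have h1 : b * t ≤ Real.exp (b * t) := by linarith [Real.add_one_le_exp (b * t)]
  have h2 : t ≤ b⁻¹ * Real.exp (b * t) := by
    rw [← mul_le_mul_iff_right₀ hb, ← mul_assoc, mul_inv_cancel₀ hb.ne', one_mul]
    exact h1
  calc t * Real.exp (-(b * t)) ≤ b⁻¹ * Real.exp (b * t) * Real.exp (-(b * t)) := by gcongr
    _ = b⁻¹ := by rw [mul_assoc, ← Real.exp_add]; simp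

theorem norm_sq_mul_gaussian_le (z : E3) : ‖z‖ ^ 2 * gaussian z ≤ 2 := by
  have := mul_exp_neg_le (t := ‖z‖ ^ 2) (b := 1 / 2) (by norm_num)
  have h : gaussian z = Real.exp (-(1 / 2 * ‖z‖ ^ 2)) := by unfold gaussian; congr 1; ring
  rw [h]
  linarith

theorem integrable_norm_sq_mul_gaussian : Integrable fun z : E3 => ‖z‖ ^ 2 * gaussian z := by
  refine ((integrable_exp_neg_mul_norm_sq (b := 1 / 4) (by norm_num)).const_mul 4).mono'
    ((continuous_norm.pow 2).mul continuous_gaussian).aestronglyMeasurable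
    (Eventually.of_forall fun z => ?_)
  have h0 : 0 ≤ ‖z‖ ^ 2 * gaussian z := mul_nonneg (by positivity) (gaussian_pos z).le
  rw [Real.norm_of_nonneg h0]
  have h := mul_exp_neg_le (t := ‖z‖ ^ 2) (b := 1 / 4) (by norm_num)
  have hg : gaussian z = Real.exp (-(1 / 4 * ‖z‖ ^ 2)) * Real.exp (-(1 / 4 * ‖z‖ ^ 2)) := by
    unfold gaussian; rw [← Real.exp_add]; congr 1; ring
  rw [hg, ← mul_assoc]
  refine mul_le_mul_of_nonneg_right ?_ (Real.exp_pos _).le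
  linarith

/-- Within distance `1` of the singularity `-a`, the factor `|z|² exp (-|z|² / 2)` is at most `2`
and `|z + a|⁻²` has an integral independent of `a`; elsewhere `|z + a|⁻² ≤ 1`. -/
theorem exists_lintegral_norm_sq_div_le : ∃ C : ℝ≥0∞, C ≠ ⊤ ∧ ∀ a : E3,
    ∫⁻ z, ENNReal.ofReal (‖z‖ ^ 2) * (ENNReal.ofReal (‖z + a‖ ^ 2))⁻¹ ∂gaussianMeasure ≤ C := by
  let B : Set E3 := Metric.ball 0 1
  let u : E3 → ℝ≥0∞ := B.indicator fun x => (ENNReal.ofReal (‖x‖ ^ 2))⁻¹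
  refine ⟨2 * (∫⁻ x in B, (ENNReal.ofReal (‖x‖ ^ 2))⁻¹) +
    ∫⁻ z : E3, ENNReal.ofReal (‖z‖ ^ 2 * gaussian z), ENNReal.add_ne_top.2
    ⟨ENNReal.mul_ne_top (by simp) (lintegral_inv_norm_sq_ball_lt_top 1).ne,
      integrable_norm_sq_mul_gaussian.lintegral_lt_top.ne⟩, fun a => ?_⟩
  rw [lintegral_gaussianMeasure]
  have hpt : ∀ z : E3, ENNReal.ofReal (gaussian z) *
      (ENNReal.ofReal (‖z‖ ^ 2) * (ENNReal.ofReal (‖z + a‖ ^ 2))⁻¹) ≤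
      2 * u (z + a) + ENNReal.ofReal (‖z‖ ^ 2 * gaussian z) := by
    intro z
    have h1 : ENNReal.ofReal (gaussian z) *
        (ENNReal.ofReal (‖z‖ ^ 2) * (ENNReal.ofReal (‖z + a‖ ^ 2))⁻¹) =
        ENNReal.ofReal (‖z‖ ^ 2 * gaussian z) * (ENNReal.ofReal (‖z + a‖ ^ 2))⁻¹ := by
      rw [ENNReal.ofReal_mul (by positivity)]
      ring
    rw [h1]
    by_cases hz : z + a ∈ B
    · refine le_add_right ?_
      simp only [u, Set.indicator_of_mem hz]
      refine mul_le_mul' ?_ le_rfl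
      calc _ ≤ ENNReal.ofReal 2 := ENNReal.ofReal_le_ofReal (norm_sq_mul_gaussian_le z)
        _ = 2 := by simp
    · refine le_add_left ?_
      refine mul_le_of_le_one_right zero_le ?_
      rw [ENNReal.inv_le_one, ENNReal.one_le_ofReal]
      have : 1 ≤ ‖z + a‖ := by simpa [B] using hz
      exact one_le_pow₀ this
  have hu : Measurable u :=
    ((ENNReal.measurable_ofReal.comp (measurable_norm.pow_const 2)).inv).indicator measurableSet_ball
  calc _ ≤ ∫⁻ z, 2 * u (z + a) + ENNReal.ofReal (‖z‖ ^ 2 * gaussian z) := lintegral_mono hpt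
    _ = 2 * (∫⁻ z, u (z + a)) + ∫⁻ z, ENNReal.ofReal (‖z‖ ^ 2 * gaussian z) := by
        have hua : Measurable fun z => 2 * u (z + a) :=
          (hu.comp (measurable_id.add_const a)).const_mul 2
        rw [lintegral_add_left hua,
          lintegral_const_mul' _ _ (by simp)]
    _ = _ := by
        rw [lintegral_add_right_eq_self (μ := (volume : Measure E3)) u a]
        congr 2
        exact lintegral_indicator measurableSet_ball _

/-- This is `|x|² ≤ 2 |x + s z|² + 2 s² |z|²` divided by `|x|² |x + s z|²`. Since `x + s z = s (z +
x/s)`, the scale survives only in the shift, against which the preceding bound is uniform. -/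
theorem inv_norm_add_smul_sq_le {s : ℝ} (hs : 0 < s) {x : E3} (hx : x ≠ 0) (z : E3) :
    (ENNReal.ofReal (‖x + s • z‖ ^ 2))⁻¹ ≤ (ENNReal.ofReal (‖x‖ ^ 2))⁻¹ *
      (2 + 2 * (ENNReal.ofReal (‖z‖ ^ 2) * (ENNReal.ofReal (‖z + s⁻¹ • x‖ ^ 2))⁻¹)) := by
  have hx' : 0 < ‖x‖ := norm_pos_iff.2 hx
  have hxz : x + s • z = s • (z + s⁻¹ • x) := by
    rw [smul_add, smul_smul, mul_inv_cancel₀ hs.ne', one_smul, add_comm]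
  by_cases h0 : z + s⁻¹ • x = 0
  · have hz : z ≠ 0 := by
      rintro rfl
      rw [zero_add, smul_eq_zero] at h0
      exact h0.elim (inv_ne_zero hs.ne') hx
    have hz' : 0 < ‖z‖ := norm_pos_iff.2 hz
    have h2 : ENNReal.ofReal (‖z‖ ^ 2) ≠ 0 := (ENNReal.ofReal_pos.2 (by positivity)).ne'
    have h3 : (ENNReal.ofReal (‖x‖ ^ 2))⁻¹ ≠ 0 := ENNReal.inv_ne_zero.2 ENNReal.ofReal_ne_top
    rw [h0]
    simp only [norm_zero, ne_eq, OfNat.ofNat_ne_zero, not_false_eq_true, zero_pow,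
      ENNReal.ofReal_zero, ENNReal.inv_zero, ENNReal.mul_top h2]
    rw [ENNReal.mul_top (by simp), add_top, ENNReal.mul_top h3]
    exact le_top
  · have hr : 0 < ‖z + s⁻¹ • x‖ := norm_pos_iff.2 h0
    have hn : ‖x + s • z‖ = s * ‖z + s⁻¹ • x‖ := by rw [hxz, norm_smul, Real.norm_of_nonneg hs.le]
    have htri : ‖x‖ ≤ s * ‖z + s⁻¹ • x‖ + s * ‖z‖ := by
      have h := norm_sub_le (x + s • z) (s • z)
      rwa [add_sub_cancel_right, hn, norm_smul, Real.norm_of_nonneg hs.le] at h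
    rw [hn]
    generalize ‖z + s⁻¹ • x‖ = r at *
    rw [← ENNReal.ofReal_inv_of_pos (by positivity), ← ENNReal.ofReal_inv_of_pos (by positivity),
      ← ENNReal.ofReal_inv_of_pos (by positivity), ← ENNReal.ofReal_mul (by positivity)]
    generalize ‖z‖ = y at *
    generalize ‖x‖ = w at *
    have h2 : ∀ q : ℝ, 0 ≤ q → (2 : ℝ≥0∞) + 2 * ENNReal.ofReal q = ENNReal.ofReal (2 + 2 * q) := by
      intro q hq
      rw [ENNReal.ofReal_add (by norm_num) (by positivity), ENNReal.ofReal_mul (by norm_num)]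
      simp
    rw [h2 _ (by positivity), ← ENNReal.ofReal_mul (by positivity)]
    refine ENNReal.ofReal_le_ofReal ?_
    have h4 : w ^ 2 ≤ s ^ 2 * (2 * r ^ 2 + 2 * y ^ 2) := by
      have : w ^ 2 ≤ (s * r + s * y) ^ 2 := pow_le_pow_left₀ hx'.le htri 2
      nlinarith [sq_nonneg (s * r - s * y)]
    rw [inv_mul_eq_div, le_div_iff₀ (by positivity), inv_mul_eq_div, div_le_iff₀ (by positivity)]
    calc w ^ 2 ≤ s ^ 2 * (2 * r ^ 2 + 2 * y ^ 2) := h4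
      _ = _ := by field_simp

/-- The regularised potential `∫ W(x + s z) exp (-|z|² / 2) dz`. -/
def smoothed (Ψ : S2 → ℝ) (s : ℝ) (x : E3) : ℝ≥0∞ :=
  ∫⁻ z, potential Ψ (x + s • z) ∂gaussianMeasure

theorem continuous_potential_add_smul (hcont : Continuous Ψ) (hpos : ∀ ω, 0 < Ψ ω) (s : ℝ) :
    Continuous fun p : E3 × E3 => potential Ψ (p.1 + s • p.2) :=
  (continuous_potential hcont hpos).comp (by fun_prop)

theorem measurable_smoothed (hcont : Continuous Ψ) (hpos : ∀ ω, 0 < Ψ ω) (s : ℝ) :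
    Measurable (smoothed Ψ s) :=
  (continuous_potential_add_smul hcont hpos s).measurable.lintegral_prod_right'

/-- A second-moment bound uniform in `s`. It supplies the uniform integrability needed to pass to
the limit `s → 0` and a majorant for the averages. -/
theorem exists_lintegral_potential_sq_le (hcont : Continuous Ψ) (hpos : ∀ ω, 0 < Ψ ω) :
    ∃ C : ℝ≥0∞, C ≠ ⊤ ∧ ∀ s : ℝ, 0 < s → ∀ x : E3, x ≠ 0 →
      ∫⁻ z, potential Ψ (x + s • z) ^ 2 ∂gaussianMeasure ≤ C * potential Ψ x ^ 2 := by
  obtain ⟨m, M, hm, hM, h⟩ := exists_profile_bounds hcont hpos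
  obtain ⟨C, hC, hCle⟩ := exists_lintegral_norm_sq_div_le
  have hm0 : ENNReal.ofReal m ≠ 0 := (ENNReal.ofReal_pos.2 hm).ne'
  have hmt : ENNReal.ofReal m ≠ ⊤ := ENNReal.ofReal_ne_top
  have hsq : ∀ x : E3, (ENNReal.ofReal (‖x‖ ^ 2))⁻¹ = ((ENNReal.ofReal ‖x‖)⁻¹) ^ 2 := by
    intro x
    rw [ENNReal.ofReal_pow (norm_nonneg _), ENNReal.inv_pow]
  let A : ℝ≥0∞ := 2 * gaussianMeasure Set.univ + 2 * C
  have hA : A ≠ ⊤ := ENNReal.add_ne_top.2 ⟨ENNReal.mul_ne_top (by simp) (measure_ne_top _ _),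
    ENNReal.mul_ne_top (by simp) hC⟩
  refine ⟨ENNReal.ofReal M ^ 2 * A * (ENNReal.ofReal m)⁻¹ ^ 2, ?_, fun s hs x hx => ?_⟩
  · exact ENNReal.mul_ne_top (ENNReal.mul_ne_top (ENNReal.pow_ne_top ENNReal.ofReal_ne_top) hA)
      (ENNReal.pow_ne_top (ENNReal.inv_ne_top.2 hm0))
  have hxinv : (ENNReal.ofReal (‖x‖ ^ 2))⁻¹ ≤ (ENNReal.ofReal m)⁻¹ ^ 2 * potential Ψ x ^ 2 := by
    rw [hsq, ← mul_pow]
    refine pow_le_pow_left₀ zero_le ?_ 2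
    calc (ENNReal.ofReal ‖x‖)⁻¹
        = (ENNReal.ofReal m)⁻¹ * (ENNReal.ofReal m * (ENNReal.ofReal ‖x‖)⁻¹) := by
          rw [← mul_assoc, ENNReal.inv_mul_cancel hm0 hmt, one_mul]
      _ ≤ _ := mul_le_mul' le_rfl (mul_inv_norm_le_potential hm (fun ω => (h ω).1) _)
  have hxt : (ENNReal.ofReal (‖x‖ ^ 2))⁻¹ ≠ ⊤ :=
    ENNReal.inv_ne_top.2 (ENNReal.ofReal_pos.2 (pow_pos (norm_pos_iff.2 hx) 2)).ne'
  calc ∫⁻ z, potential Ψ (x + s • z) ^ 2 ∂gaussianMeasure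
      ≤ ∫⁻ z, ENNReal.ofReal M ^ 2 * ((ENNReal.ofReal (‖x‖ ^ 2))⁻¹ *
        (2 + 2 * (ENNReal.ofReal (‖z‖ ^ 2) * (ENNReal.ofReal (‖z + s⁻¹ • x‖ ^ 2))⁻¹)))
          ∂gaussianMeasure := by
        refine lintegral_mono fun z => ?_
        calc potential Ψ (x + s • z) ^ 2
            ≤ (ENNReal.ofReal M * (ENNReal.ofReal ‖x + s • z‖)⁻¹) ^ 2 :=
              pow_le_pow_left₀ zero_le (potential_le_mul_inv_norm hM (fun ω => (h ω).2) _) 2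
          _ = ENNReal.ofReal M ^ 2 * (ENNReal.ofReal (‖x + s • z‖ ^ 2))⁻¹ := by
              rw [mul_pow, ← hsq]
          _ ≤ _ := mul_le_mul' le_rfl (inv_norm_add_smul_sq_le hs hx z)
    _ = ENNReal.ofReal M ^ 2 * ((ENNReal.ofReal (‖x‖ ^ 2))⁻¹ * (2 * gaussianMeasure Set.univ +
        2 * ∫⁻ z, ENNReal.ofReal (‖z‖ ^ 2) * (ENNReal.ofReal (‖z + s⁻¹ • x‖ ^ 2))⁻¹
          ∂gaussianMeasure)) := by
        rw [lintegral_const_mul' _ _ (ENNReal.pow_ne_top ENNReal.ofReal_ne_top),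
          lintegral_const_mul' _ _ hxt, lintegral_add_left measurable_const,
          lintegral_const_mul' _ _ (by simp), lintegral_const]
    _ ≤ ENNReal.ofReal M ^ 2 * (((ENNReal.ofReal m)⁻¹ ^ 2 * potential Ψ x ^ 2) * A) :=
        mul_le_mul' le_rfl (mul_le_mul' hxinv (add_le_add le_rfl (mul_le_mul' le_rfl (hCle _))))
    _ = _ := by ring

theorem le_min_add_inv_mul_sq (w : ℝ≥0∞) {K : ℝ≥0∞} (hK0 : K ≠ 0) (hKt : K ≠ ⊤) :
    w ≤ min w K + K⁻¹ * w ^ 2 := by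
  rcases le_total w K with h | h
  · rw [min_eq_left h]; exact le_self_add
  · refine le_add_left ?_
    calc w = K⁻¹ * (K * w) := by rw [← mul_assoc, ENNReal.inv_mul_cancel hK0 hKt, one_mul]
      _ ≤ K⁻¹ * (w * w) := mul_le_mul' le_rfl (mul_le_mul' h le_rfl)
      _ = _ := by rw [sq]

theorem potential_ne_top {x : E3} (hx : x ≠ 0) : potential Ψ x ≠ ⊤ := by
  rw [potential_of_ne hx]; exact ENNReal.ofReal_ne_top

theorem potential_ne_zero (hpos : ∀ ω, 0 < Ψ ω) (x : E3) : potential Ψ x ≠ 0 := by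
  by_cases hx : x = 0
  · simp [hx, potential_zero]
  · rw [potential_of_ne hx]
    exact (ENNReal.ofReal_pos.2 (mul_pos (inv_pos.2 (norm_pos_iff.2 hx)) (hpos _))).ne'

theorem exists_smoothed_le (hcont : Continuous Ψ) (hpos : ∀ ω, 0 < Ψ ω) :
    ∃ C : ℝ≥0∞, C ≠ ⊤ ∧ ∀ s : ℝ, 0 < s → ∀ x : E3, smoothed Ψ s x ≤ C * potential Ψ x := by
  obtain ⟨C, hC, hle⟩ := exists_lintegral_potential_sq_le hcont hpos
  refine ⟨gaussianMeasure Set.univ + C, ENNReal.add_ne_top.2 ⟨measure_ne_top _ _, hC⟩,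
    fun s hs x => ?_⟩
  by_cases hx : x = 0
  · rw [hx, potential_zero, ENNReal.mul_top]
    · exact le_top
    · exact fun h => gaussianMeasure_univ_ne_zero (add_eq_zero.1 h).1
  have h0 := potential_ne_zero hpos x
  have ht : potential Ψ x ≠ ⊤ := potential_ne_top hx
  -- The truncation level is `W(x)` itself, so that both the truncated part and the tail scale like
  -- `W(x)`.
  calc smoothed Ψ s x ≤ ∫⁻ z, potential Ψ x + (potential Ψ x)⁻¹ * potential Ψ (x + s • z) ^ 2
        ∂gaussianMeasure := lintegral_mono fun z =>
          (le_min_add_inv_mul_sq _ h0 ht).trans (add_le_add (min_le_right _ _) le_rfl)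
    _ = potential Ψ x * gaussianMeasure Set.univ +
        (potential Ψ x)⁻¹ * ∫⁻ z, potential Ψ (x + s • z) ^ 2 ∂gaussianMeasure := by
        rw [lintegral_add_left measurable_const, lintegral_const,
          lintegral_const_mul' _ _ (ENNReal.inv_ne_top.2 h0)]
    _ ≤ potential Ψ x * gaussianMeasure Set.univ +
        (potential Ψ x)⁻¹ * (C * potential Ψ x ^ 2) := by
        exact add_le_add le_rfl (mul_le_mul' le_rfl (hle s hs x hx))
    _ = (gaussianMeasure Set.univ + C * ((potential Ψ x)⁻¹ * potential Ψ x)) * potential Ψ x := by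
        ring
    _ = _ := by rw [ENNReal.inv_mul_cancel h0 ht, mul_one]

theorem le_liminf_smoothed (hcont : Continuous Ψ) (hpos : ∀ ω, 0 < Ψ ω) {s : ℕ → ℝ}
    (hs : Tendsto s atTop (𝓝 0)) (x : E3) :
    gaussianMeasure Set.univ * potential Ψ x ≤ liminf (fun n => smoothed Ψ (s n) x) atTop := by
  have hlim : ∀ z, Tendsto (fun n => potential Ψ (x + s n • z)) atTop (𝓝 (potential Ψ x)) := by
    intro z
    have h : Tendsto (fun n => x + s n • z) atTop (𝓝 (x + (0 : ℝ) • z)) :=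
      tendsto_const_nhds.add (hs.smul_const z)
    rw [zero_smul, add_zero] at h
    exact ((continuous_potential hcont hpos).tendsto x).comp h
  calc gaussianMeasure Set.univ * potential Ψ x
      = ∫⁻ z, liminf (fun n => potential Ψ (x + s n • z)) atTop ∂gaussianMeasure := by
        simp_rw [(hlim _).liminf_eq]
        rw [lintegral_const, mul_comm]
    _ ≤ _ := lintegral_liminf_le fun n =>
        ((continuous_potential hcont hpos).comp (by fun_prop)).measurable

theorem tendsto_smoothed (hcont : Continuous Ψ) (hpos : ∀ ω, 0 < Ψ ω) {s : ℕ → ℝ}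
    (hs : Tendsto s atTop (𝓝 0)) (hs0 : ∀ n, 0 < s n) {x : E3} (hx : x ≠ 0) :
    Tendsto (fun n => smoothed Ψ (s n) x) atTop
      (𝓝 (gaussianMeasure Set.univ * potential Ψ x)) := by
  refine tendsto_of_le_liminf_of_limsup_le (le_liminf_smoothed hcont hpos hs x) ?_
  obtain ⟨C, hC, hle⟩ := exists_lintegral_potential_sq_le hcont hpos
  have ht : potential Ψ x ≠ ⊤ := potential_ne_top hx
  have hlim : ∀ z, Tendsto (fun n => potential Ψ (x + s n • z)) atTop (𝓝 (potential Ψ x)) := by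
    intro z
    have h : Tendsto (fun n => x + s n • z) atTop (𝓝 (x + (0 : ℝ) • z)) :=
      tendsto_const_nhds.add (hs.smul_const z)
    rw [zero_smul, add_zero] at h
    exact ((continuous_potential hcont hpos).tendsto x).comp h
  have hmeas : ∀ n, Measurable fun z => potential Ψ (x + s n • z) := fun n =>
    ((continuous_potential hcont hpos).comp (by fun_prop)).measurable
  -- The part truncated at level `K + 1` converges by dominated convergence; the second-moment bound
  -- makes the tail `O(1 / (K + 1))`, uniformly in `n`.
  have hK : ∀ K : ℕ, limsup (fun n => smoothed Ψ (s n) x) atTop ≤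
      gaussianMeasure Set.univ * potential Ψ x +
        ((K + 1 : ℕ) : ℝ≥0∞)⁻¹ * (C * potential Ψ x ^ 2) := by
    intro K
    have hK0 : ((K + 1 : ℕ) : ℝ≥0∞) ≠ 0 := by simp
    have hKt : ((K + 1 : ℕ) : ℝ≥0∞) ≠ ⊤ := ENNReal.natCast_ne_top _
    have h1 : Tendsto (fun n => ∫⁻ z, min (potential Ψ (x + s n • z)) ((K + 1 : ℕ) : ℝ≥0∞)
        ∂gaussianMeasure) atTop
        (𝓝 (∫⁻ _, min (potential Ψ x) ((K + 1 : ℕ) : ℝ≥0∞) ∂gaussianMeasure)) := by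
      refine tendsto_lintegral_of_dominated_convergence (fun _ => ((K + 1 : ℕ) : ℝ≥0∞))
        (fun n => (hmeas n).min measurable_const)
        (fun n => Eventually.of_forall fun z => min_le_right _ _) ?_
        (Eventually.of_forall fun z => (hlim z).min tendsto_const_nhds)
      rw [lintegral_const]
      exact ENNReal.mul_ne_top hKt (measure_ne_top _ _)
    have h2 : ∀ n, smoothed Ψ (s n) x ≤
        (∫⁻ z, min (potential Ψ (x + s n • z)) ((K + 1 : ℕ) : ℝ≥0∞) ∂gaussianMeasure) +
        ((K + 1 : ℕ) : ℝ≥0∞)⁻¹ * (C * potential Ψ x ^ 2) := by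
      intro n
      calc smoothed Ψ (s n) x ≤ ∫⁻ z, min (potential Ψ (x + s n • z)) ((K + 1 : ℕ) : ℝ≥0∞) +
            ((K + 1 : ℕ) : ℝ≥0∞)⁻¹ * potential Ψ (x + s n • z) ^ 2 ∂gaussianMeasure :=
            lintegral_mono fun z => le_min_add_inv_mul_sq _ hK0 hKt
        _ = _ := by
            rw [lintegral_add_left ((hmeas n).min measurable_const),
              lintegral_const_mul' _ _ (ENNReal.inv_ne_top.2 hK0)]
        _ ≤ _ := add_le_add le_rfl (mul_le_mul' le_rfl (hle _ (hs0 n) x hx))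
    refine (limsup_le_limsup (Eventually.of_forall h2)).trans ?_
    rw [(h1.add_const _).limsup_eq]
    refine add_le_add ?_ le_rfl
    rw [lintegral_const, mul_comm]
    exact mul_le_mul' le_rfl (min_le_left _ _)
  have hlimK : Tendsto (fun K : ℕ => gaussianMeasure Set.univ * potential Ψ x +
      ((K + 1 : ℕ) : ℝ≥0∞)⁻¹ * (C * potential Ψ x ^ 2)) atTop
      (𝓝 (gaussianMeasure Set.univ * potential Ψ x)) := by
    have h1 : Tendsto (fun K : ℕ => ((K + 1 : ℕ) : ℝ≥0∞)⁻¹) atTop (𝓝 0) :=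
      ENNReal.tendsto_inv_nat_nhds_zero.comp (tendsto_add_atTop_nat 1)
    have h2 := ENNReal.Tendsto.mul_const (b := C * potential Ψ x ^ 2) h1
      (Or.inr (ENNReal.mul_ne_top hC (ENNReal.pow_ne_top ht)))
    rw [zero_mul] at h2
    simpa using tendsto_const_nhds (x := gaussianMeasure Set.univ * potential Ψ x) |>.add h2
  exact ge_of_tendsto' hlimK hK

/-! ### Positivity of the interaction in Fourier variables -/

/-- `F` represents the Fourier transform of the potential, tested against all bounded continuous
integrable functions with integrable Fourier transform. -/
structure HasFourierProfile (Ψ : S2 → ℝ) (F : E3 → ℝ) : Prop where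
  continuousOn : ContinuousOn F {0}ᶜ
  homogeneous : ∀ t : ℝ, 0 < t → ∀ ξ, F (t • ξ) = (t ^ 2)⁻¹ * F ξ
  map_zero : F 0 = 0
  pairing : ∀ φ : E3 → ℂ, Continuous φ → (∃ B, ∀ x, ‖φ x‖ ≤ B) → Integrable φ →
    Integrable (fourier φ) →
    Integrable (fun x => (((potential Ψ x).toReal : ℝ) : ℂ) * fourier φ x) ∧
    Integrable (fun ξ => (F ξ : ℂ) * φ ξ) ∧
    ∫ x, (((potential Ψ x).toReal : ℝ) : ℂ) * fourier φ x = ∫ ξ, (F ξ : ℂ) * φ ξ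

/-- The function `exp (-s² |ξ|² / 2 + i x·ξ)`. -/
def gaussianWave (s : ℝ) (x ξ : E3) : ℂ :=
  Complex.exp (-((s ^ 2 / 2 : ℝ) : ℂ) * (‖ξ‖ : ℂ) ^ 2 + Complex.I * ((inner ℝ x ξ : ℝ) : ℂ))

theorem integrable_gaussianWave {s : ℝ} (hs : 0 < s) (x : E3) :
    Integrable (gaussianWave s x) :=
  GaussianFourier.integrable_cexp_neg_mul_sq_norm_add
    (by rw [Complex.ofReal_re]; positivity) Complex.I x

theorem gaussianWave_eq (s : ℝ) (x ξ : E3) : gaussianWave s x ξ =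
    ((Real.exp (-(s ^ 2 / 2 * ‖ξ‖ ^ 2)) : ℝ) : ℂ) *
      Complex.exp (Complex.I * ((inner ℝ x ξ : ℝ) : ℂ)) := by
  unfold gaussianWave
  rw [Complex.exp_add]
  congr 1
  push_cast
  congr 1
  ring

theorem norm_gaussianWave (s : ℝ) (x ξ : E3) :
    ‖gaussianWave s x ξ‖ = Real.exp (-(s ^ 2 / 2 * ‖ξ‖ ^ 2)) := by
  rw [gaussianWave_eq, norm_mul, mul_comm Complex.I, Complex.norm_exp_ofReal_mul_I, mul_one,
    Complex.norm_real, Real.norm_of_nonneg (Real.exp_pos _).le]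

/-- The transform is a Gaussian of width `s` centred at `x`, so pairing `W` with it produces the
regularised potential at `x`. -/
theorem fourier_gaussianWave {s : ℝ} (hs : 0 < s) (x y : E3) :
    fourier (gaussianWave s x) y = (((s ^ 3)⁻¹ * gaussian (s⁻¹ • (y - x)) : ℝ) : ℂ) := by
  have hb : 0 < (((s ^ 2 / 2 : ℝ) : ℂ)).re := by rw [Complex.ofReal_re]; positivity
  have h1 : ∀ v : E3, gaussianWave s x v * Complex.exp (-(Complex.I * ((inner ℝ y v : ℝ) : ℂ))) =
      Complex.exp (-((s ^ 2 / 2 : ℝ) : ℂ) * (‖v‖ : ℂ) ^ 2 +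
        Complex.I * ((inner ℝ (x - y) v : ℝ) : ℂ)) := by
    intro v
    unfold gaussianWave
    rw [← Complex.exp_add, inner_sub_left]
    congr 1
    push_cast
    ring
  unfold fourier
  simp_rw [h1]
  rw [GaussianFourier.integral_cexp_neg_mul_sq_norm_add hb Complex.I (x - y), finrank_E3,
    ← mul_assoc]
  have h2 : ((Real.pi : ℂ) / ((s ^ 2 / 2 : ℝ) : ℂ)) ^ (((3 : ℕ) : ℂ) / 2) =
      (((2 * Real.pi / s ^ 2) ^ (3 / 2 : ℝ) : ℝ) : ℂ) := by
    rw [Complex.ofReal_cpow (by positivity)]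
    congr 1
    · push_cast
      field_simp
    · push_cast; rfl
  have h3 : (2 * Real.pi) ^ (-(3 / 2) : ℝ) * (2 * Real.pi / s ^ 2) ^ (3 / 2 : ℝ) = (s ^ 3)⁻¹ := by
    rw [Real.div_rpow (by positivity) (by positivity), Real.rpow_neg (by positivity)]
    have h4 : (s ^ 2) ^ (3 / 2 : ℝ) = s ^ 3 := by
      rw [← Real.rpow_natCast s 2, ← Real.rpow_mul hs.le, ← Real.rpow_natCast s 3]
      norm_num
    rw [h4]
    have h5 : (2 * Real.pi) ^ (3 / 2 : ℝ) ≠ 0 := (Real.rpow_pos_of_pos (by positivity) _).ne'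
    field_simp
  rw [h2, ← Complex.ofReal_mul, h3, Complex.ofReal_mul]
  congr 1
  unfold gaussian
  rw [Complex.ofReal_exp]
  congr 1
  rw [norm_smul, norm_inv, Real.norm_of_nonneg hs.le, norm_sub_rev y x]
  push_cast
  rw [Complex.I_sq]
  have : (s : ℂ) ≠ 0 := by exact_mod_cast hs.ne'
  field_simp
  ring

theorem integrable_fourier_gaussianWave {s : ℝ} (hs : 0 < s) (x : E3) :
    Integrable (fourier (gaussianWave s x)) := by
  have h : fourier (gaussianWave s x) =
      fun y => (((s ^ 3)⁻¹ * gaussian (s⁻¹ • (y - x)) : ℝ) : ℂ) :=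
    funext fun y => fourier_gaussianWave hs x y
  rw [h]
  have h1 : Integrable fun y : E3 => gaussian (s⁻¹ • y) :=
    integrable_gaussian.comp_smul (inv_ne_zero hs.ne')
  exact ((h1.comp_sub_right x).const_mul _).ofReal

theorem HasFourierProfile.pairing_gaussianWave {F : E3 → ℝ} (hF : HasFourierProfile Ψ F) {s : ℝ}
    (hs : 0 < s) (x : E3) :
    Integrable (fun y => (((potential Ψ y).toReal : ℝ) : ℂ) * fourier (gaussianWave s x) y) ∧
    Integrable (fun ξ => (F ξ : ℂ) * gaussianWave s x ξ) ∧
    ∫ y, (((potential Ψ y).toReal : ℝ) : ℂ) * fourier (gaussianWave s x) y =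
      ∫ ξ, (F ξ : ℂ) * gaussianWave s x ξ := by
  refine hF.pairing _ ?_ ⟨1, fun ξ => ?_⟩ (integrable_gaussianWave hs x)
    (integrable_fourier_gaussianWave hs x)
  · unfold gaussianWave; fun_prop
  · rw [norm_gaussianWave, Real.exp_le_one_iff]
    have : 0 ≤ s ^ 2 / 2 * ‖ξ‖ ^ 2 := by positivity
    linarith

/-- The density `F(ξ) exp (-s² |ξ|² / 2)` of the regularised interaction in Fourier variables. -/
def fourierWeight (F : E3 → ℝ) (s : ℝ) (ξ : E3) : ℝ := F ξ * Real.exp (-(s ^ 2 / 2 * ‖ξ‖ ^ 2))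

theorem HasFourierProfile.integrable_fourierWeight {F : E3 → ℝ} (hF : HasFourierProfile Ψ F)
    {s : ℝ} (hs : 0 < s) : Integrable (fourierWeight F s) := by
  refine (hF.pairing_gaussianWave hs 0).2.1.re.congr (Eventually.of_forall fun ξ => ?_)
  simp [fourierWeight, gaussianWave_eq, ← Complex.ofReal_mul, -Complex.ofReal_exp]

/-- The substitution `y = x + s z` absorbs the factor `s⁻³`, and real parts turn the wave into a
cosine. The regularised potential is thus a superposition of cosines with an integrable density. -/
theorem HasFourierProfile.smoothed_eq {F : E3 → ℝ} (hF : HasFourierProfile Ψ F) {s : ℝ}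
    (hs : 0 < s) (x : E3) : smoothed Ψ s x ≠ ⊤ ∧
    (smoothed Ψ s x).toReal = ∫ ξ, fourierWeight F s ξ * Real.cos (inner ℝ x ξ) := by
  obtain ⟨h1, h2, h3⟩ := hF.pairing_gaussianWave hs x
  let q : E3 → ℝ := fun y => (potential Ψ y).toReal * gaussian (s⁻¹ • (y - x))
  have hq : ∀ y, (((potential Ψ y).toReal : ℝ) : ℂ) * fourier (gaussianWave s x) y =
      (((s ^ 3)⁻¹ * q y : ℝ) : ℂ) := by
    intro y
    rw [fourier_gaussianWave hs, ← Complex.ofReal_mul]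
    congr 1
    simp only [q]
    ring
  simp_rw [hq] at h1 h3
  have hs3 : (s ^ 3)⁻¹ ≠ 0 := by positivity
  have hqi : Integrable q := by
    have := h1.re
    simp only [RCLike.re_to_complex, Complex.ofReal_re] at this
    exact (integrable_const_mul_iff (IsUnit.mk0 _ hs3) _).1 this
  let r : E3 → ℝ := fun z => (potential Ψ (x + s • z)).toReal * gaussian z
  have hr : r = fun z => q (x + s • z) := by
    ext z
    simp [r, q, smul_smul, inv_mul_cancel₀ hs.ne']
  have hri : Integrable r := by
    rw [hr]
    exact (hqi.comp_add_left x).comp_smul hs.ne'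
  have hint : ∫ z, r z = (s ^ 3)⁻¹ * ∫ y, q y := by
    rw [hr, Measure.integral_comp_smul_of_nonneg volume (fun w => q (x + w)) s (hR := hs.le),
      integral_add_left_eq_self q x, finrank_E3, smul_eq_mul]
  have hsm : smoothed Ψ s x = ∫⁻ z, ENNReal.ofReal (r z) := by
    unfold smoothed
    rw [lintegral_gaussianMeasure]
    refine lintegral_congr_ae ?_
    filter_upwards [Measure.ae_ne (volume : Measure E3) (-(s⁻¹ • x))] with z hz
    have hne : x + s • z ≠ 0 := by
      intro h
      apply hz
      have : s⁻¹ • (x + s • z) = 0 := by rw [h, smul_zero]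
      rw [smul_add, smul_smul, inv_mul_cancel₀ hs.ne', one_smul] at this
      exact eq_neg_of_add_eq_zero_right this
    simp only [r]
    rw [ENNReal.ofReal_mul ENNReal.toReal_nonneg, ENNReal.ofReal_toReal (potential_ne_top hne),
      mul_comm]
  have hr0 : 0 ≤ᵐ[volume] r := Eventually.of_forall fun z =>
    mul_nonneg ENNReal.toReal_nonneg (gaussian_pos z).le
  rw [hsm]
  refine ⟨hri.lintegral_lt_top.ne, ?_⟩
  rw [← integral_eq_lintegral_of_nonneg_ae hr0 hri.aestronglyMeasurable, hint,
    ← integral_const_mul]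
  have h4 : ((∫ y, (s ^ 3)⁻¹ * q y : ℝ) : ℂ) = ∫ ξ, (F ξ : ℂ) * gaussianWave s x ξ := by
    rw [← h3, ← integral_complex_ofReal]
  have h5 := congrArg Complex.re h4
  rw [Complex.ofReal_re] at h5
  rw [h5, ← RCLike.re_to_complex, ← integral_re h2]
  refine integral_congr_ae (Eventually.of_forall fun ξ => ?_)
  simp only [RCLike.re_to_complex]
  rw [gaussianWave_eq, ← mul_assoc, ← Complex.ofReal_mul, Complex.re_ofReal_mul,
    mul_comm Complex.I, Complex.exp_ofReal_mul_I_re]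
  rfl

/-! ### Energies through characteristic functions, and the limit of vanishing regularisation -/

/-- The interaction energy of the regularised potential. -/
def smoothedInteraction (Ψ : S2 → ℝ) (s : ℝ) (μ ν : Measure E3) : ℝ≥0∞ :=
  ∫⁻ p, smoothed Ψ s (p.1 - p.2) ∂(ν.prod μ)

theorem integral_cos_inner_sub (μ ν : Measure E3) [IsProbabilityMeasure μ]
    [IsProbabilityMeasure ν] (ξ : E3) :
    ∫ p : E3 × E3, Real.cos (inner ℝ (p.1 - p.2) ξ) ∂(ν.prod μ) =
      (charFun ν ξ * (starRingEnd ℂ) (charFun μ ξ)).re := by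
  have h : ∀ p : E3 × E3, Complex.exp (((inner ℝ (p.1 - p.2) ξ : ℝ) : ℂ) * Complex.I) =
      Complex.exp (((inner ℝ p.1 ξ : ℝ) : ℂ) * Complex.I) *
      Complex.exp (((inner ℝ p.2 (-ξ) : ℝ) : ℂ) * Complex.I) := by
    intro p
    rw [← Complex.exp_add, inner_sub_left, inner_neg_right]
    congr 1
    push_cast
    ring
  have hi : Integrable (fun p : E3 × E3 =>
      Complex.exp (((inner ℝ (p.1 - p.2) ξ : ℝ) : ℂ) * Complex.I)) (ν.prod μ) := by
    refine Integrable.of_bound (C := 1) (Continuous.aestronglyMeasurable (by fun_prop))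
      (Eventually.of_forall fun p => ?_)
    rw [Complex.norm_exp_ofReal_mul_I]
  rw [← charFun_neg, charFun_apply, charFun_apply, ← integral_prod_mul, ← RCLike.re_to_complex]
  simp_rw [← h]
  rw [← integral_re hi]
  refine integral_congr_ae (Eventually.of_forall fun p => ?_)
  simp only [RCLike.re_to_complex]
  rw [Complex.exp_ofReal_mul_I_re]

theorem HasFourierProfile.smoothedInteraction_eq (hcont : Continuous Ψ) (hpos : ∀ ω, 0 < Ψ ω)
    {F : E3 → ℝ} (hF : HasFourierProfile Ψ F) {s : ℝ} (hs : 0 < s) (μ ν : Measure E3)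
    [IsProbabilityMeasure μ] [IsProbabilityMeasure ν] :
    smoothedInteraction Ψ s μ ν ≠ ⊤ ∧ (smoothedInteraction Ψ s μ ν).toReal =
      ∫ ξ, fourierWeight F s ξ * (charFun ν ξ * (starRingEnd ℂ) (charFun μ ξ)).re := by
  have hw := hF.integrable_fourierWeight hs
  have hmeas : Measurable fun p : E3 × E3 => smoothed Ψ s (p.1 - p.2) :=
    (measurable_smoothed hcont hpos s).comp (measurable_fst.sub measurable_snd)
  -- The regularised potential is bounded by the `L¹` norm of its Fourier density, so its energy is
  -- finite for all probability measures.
  have hbound : ∀ x, smoothed Ψ s x ≤ ENNReal.ofReal (∫ ξ, ‖fourierWeight F s ξ‖) := by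
    intro x
    rw [← ENNReal.ofReal_toReal (hF.smoothed_eq hs x).1, (hF.smoothed_eq hs x).2]
    refine ENNReal.ofReal_le_ofReal ((Real.le_norm_self _).trans
      ((norm_integral_le_integral_norm _).trans ?_))
    refine integral_mono_of_nonneg (Eventually.of_forall fun _ => norm_nonneg _) hw.norm
      (Eventually.of_forall fun ξ => ?_)
    simp only [norm_mul]
    exact mul_le_of_le_one_right (norm_nonneg _) (Real.abs_cos_le_one _)
  have hfin : smoothedInteraction Ψ s μ ν ≠ ⊤ := by
    refine ne_top_of_le_ne_top ?_ (lintegral_mono fun p => hbound _)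
    simp
  refine ⟨hfin, ?_⟩
  unfold smoothedInteraction
  rw [← integral_toReal hmeas.aemeasurable (Eventually.of_forall fun p =>
    (hF.smoothed_eq hs _).1.lt_top)]
  simp_rw [(hF.smoothed_eq hs _).2]
  rw [integral_integral_swap]
  · refine integral_congr_ae (Eventually.of_forall fun ξ => ?_)
    simp only
    rw [integral_const_mul, integral_cos_inner_sub]
  · refine (hw.comp_snd (ν.prod μ)).mono ?_ (Eventually.of_forall fun p => ?_)
    · exact (hw.comp_snd (ν.prod μ)).aestronglyMeasurable.mul
        (Continuous.aestronglyMeasurable (by fun_prop))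
    · simp only [Function.uncurry, norm_mul]
      exact mul_le_of_le_one_right (norm_nonneg _) (Real.abs_cos_le_one _)

/-- The squared distance of two measures in Fourier variables. -/
def fourierDefect (F : E3 → ℝ) (s : ℝ) (μ ν : Measure E3) : ℝ :=
  ∫ ξ, fourierWeight F s ξ * ‖charFun μ ξ - charFun ν ξ‖ ^ 2

theorem integrable_fourierWeight_mul {F : E3 → ℝ} (hF : HasFourierProfile Ψ F)
    {s : ℝ} (hs : 0 < s) {g : E3 → ℝ} (hg : Measurable g) {B : ℝ} (hB : ∀ ξ, ‖g ξ‖ ≤ B) :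
    Integrable fun ξ => fourierWeight F s ξ * g ξ :=
  (hF.integrable_fourierWeight hs).mul_bdd hg.aestronglyMeasurable
    (Eventually.of_forall hB)

theorem norm_charFun_sub_sq_le (μ ν : Measure E3) [IsProbabilityMeasure μ]
    [IsProbabilityMeasure ν] (ξ : E3) : ‖‖charFun μ ξ - charFun ν ξ‖ ^ 2‖ ≤ 4 := by
  rw [Real.norm_of_nonneg (by positivity)]
  have h1 := norm_sub_le (charFun μ ξ) (charFun ν ξ)
  have h2 := norm_charFun_le_one (μ := μ) ξ
  have h3 := norm_charFun_le_one (μ := ν) ξ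
  nlinarith [norm_nonneg (charFun μ ξ - charFun ν ξ)]

theorem HasFourierProfile.integrable_fourierDefect {F : E3 → ℝ} (hF : HasFourierProfile Ψ F)
    {s : ℝ} (hs : 0 < s) (μ ν : Measure E3) [IsProbabilityMeasure μ] [IsProbabilityMeasure ν] :
    Integrable fun ξ => fourierWeight F s ξ * ‖charFun μ ξ - charFun ν ξ‖ ^ 2 :=
  integrable_fourierWeight_mul hF hs
    ((measurable_charFun.sub measurable_charFun).norm.pow_const 2) (norm_charFun_sub_sq_le μ ν)

/-- Polarisation, `|a|² + |b|² = 2 Re (b ā) + |a - b|²`, under the integral. No sign of `F` is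
needed for the identity. -/
theorem HasFourierProfile.smoothed_convexity (hcont : Continuous Ψ) (hpos : ∀ ω, 0 < Ψ ω)
    {F : E3 → ℝ} (hF : HasFourierProfile Ψ F) {s : ℝ} (hs : 0 < s) (μ ν : Measure E3)
    [IsProbabilityMeasure μ] [IsProbabilityMeasure ν] :
    (smoothedInteraction Ψ s μ μ).toReal + (smoothedInteraction Ψ s ν ν).toReal =
      2 * (smoothedInteraction Ψ s μ ν).toReal + fourierDefect F s μ ν := by
  have hi : ∀ (κ l : Measure E3) [IsProbabilityMeasure κ] [IsProbabilityMeasure l],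
      Integrable fun ξ => fourierWeight F s ξ *
        (charFun l ξ * (starRingEnd ℂ) (charFun κ ξ)).re := by
    intro κ l _ _
    refine integrable_fourierWeight_mul hF hs (B := 1) ?_ fun ξ => ?_
    · exact Complex.measurable_re.comp (measurable_charFun.mul
        (Complex.continuous_conj.measurable.comp measurable_charFun))
    · refine (Complex.abs_re_le_norm _).trans ?_
      rw [norm_mul, RCLike.norm_conj]
      exact mul_le_one₀ (norm_charFun_le_one _) (norm_nonneg _) (norm_charFun_le_one _)
  rw [(hF.smoothedInteraction_eq hcont hpos hs μ μ).2,
    (hF.smoothedInteraction_eq hcont hpos hs ν ν).2,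
    (hF.smoothedInteraction_eq hcont hpos hs μ ν).2, fourierDefect,
    ← integral_add (hi μ μ) (hi ν ν), ← integral_const_mul,
    ← integral_add ((hi μ ν).const_mul 2) (hF.integrable_fourierDefect hs μ ν)]
  refine integral_congr_ae (Eventually.of_forall fun ξ => ?_)
  simp only
  generalize charFun μ ξ = a
  generalize charFun ν ξ = b
  rw [Complex.sq_norm, Complex.normSq_apply]
  simp only [Complex.mul_re, Complex.conj_re, Complex.conj_im, Complex.sub_re, Complex.sub_im]
  ring

/-- For `F ≥ 0` the weight `F(ξ) exp (-s² |ξ|² / 2)` increases as `s` decreases. Freezing the defect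
at scale `1` therefore gives a lower bound that does not depend on `s` and survives the limit. -/
theorem HasFourierProfile.defect_add_le (hcont : Continuous Ψ) (hpos : ∀ ω, 0 < Ψ ω)
    {F : E3 → ℝ} (hF : HasFourierProfile Ψ F) (hF0 : ∀ ξ, 0 ≤ F ξ) {s : ℝ} (hs : 0 < s)
    (hs1 : s ≤ 1) (μ ν : Measure E3) [IsProbabilityMeasure μ] [IsProbabilityMeasure ν] :
    ENNReal.ofReal (fourierDefect F 1 μ ν) + 2 * smoothedInteraction Ψ s μ ν ≤
      smoothedInteraction Ψ s μ μ + smoothedInteraction Ψ s ν ν := by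
  have hmono : fourierDefect F 1 μ ν ≤ fourierDefect F s μ ν := by
    refine integral_mono (hF.integrable_fourierDefect one_pos μ ν)
      (hF.integrable_fourierDefect hs μ ν) fun ξ => ?_
    refine mul_le_mul_of_nonneg_right (mul_le_mul_of_nonneg_left (Real.exp_le_exp.2 ?_) (hF0 ξ))
      (by positivity)
    have : s ^ 2 ≤ 1 ^ 2 := pow_le_pow_left₀ hs.le hs1 2
    have h2 := sq_nonneg ‖ξ‖
    nlinarith
  have hD0 : 0 ≤ fourierDefect F 1 μ ν := integral_nonneg fun ξ =>
    mul_nonneg (mul_nonneg (hF0 ξ) (Real.exp_pos _).le) (by positivity)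
  have h := hF.smoothed_convexity hcont hpos hs μ ν
  have h1 := (hF.smoothedInteraction_eq hcont hpos hs μ μ).1
  have h2 := (hF.smoothedInteraction_eq hcont hpos hs ν ν).1
  have h3 := (hF.smoothedInteraction_eq hcont hpos hs μ ν).1
  rw [← ENNReal.toReal_le_toReal (ENNReal.add_ne_top.2 ⟨ENNReal.ofReal_ne_top,
    ENNReal.mul_ne_top (by simp) h3⟩) (ENNReal.add_ne_top.2 ⟨h1, h2⟩),
    ENNReal.toReal_add ENNReal.ofReal_ne_top (ENNReal.mul_ne_top (by simp) h3),
    ENNReal.toReal_add h1 h2, ENNReal.toReal_ofReal hD0, ENNReal.toReal_mul, h]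
  simp only [ENNReal.toReal_ofNat]
  linarith

theorem tendsto_smoothedInteraction (hcont : Continuous Ψ) (hpos : ∀ ω, 0 < Ψ ω) {s : ℕ → ℝ}
    (hs : Tendsto s atTop (𝓝 0)) (hs0 : ∀ n, 0 < s n) (μ : Measure E3) [IsProbabilityMeasure μ]
    (hμ : interaction Ψ μ μ ≠ ⊤) :
    Tendsto (fun n => smoothedInteraction Ψ (s n) μ μ) atTop
      (𝓝 (gaussianMeasure Set.univ * interaction Ψ μ μ)) := by
  rw [interaction_eq_prod hcont hpos] at hμ ⊢
  have hmeas : Measurable fun z : E3 × E3 => potential Ψ (z.1 - z.2) :=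
    (continuous_potential_sub hcont hpos).measurable
  rw [← lintegral_const_mul _ hmeas]
  obtain ⟨C, hC, hle⟩ := exists_smoothed_le hcont hpos
  refine tendsto_lintegral_of_dominated_convergence (fun p => C * potential Ψ (p.1 - p.2))
    (fun n => (measurable_smoothed hcont hpos (s n)).comp (measurable_fst.sub measurable_snd))
    (fun n => Eventually.of_forall fun p => hle _ (hs0 n) _) ?_ ?_
  · rw [lintegral_const_mul _ hmeas]
    exact ENNReal.mul_ne_top hC hμ
  -- Finite energy makes the diagonal, where `W = ⊤`, null for `μ ⊗ μ`; off the diagonal the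
  -- averages converge.
  · filter_upwards [ae_lt_top hmeas hμ] with p hp
    refine tendsto_smoothed hcont hpos hs hs0 fun h => ?_
    rw [h, potential_zero] at hp
    exact lt_irrefl _ hp

/-- Positive definiteness of the interaction energy, with a quantitative defect. -/
theorem HasFourierProfile.defect_add_interaction_le (hcont : Continuous Ψ) (hpos : ∀ ω, 0 < Ψ ω)
    {F : E3 → ℝ} (hF : HasFourierProfile Ψ F) (hF0 : ∀ ξ, 0 ≤ F ξ) (μ ν : Measure E3)
    [IsProbabilityMeasure μ] [IsProbabilityMeasure ν] (hμ : interaction Ψ μ μ ≠ ⊤)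
    (hν : interaction Ψ ν ν ≠ ⊤) :
    ENNReal.ofReal (fourierDefect F 1 μ ν) +
      gaussianMeasure Set.univ * (2 * interaction Ψ μ ν) ≤
      gaussianMeasure Set.univ * (interaction Ψ μ μ + interaction Ψ ν ν) := by
  let s : ℕ → ℝ := fun n => 1 / ((n : ℝ) + 1)
  have hs : Tendsto s atTop (𝓝 0) := tendsto_one_div_add_atTop_nhds_zero_nat
  have hs0 : ∀ n, 0 < s n := fun n => by positivity
  have hs1 : ∀ n, s n ≤ 1 := fun n => by
    simp only [s]
    rw [div_le_one (by positivity)]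
    linarith [Nat.cast_nonneg (α := ℝ) n]
  have hR := (tendsto_smoothedInteraction hcont hpos hs hs0 μ hμ).add
    (tendsto_smoothedInteraction hcont hpos hs hs0 ν hν)
  rw [← mul_add] at hR
  have hmeas : ∀ n, Measurable fun p : E3 × E3 => smoothed Ψ (s n) (p.1 - p.2) := fun n =>
    (measurable_smoothed hcont hpos (s n)).comp (measurable_fst.sub measurable_snd)
  have hpt : ∀ p : E3 × E3, Tendsto (fun n => ENNReal.ofReal (fourierDefect F 1 μ ν) +
      2 * smoothed Ψ (s n) (p.1 - p.2)) atTop (𝓝 (ENNReal.ofReal (fourierDefect F 1 μ ν) +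
      2 * (gaussianMeasure Set.univ * potential Ψ (p.1 - p.2)))) := by
    intro p
    refine tendsto_const_nhds.add (ENNReal.Tendsto.const_mul ?_ (Or.inr (by simp)))
    by_cases hp : p.1 - p.2 = 0
    · rw [hp]
      refine tendsto_of_le_liminf_of_limsup_le (le_liminf_smoothed hcont hpos hs _) ?_
      rw [potential_zero, ENNReal.mul_top gaussianMeasure_univ_ne_zero]
      exact le_top
    · exact tendsto_smoothed hcont hpos hs hs0 hp
  calc ENNReal.ofReal (fourierDefect F 1 μ ν) +
        gaussianMeasure Set.univ * (2 * interaction Ψ μ ν)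
      = ∫⁻ p, ENNReal.ofReal (fourierDefect F 1 μ ν) +
          2 * (gaussianMeasure Set.univ * potential Ψ (p.1 - p.2)) ∂(ν.prod μ) := by
        rw [interaction_eq_prod hcont hpos, lintegral_add_left measurable_const,
          lintegral_const_mul' _ _ (by simp), lintegral_const_mul' _ _ (measure_ne_top _ _),
          lintegral_const, measure_univ (μ := ν.prod μ), mul_one]
        ring
    -- Only a lower bound is needed for the mixed term, so Fatou's lemma suffices and finiteness of
    -- the mutual energy is not assumed.
    _ = ∫⁻ p, liminf (fun n => ENNReal.ofReal (fourierDefect F 1 μ ν) +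
          2 * smoothed Ψ (s n) (p.1 - p.2)) atTop ∂(ν.prod μ) :=
        lintegral_congr fun p => (hpt p).liminf_eq.symm
    _ ≤ liminf (fun n => ∫⁻ p, ENNReal.ofReal (fourierDefect F 1 μ ν) +
          2 * smoothed Ψ (s n) (p.1 - p.2) ∂(ν.prod μ)) atTop :=
        lintegral_liminf_le fun n => ((hmeas n).const_mul 2).const_add _
    _ ≤ liminf (fun n => smoothedInteraction Ψ (s n) μ μ + smoothedInteraction Ψ (s n) ν ν)
          atTop := by
        refine liminf_le_liminf (Eventually.of_forall fun n => ?_)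
        refine le_trans (le_of_eq ?_) (hF.defect_add_le hcont hpos hF0 (hs0 n) (hs1 n) μ ν)
        rw [lintegral_add_left measurable_const, lintegral_const_mul' _ _ (by simp),
          lintegral_const, measure_univ, mul_one]
        rfl
    _ = _ := hR.liminf_eq

/-! ### Uniqueness of minimisers -/

/-- The holomorphic extension of a characteristic function along a line. -/
def charFunLine (μ : Measure E3) (ξ v : E3) (z : ℂ) : ℂ :=
  ∫ x, Complex.exp ((((inner ℝ x ξ : ℝ) : ℂ) + z * ((inner ℝ x v : ℝ) : ℂ)) * Complex.I) ∂μ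

theorem charFunLine_ofReal (μ : Measure E3) (ξ v : E3) (t : ℝ) :
    charFunLine μ ξ v t = charFun μ (ξ + t • v) := by
  unfold charFunLine
  rw [charFun_apply]
  refine integral_congr_ae (Eventually.of_forall fun x => ?_)
  simp only [inner_add_right, inner_smul_right]
  push_cast
  rfl

/-- Bounded support dominates the complex exponential and its derivative locally uniformly in `z`,
so one may differentiate under the integral. -/
theorem differentiable_charFunLine (μ : Measure E3) [IsFiniteMeasure μ] {R : ℝ}
    (hR : ∀ᵐ x ∂μ, ‖x‖ ≤ R) (ξ v : E3) : Differentiable ℂ (charFunLine μ ξ v) := by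
  intro z₀
  let f : ℂ → E3 → ℂ := fun z x =>
    Complex.exp ((((inner ℝ x ξ : ℝ) : ℂ) + z * ((inner ℝ x v : ℝ) : ℂ)) * Complex.I)
  let f' : ℂ → E3 → ℂ := fun z x => f z x * (((inner ℝ x v : ℝ) : ℂ) * Complex.I)
  have hcont : ∀ z, Continuous (f z) := fun z => by fun_prop
  have hcont' : ∀ z, Continuous (f' z) := fun z => by fun_prop
  have hnorm : ∀ z x, ‖f z x‖ ≤ Real.exp (‖z‖ * ‖inner ℝ x v‖) := by
    intro z x
    simp only [f, Complex.norm_exp]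
    refine Real.exp_le_exp.2 ?_
    have h : (((((inner ℝ x ξ : ℝ) : ℂ) + z * ((inner ℝ x v : ℝ) : ℂ)) * Complex.I)).re =
        -(z.im * inner ℝ x v) := by simp
    rw [h]
    calc -(z.im * inner ℝ x v) ≤ |z.im * inner ℝ x v| := neg_le_abs _
      _ = |z.im| * ‖inner ℝ x v‖ := abs_mul _ _
      _ ≤ ‖z‖ * ‖inner ℝ x v‖ := by gcongr; exact Complex.abs_im_le_norm z
  have hinner : ∀ x : E3, ‖x‖ ≤ R → ‖inner ℝ x v‖ ≤ R * ‖v‖ := fun x hx =>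
    (norm_inner_le_norm x v).trans (by gcongr)
  refine (hasDerivAt_integral_of_dominated_loc_of_deriv_le (F := f) (F' := f') (μ := μ)
    (bound := fun _ => Real.exp ((‖z₀‖ + 1) * (R * ‖v‖)) * (R * ‖v‖))
    (Metric.ball_mem_nhds z₀ one_pos) ?_ ?_ ?_ ?_ ?_ ?_).2.differentiableAt
  · exact Eventually.of_forall fun z => (hcont z).aestronglyMeasurable
  · refine Integrable.of_bound (hcont z₀).aestronglyMeasurable
      (Real.exp (‖z₀‖ * (R * ‖v‖))) ?_
    filter_upwards [hR] with x hx
    refine (hnorm z₀ x).trans (Real.exp_le_exp.2 ?_)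
    gcongr
    exact hinner x hx
  · exact (hcont' z₀).aestronglyMeasurable
  · filter_upwards [hR] with x hx z hz
    have hz' : ‖z‖ ≤ ‖z₀‖ + 1 := by
      have h1 : ‖z - z₀‖ < 1 := by simpa [dist_eq_norm] using hz
      have h2 := norm_add_le (z - z₀) z₀
      rw [sub_add_cancel] at h2
      linarith
    simp only [f', norm_mul, Complex.norm_I, mul_one, Complex.norm_real]
    refine mul_le_mul ((hnorm z x).trans (Real.exp_le_exp.2 ?_)) (hinner x hx) (norm_nonneg _)
      (Real.exp_pos _).le
    exact mul_le_mul hz' (hinner x hx) (norm_nonneg _) (by positivity)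
  · exact integrable_const _
  · refine Eventually.of_forall fun x z _ => ?_
    have h1 : HasDerivAt (fun z : ℂ => (((inner ℝ x ξ : ℝ) : ℂ) + z * ((inner ℝ x v : ℝ) : ℂ)) *
        Complex.I) (((inner ℝ x v : ℝ) : ℂ) * Complex.I) z := by
      have := (((hasDerivAt_id z).mul_const ((inner ℝ x v : ℝ) : ℂ)).const_add
        ((inner ℝ x ξ : ℝ) : ℂ)).mul_const Complex.I
      simpa using this
    exact h1.cexp

/-- Two measures with bounded supports whose characteristic functions agree on a nonempty open set
are equal. -/
theorem measure_eq_of_charFun_eqOn (μ ν : Measure E3) [IsFiniteMeasure μ] [IsFiniteMeasure ν]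
    {R : ℝ} (hμ : ∀ᵐ x ∂μ, ‖x‖ ≤ R) (hν : ∀ᵐ x ∂ν, ‖x‖ ≤ R) {U : Set E3} (hU : IsOpen U)
    (hne : U.Nonempty) (h : ∀ ξ ∈ U, charFun μ ξ = charFun ν ξ) : μ = ν := by
  obtain ⟨ξ₀, hξ₀⟩ := hne
  refine Measure.ext_of_charFun (funext fun ξ => ?_)
  have hμd := differentiable_charFunLine μ hμ ξ₀ (ξ - ξ₀)
  have hνd := differentiable_charFunLine ν hν ξ₀ (ξ - ξ₀)
  -- Along the line from `ξ₀` to `ξ` the functions agree for small real parameters, which accumulate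
  -- at `0`. The identity theorem carries the equality to the parameter `1`, that is, to `ξ`.
  have hfreq : ∃ᶠ z in 𝓝[≠] (0 : ℂ), charFunLine μ ξ₀ (ξ - ξ₀) z = charFunLine ν ξ₀ (ξ - ξ₀) z := by
    have hev : ∀ᶠ t : ℝ in 𝓝[≠] 0, charFunLine μ ξ₀ (ξ - ξ₀) t = charFunLine ν ξ₀ (ξ - ξ₀) t := by
      have hc : Continuous fun t : ℝ => ξ₀ + t • (ξ - ξ₀) := by fun_prop
      have hmem : ∀ᶠ t : ℝ in 𝓝 0, ξ₀ + t • (ξ - ξ₀) ∈ U := by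
        refine hc.continuousAt.eventually_mem (hU.mem_nhds ?_)
        simpa using hξ₀
      filter_upwards [nhdsWithin_le_nhds hmem] with t ht
      rw [charFunLine_ofReal, charFunLine_ofReal, h _ ht]
    have htend : Tendsto (fun t : ℝ => (t : ℂ)) (𝓝[≠] 0) (𝓝[≠] 0) := by
      refine tendsto_nhdsWithin_of_tendsto_nhds_of_eventually_within _ ?_ ?_
      · have := Complex.continuous_ofReal.tendsto 0
        rw [Complex.ofReal_zero] at this
        exact this.mono_left nhdsWithin_le_nhds
      · filter_upwards [self_mem_nhdsWithin] with t ht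
        simpa using ht
    exact htend.frequently hev.frequently
  have heq := AnalyticOnNhd.eqOn_of_preconnected_of_frequently_eq
    (hμd.differentiableOn.analyticOnNhd isOpen_univ)
    (hνd.differentiableOn.analyticOnNhd isOpen_univ) isPreconnected_univ (Set.mem_univ (0 : ℂ)) hfreq
  have h1 := heq (Set.mem_univ (1 : ℂ))
  have h2 := charFunLine_ofReal μ ξ₀ (ξ - ξ₀) 1
  have h3 := charFunLine_ofReal ν ξ₀ (ξ - ξ₀) 1
  rw [one_smul, add_sub_cancel, Complex.ofReal_one] at h2 h3
  rw [← h2, ← h3]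
  exact h1

/-- If `F` vanished identically, so would the Gaussian average of the strictly positive `W`. -/
theorem HasFourierProfile.exists_pos (hpos : ∀ ω, 0 < Ψ ω) (hcont : Continuous Ψ)
    {F : E3 → ℝ} (hF : HasFourierProfile Ψ F) (hF0 : ∀ ξ, 0 ≤ F ξ) : ∃ ξ, 0 < F ξ := by
  by_contra! hle
  obtain ⟨h1, h2⟩ := hF.smoothed_eq one_pos 0
  have hz : ∀ ξ, F ξ = 0 := fun ξ => le_antisymm (hle ξ) (hF0 ξ)
  simp only [fourierWeight, hz, zero_mul, integral_zero] at h2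
  have h3 : smoothed Ψ 1 0 = 0 := ((ENNReal.toReal_eq_zero_iff _).1 h2).resolve_right h1
  have hmeas : Measurable fun z : E3 => potential Ψ (0 + (1 : ℝ) • z) :=
    ((continuous_potential hcont hpos).comp (by fun_prop)).measurable
  have h4 := (lintegral_eq_zero_iff hmeas).1 h3
  have h5 : ∀ᵐ z ∂gaussianMeasure, False := h4.mono fun z hz => potential_ne_zero hpos _ hz
  have h6 : gaussianMeasure = 0 := by
    rw [← Measure.measure_univ_eq_zero, measure_eq_zero_iff_ae_notMem]
    exact h5.mono fun _ h => h.elim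
  exact gaussianMeasure_univ_ne_zero (by rw [h6]; simp)

/-- As `F` may have zeros, a vanishing defect only identifies the characteristic functions where `F
> 0`; bounded support compensates for this through analytic continuation. -/
theorem HasFourierProfile.eq_of_defect_le (hpos : ∀ ω, 0 < Ψ ω) (hcont : Continuous Ψ)
    {F : E3 → ℝ} (hF : HasFourierProfile Ψ F) (hF0 : ∀ ξ, 0 ≤ F ξ) {μ ν : Measure E3}
    [IsProbabilityMeasure μ] [IsProbabilityMeasure ν] {R : ℝ} (hμ : ∀ᵐ x ∂μ, ‖x‖ ≤ R)
    (hν : ∀ᵐ x ∂ν, ‖x‖ ≤ R) (hD : fourierDefect F 1 μ ν ≤ 0) : μ = ν := by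
  obtain ⟨ξ₀, hξ₀⟩ := hF.exists_pos hpos hcont hF0
  let U : Set E3 := {0}ᶜ ∩ F ⁻¹' Set.Ioi 0
  have hU : IsOpen U := hF.continuousOn.isOpen_inter_preimage isOpen_compl_singleton isOpen_Ioi
  have hne : U.Nonempty := ⟨ξ₀, fun h => by
    rw [Set.mem_singleton_iff] at h
    rw [h, hF.map_zero] at hξ₀
    exact lt_irrefl _ hξ₀, hξ₀⟩
  have hnn : ∀ ξ, 0 ≤ fourierWeight F 1 ξ * ‖charFun μ ξ - charFun ν ξ‖ ^ 2 := fun ξ =>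
    mul_nonneg (mul_nonneg (hF0 ξ) (Real.exp_pos _).le) (by positivity)
  have hD0 : fourierDefect F 1 μ ν = 0 := le_antisymm hD (integral_nonneg hnn)
  have hae := (integral_eq_zero_iff_of_nonneg hnn (hF.integrable_fourierDefect one_pos μ ν)).1 hD0
  refine measure_eq_of_charFun_eqOn μ ν hμ hν hU hne ?_
  have haeU : charFun μ =ᵐ[volume.restrict U] charFun ν := by
    filter_upwards [ae_restrict_of_ae hae, ae_restrict_mem hU.measurableSet] with ξ hξ hξU
    have hw : fourierWeight F 1 ξ ≠ 0 := (mul_pos hξU.2 (Real.exp_pos _)).ne'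
    have := (mul_eq_zero.1 hξ).resolve_left hw
    rw [pow_eq_zero_iff two_ne_zero, norm_eq_zero, sub_eq_zero] at this
    exact this
  exact Measure.eqOn_open_of_ae_eq haeU hU continuous_charFun.continuousOn
    continuous_charFun.continuousOn

/-- Existence, uniqueness, compactness of the support and the Euler–Lagrange characterisation of the
minimiser, given a nonnegative Fourier transform of the potential. -/
theorem HasFourierProfile.main (hcont : Continuous Ψ) (hpos : ∀ ω, 0 < Ψ ω)
    (heven : ∀ ω, Ψ (-ω) = Ψ ω) {F : E3 → ℝ} (hF : HasFourierProfile Ψ F)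
    (hF0 : ∀ ξ, 0 ≤ F ξ) :
    (∃! μ₀ : ProbabilityMeasure E3, IsMinimiser Ψ μ₀) ∧
    (∀ μ₀ : ProbabilityMeasure E3, IsMinimiser Ψ μ₀ → IsCompact (μ₀ : Measure E3).support) ∧
    (∀ μ₀ : ProbabilityMeasure E3, IsMinimiser Ψ μ₀ ↔ EulerLagrange Ψ μ₀) := by
  have hg0 := gaussianMeasure_univ_ne_zero
  have hgt : gaussianMeasure Set.univ ≠ ⊤ := measure_ne_top _ _
  have hconv : ∀ μ ν : ProbabilityMeasure E3, interaction Ψ μ μ ≠ ⊤ → interaction Ψ ν ν ≠ ⊤ →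
      2 * interaction Ψ μ ν ≤ interaction Ψ μ μ + interaction Ψ ν ν := by
    intro μ ν hμ hν
    exact (ENNReal.mul_le_mul_iff_right hg0 hgt).1
      (le_add_self.trans (hF.defect_add_interaction_le hcont hpos hF0 μ ν hμ hν))
  refine ⟨?_, ?_, fun μ => ⟨fun h => h.eulerLagrange hcont hpos heven,
    fun h => h.isMinimiser hcont hpos hconv⟩⟩
  · obtain ⟨μ, hμ⟩ := exists_isMinimiser hcont hpos
    refine ⟨μ, hμ, fun ν hν => ?_⟩
    have hfin : ∀ κ : ProbabilityMeasure E3, IsMinimiser Ψ κ → interaction Ψ κ κ ≠ ⊤ := by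
      intro κ hκ
      have h : interaction Ψ κ κ + confinement (κ : Measure E3) ≠ ⊤ :=
        energy_isMinimiser_ne_top hcont hpos hκ
      exact (ENNReal.add_ne_top.1 h).1
    obtain ⟨R₁, hR₁⟩ := (hμ.eulerLagrange hcont hpos heven).exists_ae_norm_le
    obtain ⟨R₂, hR₂⟩ := (hν.eulerLagrange hcont hpos heven).exists_ae_norm_le
    have hle := hF.defect_add_interaction_le hcont hpos hF0 ν μ (hfin ν hν) (hfin μ hμ)
    have hmid := hν.add_interaction_le hcont hpos heven hμ
    have hfin2 : gaussianMeasure Set.univ *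
        (interaction Ψ (ν : Measure E3) ν + interaction Ψ (μ : Measure E3) μ) ≠ ⊤ :=
      ENNReal.mul_ne_top hgt (ENNReal.add_ne_top.2 ⟨hfin ν hν, hfin μ hμ⟩)
    -- Minimality bounds the mutual energy from below by the mean of the self-energies and positive
    -- definiteness bounds it from above by the same quantity minus the defect, up to the Gaussian
    -- mass.
    have hD : ENNReal.ofReal (fourierDefect F 1 ν μ) ≤ 0 := by
      have h1 : ENNReal.ofReal (fourierDefect F 1 ν μ) + gaussianMeasure Set.univ *
          (interaction Ψ (ν : Measure E3) ν + interaction Ψ (μ : Measure E3) μ) ≤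
          0 + gaussianMeasure Set.univ *
          (interaction Ψ (ν : Measure E3) ν + interaction Ψ (μ : Measure E3) μ) := by
        rw [zero_add]
        exact le_trans (add_le_add le_rfl (mul_le_mul' le_rfl hmid)) hle
      exact (ENNReal.add_le_add_iff_right hfin2).1 h1
    have hD' : fourierDefect F 1 (ν : Measure E3) μ ≤ 0 :=
      ENNReal.ofReal_eq_zero.1 (le_zero_iff.1 hD)
    have heq : (ν : Measure E3) = (μ : Measure E3) :=
      hF.eq_of_defect_le hpos hcont hF0 (R := max R₁ R₂)
        (hR₂.mono fun x hx => hx.trans (le_max_right _ _))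
        (hR₁.mono fun x hx => hx.trans (le_max_left _ _)) hD'
    exact Subtype.ext heq
  · intro μ hμ
    obtain ⟨R, hR⟩ := (hμ.eulerLagrange hcont hpos heven).exists_ae_norm_le
    exact isCompact_support_of_ae_norm_le hR

/-! ### Hecke's identity for harmonic polynomials -/

/-- Evaluation of a polynomial at a point of `ℝ³`. -/
def polyEval (p : MvPolynomial (Fin 3) ℝ) (x : E3) : ℝ := MvPolynomial.eval (fun i => x i) p

/-- The Laplacian of a polynomial. -/
def polyLaplacian (p : MvPolynomial (Fin 3) ℝ) : MvPolynomial (Fin 3) ℝ :=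
  ∑ i, MvPolynomial.pderiv i (MvPolynomial.pderiv i p)

@[simp] theorem polyEval_C (c : ℝ) (x : E3) : polyEval (MvPolynomial.C c) x = c := by
  simp [polyEval]

@[simp] theorem polyEval_zero (x : E3) : polyEval 0 x = 0 := by simp [polyEval]

@[simp] theorem polyEval_add (p q : MvPolynomial (Fin 3) ℝ) (x : E3) :
    polyEval (p + q) x = polyEval p x + polyEval q x := by simp [polyEval]

@[simp] theorem polyEval_mul (p q : MvPolynomial (Fin 3) ℝ) (x : E3) :
    polyEval (p * q) x = polyEval p x * polyEval q x := by simp [polyEval]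

@[simp] theorem polyEval_X (i : Fin 3) (x : E3) : polyEval (MvPolynomial.X i) x = x i := by
  simp [polyEval]

theorem polyEval_sum {ι : Type*} (s : Finset ι) (p : ι → MvPolynomial (Fin 3) ℝ) (x : E3) :
    polyEval (∑ i ∈ s, p i) x = ∑ i ∈ s, polyEval (p i) x := by simp [polyEval]

theorem continuous_polyEval (p : MvPolynomial (Fin 3) ℝ) : Continuous (polyEval p) :=
  (MvPolynomial.continuous_eval p).comp (by fun_prop)

/-- The `j`-th unit vector. -/
def unitVec (j : Fin 3) : E3 := EuclideanSpace.single j 1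

theorem inner_unitVec (j : Fin 3) (x : E3) : inner ℝ (unitVec j) x = x j := by
  simp [unitVec, EuclideanSpace.inner_single_left]

theorem unitVec_apply (i j : Fin 3) : unitVec j i = if i = j then 1 else 0 := by
  simp [unitVec]

theorem hasDerivAt_polyEval (p : MvPolynomial (Fin 3) ℝ) (j : Fin 3) (x : E3) :
    HasDerivAt (fun r : ℝ => polyEval p (x + r • unitVec j))
      (polyEval (MvPolynomial.pderiv j p) x) 0 := by
  induction p using MvPolynomial.induction_on with
  | C a => simpa using hasDerivAt_const (0 : ℝ) a
  | add p q hp hq => simpa using hp.fun_add hq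
  | mul_X p i hp =>
    have hX : HasDerivAt (fun r : ℝ => polyEval (MvPolynomial.X i) (x + r • unitVec j))
        (if i = j then 1 else 0) 0 := by
      simp only [polyEval_X, PiLp.add_apply, PiLp.smul_apply, smul_eq_mul, unitVec_apply]
      simpa using ((hasDerivAt_id (0 : ℝ)).mul_const (if i = j then (1 : ℝ) else 0)).const_add (x i)
    have h := hp.fun_mul hX
    simp only [zero_smul, add_zero] at h
    simp only [polyEval_mul]
    refine h.congr_deriv ?_
    rw [MvPolynomial.pderiv_mul, polyEval_add, polyEval_mul, polyEval_mul, MvPolynomial.pderiv_X]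
    congr 2
    by_cases hij : i = j
    · subst hij; simp [polyEval]
    · simp [hij, polyEval]

/-- Each factor `x i` is absorbed by half of the Gaussian exponent, so `b` must vary in the
induction. -/
theorem integrable_polyEval_mul_exp (p : MvPolynomial (Fin 3) ℝ) :
    ∀ b : ℝ, 0 < b → Integrable fun x : E3 => polyEval p x * Real.exp (-(b * ‖x‖ ^ 2)) := by
  induction p using MvPolynomial.induction_on with
  | C a =>
    intro b hb
    simpa using (integrable_exp_neg_mul_norm_sq hb).const_mul a
  | add p q hp hq =>
    intro b hb
    simpa [add_mul] using (hp b hb).fun_add (hq b hb)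
  | mul_X p i hp =>
    intro b hb
    have hb2 : 0 < b / 2 := by positivity
    refine ((hp (b / 2) hb2).mul_bdd (c := 1 + (b / 2)⁻¹)
      (g := fun x : E3 => x i * Real.exp (-(b / 2 * ‖x‖ ^ 2)))
      (Continuous.aestronglyMeasurable (by fun_prop)) (Eventually.of_forall fun x => ?_)).congr
      (Eventually.of_forall fun x => ?_)
    · rw [norm_mul, Real.norm_of_nonneg (Real.exp_pos _).le]
      have h1 : ‖x i‖ ≤ ‖x‖ := PiLp.norm_apply_le x i
      have h2 : ‖x i‖ ≤ 1 + ‖x‖ ^ 2 := by nlinarith [sq_nonneg (‖x‖ - 1)]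
      have h3 := mul_exp_neg_le (t := ‖x‖ ^ 2) hb2
      have h4 : Real.exp (-(b / 2 * ‖x‖ ^ 2)) ≤ 1 := by
        rw [Real.exp_le_one_iff]
        have : 0 ≤ b / 2 * ‖x‖ ^ 2 := by positivity
        linarith
      calc ‖x i‖ * Real.exp (-(b / 2 * ‖x‖ ^ 2))
          ≤ (1 + ‖x‖ ^ 2) * Real.exp (-(b / 2 * ‖x‖ ^ 2)) := by gcongr
        _ ≤ 1 + (b / 2)⁻¹ := by rw [add_mul, one_mul]; exact add_le_add h4 h3
    · simp only [polyEval_mul, polyEval_X]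
      have : Real.exp (-(b * ‖x‖ ^ 2)) =
          Real.exp (-(b / 2 * ‖x‖ ^ 2)) * Real.exp (-(b / 2 * ‖x‖ ^ 2)) := by
        rw [← Real.exp_add]; congr 1; ring
      rw [this]
      ring

/-- The integrand `p(x) exp (-t |x|² / 2 - i ξ·x)`. -/
def heckeIntegrand (t : ℝ) (p : MvPolynomial (Fin 3) ℝ) (ξ x : E3) : ℂ :=
  ((polyEval p x * Real.exp (-(t / 2 * ‖x‖ ^ 2)) : ℝ) : ℂ) *
    Complex.exp (-(Complex.I * ((inner ℝ ξ x : ℝ) : ℂ)))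

theorem norm_exp_neg_I_mul (a : ℝ) : ‖Complex.exp (-(Complex.I * (a : ℂ)))‖ = 1 := by
  have : -(Complex.I * (a : ℂ)) = ((-a : ℝ) : ℂ) * Complex.I := by push_cast; ring
  rw [this, Complex.norm_exp_ofReal_mul_I]

theorem norm_heckeIntegrand (t : ℝ) (p : MvPolynomial (Fin 3) ℝ) (ξ x : E3) :
    ‖heckeIntegrand t p ξ x‖ = ‖polyEval p x * Real.exp (-(t / 2 * ‖x‖ ^ 2))‖ := by
  rw [heckeIntegrand, norm_mul, norm_exp_neg_I_mul, mul_one, Complex.norm_real]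

theorem continuous_heckeIntegrand (t : ℝ) (p : MvPolynomial (Fin 3) ℝ) (ξ : E3) :
    Continuous (heckeIntegrand t p ξ) := by
  have := continuous_polyEval p
  unfold heckeIntegrand
  fun_prop

theorem integrable_heckeIntegrand {t : ℝ} (ht : 0 < t) (p : MvPolynomial (Fin 3) ℝ) (ξ : E3) :
    Integrable (heckeIntegrand t p ξ) := by
  refine (integrable_polyEval_mul_exp p (t / 2) (by positivity)).mono
    (continuous_heckeIntegrand t p ξ).aestronglyMeasurable (Eventually.of_forall fun x => ?_)
  rw [norm_heckeIntegrand]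

/-- Multiplication by a coordinate is differentiation in Fourier variables. -/
theorem hasDerivAt_integral_heckeIntegrand {t : ℝ} (ht : 0 < t) (p : MvPolynomial (Fin 3) ℝ)
    (j : Fin 3) (ξ : E3) :
    HasDerivAt (fun r : ℝ => ∫ x, heckeIntegrand t p (ξ + r • unitVec j) x)
      (-Complex.I * ∫ x, heckeIntegrand t (MvPolynomial.X j * p) ξ x) 0 := by
  have hd : ∀ (x : E3) (r : ℝ), HasDerivAt (fun r : ℝ => heckeIntegrand t p (ξ + r • unitVec j) x)
      (-Complex.I * heckeIntegrand t (MvPolynomial.X j * p) (ξ + r • unitVec j) x) r := by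
    intro x r
    have h2 : HasDerivAt (fun r : ℝ => (inner ℝ (ξ + r • unitVec j) x : ℝ)) (x j) r := by
      simp only [inner_add_left, real_inner_smul_left, inner_unitVec]
      simpa using ((hasDerivAt_id r).mul_const (x j)).const_add (inner ℝ ξ x)
    have h1 : HasDerivAt (fun r : ℝ => -(Complex.I *
        ((inner ℝ (ξ + r • unitVec j) x : ℝ) : ℂ))) (-(Complex.I * ((x j : ℝ) : ℂ))) r :=
      (h2.ofReal_comp.const_mul Complex.I).fun_neg
    unfold heckeIntegrand
    refine (h1.cexp.const_mul _).congr_deriv ?_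
    rw [polyEval_mul, polyEval_X]
    push_cast
    ring
  have hm : ∀ᶠ r : ℝ in 𝓝 0,
      AEStronglyMeasurable (heckeIntegrand t p (ξ + r • unitVec j)) volume :=
    Eventually.of_forall fun r => (continuous_heckeIntegrand t p _).aestronglyMeasurable
  have hm' : AEStronglyMeasurable (fun x => -Complex.I *
      heckeIntegrand t (MvPolynomial.X j * p) (ξ + (0 : ℝ) • unitVec j) x) volume :=
    (continuous_heckeIntegrand t _ _).aestronglyMeasurable.const_mul _
  have hb : ∀ᵐ x : E3, ∀ r ∈ (Set.univ : Set ℝ), ‖-Complex.I *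
      heckeIntegrand t (MvPolynomial.X j * p) (ξ + r • unitVec j) x‖ ≤
      ‖polyEval (MvPolynomial.X j * p) x * Real.exp (-(t / 2 * ‖x‖ ^ 2))‖ :=
    Eventually.of_forall fun x r _ => by
      rw [norm_mul, norm_neg, Complex.norm_I, one_mul, norm_heckeIntegrand]
  have hbi := (integrable_polyEval_mul_exp (MvPolynomial.X j * p) (t / 2) (by positivity)).norm
  have hd' : ∀ᵐ x : E3, ∀ r ∈ (Set.univ : Set ℝ),
      HasDerivAt (fun r : ℝ => heckeIntegrand t p (ξ + r • unitVec j) x)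
      (-Complex.I * heckeIntegrand t (MvPolynomial.X j * p) (ξ + r • unitVec j) x) r :=
    Eventually.of_forall fun x r _ => hd x r
  have h := (hasDerivAt_integral_of_dominated_loc_of_deriv_le
    (F := fun (r : ℝ) => heckeIntegrand t p (ξ + r • unitVec j))
    univ_mem hm (integrable_heckeIntegrand ht p _) hm' hb hbi hd').2
  simp only [zero_smul, add_zero] at h
  rwa [integral_const_mul] at h

theorem polyEval_sum_X_mul_pderiv {p : MvPolynomial (Fin 3) ℝ} {k : ℕ} (hp : p.IsHomogeneous k)
    (x : E3) : ∑ i, x i * polyEval (MvPolynomial.pderiv i p) x = k * polyEval p x := by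
  have h := congrArg (fun q => polyEval q x) hp.sum_X_mul_pderiv
  simpa [polyEval_sum, polyEval] using h

theorem polyLaplacian_pderiv {p : MvPolynomial (Fin 3) ℝ} (hp : polyLaplacian p = 0) (j : Fin 3) :
    polyLaplacian (MvPolynomial.pderiv j p) = 0 := by
  have hc : ∀ (a b : Fin 3) (q : MvPolynomial (Fin 3) ℝ), MvPolynomial.pderiv a
      (MvPolynomial.pderiv b q) = MvPolynomial.pderiv b (MvPolynomial.pderiv a q) := by
    intro a b q
    ext m
    simp only [MvPolynomial.coeff_pderiv]
    by_cases hab : a = b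
    · rw [hab]
    · rw [add_right_comm m]
      simp [hab, Ne.symm hab]
      ring
  unfold polyLaplacian at hp ⊢
  have : ∀ i, MvPolynomial.pderiv i (MvPolynomial.pderiv i (MvPolynomial.pderiv j p)) =
      MvPolynomial.pderiv j (MvPolynomial.pderiv i (MvPolynomial.pderiv i p)) := by
    intro i
    rw [hc i j p, hc i j]
  simp_rw [this]
  rw [← map_sum, hp, map_zero]

/-- **Hecke's identity**. -/
theorem integral_heckeIntegrand {t : ℝ} (ht : 0 < t) (k : ℕ) :
    ∀ p : MvPolynomial (Fin 3) ℝ, p.IsHomogeneous k → polyLaplacian p = 0 → ∀ ξ : E3,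
    ∫ x, heckeIntegrand t p ξ x = (((2 * Real.pi / t) ^ (3 / 2 : ℝ) : ℝ) : ℂ) *
      (-Complex.I / t) ^ k * ((polyEval p ξ * Real.exp (-(‖ξ‖ ^ 2 / (2 * t))) : ℝ) : ℂ) := by
  have ht' : (t : ℂ) ≠ 0 := by exact_mod_cast ht.ne'
  induction k with
  | zero =>
    intro p hp _ ξ
    obtain ⟨c, rfl⟩ : ∃ c, p = MvPolynomial.C c :=
      ⟨_, MvPolynomial.totalDegree_eq_zero_iff_eq_C.1
        ((MvPolynomial.totalDegree_zero_iff_isHomogeneous _).2 hp)⟩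
    have hb : 0 < (((t / 2 : ℝ) : ℂ)).re := by rw [Complex.ofReal_re]; positivity
    have h1 : ∀ x, heckeIntegrand t (MvPolynomial.C c) ξ x = (c : ℂ) * Complex.exp
        (-((t / 2 : ℝ) : ℂ) * (‖x‖ : ℂ) ^ 2 + (-Complex.I) * ((inner ℝ ξ x : ℝ) : ℂ)) := by
      intro x
      unfold heckeIntegrand
      rw [polyEval_C, Complex.ofReal_mul, mul_assoc, Complex.ofReal_exp, ← Complex.exp_add]
      congr 2
      push_cast
      ring
    simp_rw [h1]
    rw [integral_const_mul, GaussianFourier.integral_cexp_neg_mul_sq_norm_add hb, finrank_E3,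
      polyEval_C]
    have h2 : ((Real.pi : ℂ) / ((t / 2 : ℝ) : ℂ)) ^ (((3 : ℕ) : ℂ) / 2) =
        (((2 * Real.pi / t) ^ (3 / 2 : ℝ) : ℝ) : ℂ) := by
      rw [Complex.ofReal_cpow (by positivity)]
      congr 1
      · push_cast
        field_simp
      · push_cast; rfl
    rw [h2, pow_zero, mul_one, Complex.ofReal_mul, Complex.ofReal_exp]
    have h3 : (-Complex.I) ^ 2 * (‖ξ‖ : ℂ) ^ 2 / (4 * ((t / 2 : ℝ) : ℂ)) =
        ((-(‖ξ‖ ^ 2 / (2 * t)) : ℝ) : ℂ) := by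
      rw [neg_sq, Complex.I_sq]
      push_cast
      field_simp
      ring
    rw [h3]
    ring
  | succ k ih =>
    intro p hp hΔ ξ
    -- Euler's identity writes `(k + 1) p` as `∑ xⱼ ∂ⱼp` with each `∂ⱼp` harmonic of degree `k`.
    -- Multiplication by `xⱼ` becomes `i ∂ⱼ` of the transform of `∂ⱼp` known by induction. By the
    -- product rule the second derivatives of `p` sum to the Laplacian and vanish; the derivative of
    -- the Gaussian leaves `-ξⱼ / t`, and Euler's identity is used again.
    set A : ℂ := (((2 * Real.pi / t) ^ (3 / 2 : ℝ) : ℝ) : ℂ) * (-Complex.I / t) ^ k with hA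
    have hd : ∀ j, ∫ x, heckeIntegrand t (MvPolynomial.X j * MvPolynomial.pderiv j p) ξ x =
        Complex.I * (A * ((polyEval (MvPolynomial.pderiv j (MvPolynomial.pderiv j p)) ξ *
          Real.exp (-(‖ξ‖ ^ 2 / (2 * t))) + polyEval (MvPolynomial.pderiv j p) ξ *
          (Real.exp (-(‖ξ‖ ^ 2 / (2 * t))) * (-(ξ j / t))) : ℝ) : ℂ)) := by
      intro j
      have h1 := hasDerivAt_integral_heckeIntegrand ht (MvPolynomial.pderiv j p) j ξ
      have hq : (MvPolynomial.pderiv j p).IsHomogeneous k := by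
        simpa using hp.pderiv (i := j)
      simp_rw [ih _ hq (polyLaplacian_pderiv hΔ j)] at h1
      have h2 : HasDerivAt (fun r : ℝ => -(‖ξ + r • unitVec j‖ ^ 2 / (2 * t))) (-(ξ j / t)) 0 := by
        have h3 : ∀ r : ℝ, ‖ξ + r • unitVec j‖ ^ 2 = ‖ξ‖ ^ 2 + 2 * r * ξ j + r ^ 2 := by
          intro r
          rw [norm_add_sq_real, real_inner_smul_right, real_inner_comm, inner_unitVec, norm_smul,
            mul_pow]
          have : ‖unitVec j‖ = 1 := by rw [unitVec, PiLp.norm_single, norm_one]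
          rw [this, Real.norm_eq_abs, sq_abs]
          ring
        simp_rw [h3]
        have h4 : HasDerivAt (fun r : ℝ => ‖ξ‖ ^ 2 + 2 * r * ξ j + r ^ 2) (2 * ξ j) 0 := by
          have h5 := ((((hasDerivAt_id (0 : ℝ)).const_mul 2).mul_const (ξ j)).const_add
            (‖ξ‖ ^ 2)).fun_add (hasDerivAt_pow 2 (0 : ℝ))
          simpa using h5
        refine (h4.div_const (2 * t)).fun_neg.congr_deriv ?_
        field_simp
      have h7 := (hasDerivAt_polyEval (MvPolynomial.pderiv j p) j ξ).mul h2.exp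
      simp only [zero_smul, add_zero] at h7
      have h8 := h7.ofReal_comp.const_mul A
      have h9 := h1.unique h8
      rw [← h9, ← mul_assoc]
      simp
    have hsum : ((k + 1 : ℕ) : ℂ) * ∫ x, heckeIntegrand t p ξ x =
        ∑ j, ∫ x, heckeIntegrand t (MvPolynomial.X j * MvPolynomial.pderiv j p) ξ x := by
      rw [← integral_finsetSum _ fun j _ => integrable_heckeIntegrand ht _ ξ,
        ← integral_const_mul]
      refine integral_congr_ae (Eventually.of_forall fun x => ?_)
      simp only [heckeIntegrand, polyEval_mul, polyEval_X]
      rw [← Finset.sum_mul, ← Complex.ofReal_sum, ← Finset.sum_mul,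
        polyEval_sum_X_mul_pderiv hp x]
      push_cast
      ring
    have hk : ((k + 1 : ℕ) : ℂ) ≠ 0 := by exact_mod_cast Nat.succ_ne_zero k
    apply mul_left_cancel₀ hk
    rw [hsum]
    simp_rw [hd]
    rw [← Finset.mul_sum, ← Finset.mul_sum, ← Complex.ofReal_sum, Finset.sum_add_distrib,
      ← Finset.sum_mul, ← polyEval_sum]
    have hΔ' : ∑ i, MvPolynomial.pderiv i (MvPolynomial.pderiv i p) = 0 := hΔ
    have hE := polyEval_sum_X_mul_pderiv hp ξ
    have h10 : ∑ i, polyEval (MvPolynomial.pderiv i p) ξ *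
        (Real.exp (-(‖ξ‖ ^ 2 / (2 * t))) * (-(ξ i / t))) =
        -(Real.exp (-(‖ξ‖ ^ 2 / (2 * t))) / t) * (((k + 1 : ℕ) : ℝ) * polyEval p ξ) := by
      rw [← hE, Finset.mul_sum]
      refine Finset.sum_congr rfl fun i _ => ?_
      ring
    rw [hΔ', h10, polyEval_zero, zero_mul, zero_add, hA, pow_succ]
    push_cast
    ring

/-! ### The Fourier transform of homogeneous harmonic functions -/

/-- A power of `|x|` becomes a superposition of Gaussians, to which Hecke's identity applies. The
companion formula, obtained by `t ↦ 1/t`, recombines the transformed Gaussians `exp (-r² / (2t))`.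
-/
theorem integral_rpow_mul_exp_scale (n : ℕ) {r : ℝ} (hr : 0 < r) :
    ∫ t in Set.Ioi (0 : ℝ), t ^ ((n + 1 : ℝ) / 2 - 1) * Real.exp (-(r ^ 2 / 2 * t)) =
      2 ^ ((n + 1 : ℝ) / 2) * Real.Gamma ((n + 1 : ℝ) / 2) * (r ^ (n + 1))⁻¹ := by
  rw [Real.integral_rpow_mul_exp_neg_mul_Ioi (by positivity) (by positivity)]
  have h : (1 / (r ^ 2 / 2)) ^ ((n + 1 : ℝ) / 2) = 2 ^ ((n + 1 : ℝ) / 2) * (r ^ (n + 1))⁻¹ := by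
    rw [one_div_div, Real.div_rpow (by norm_num) (by positivity), div_eq_mul_inv]
    congr 2
    rw [← Real.rpow_natCast r 2, ← Real.rpow_mul hr.le, ← Real.rpow_natCast r (n + 1)]
    congr 1
    push_cast
    ring
  rw [h]
  ring

theorem integral_rpow_mul_exp_scale_inv (n : ℕ) {r : ℝ} (hr : 0 < r) :
    ∫ t in Set.Ioi (0 : ℝ), t ^ (-1 - (n + 1 : ℝ) / 2) * Real.exp (-(r ^ 2 / (2 * t))) =
      2 ^ ((n + 1 : ℝ) / 2) * Real.Gamma ((n + 1 : ℝ) / 2) * (r ^ (n + 1))⁻¹ := by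
  rw [← integral_rpow_mul_exp_scale n hr, ← integral_comp_rpow_Ioi _ (neg_ne_zero.2 one_ne_zero)]
  refine setIntegral_congr_fun measurableSet_Ioi fun t ht => ?_
  have ht' : (0 : ℝ) < t := ht
  simp only [abs_neg, abs_one, one_mul, smul_eq_mul]
  rw [← Real.rpow_mul ht'.le, ← mul_assoc, ← Real.rpow_add ht', Real.rpow_neg_one]
  congr 2
  · ring
  · field_simp

/-- Fubini for a superposition `κ(x) = ∫ K(x, t) dt` of nonnegative kernels. -/
theorem integral_mul_superposition {H : E3 → ℂ} {K : E3 → ℝ → ℝ} {κ : E3 → ℝ}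
    (hH : AEStronglyMeasurable H volume)
    (hK : Measurable (Function.uncurry K)) (hK0 : ∀ x, ∀ t ∈ Set.Ioi (0 : ℝ), 0 ≤ K x t)
    (hκ : ∀ x, x ≠ 0 → ∫ t in Set.Ioi (0 : ℝ), K x t = κ x)
    (hκ0 : ∀ x, x ≠ 0 → κ x ≠ 0) (hi : Integrable fun x => H x * (κ x : ℂ)) :
    ∫ x, H x * (κ x : ℂ) = ∫ t in Set.Ioi (0 : ℝ), ∫ x, H x * (K x t : ℂ) := by
  have hne : ∀ᵐ x : E3, x ≠ 0 := Measure.ae_ne _ _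
  -- A nonintegrable function has integral `0` by convention, so `κ x ≠ 0` already gives
  -- integrability.
  have hKi : ∀ x, x ≠ 0 → Integrable (K x) (volume.restrict (Set.Ioi (0 : ℝ))) := fun x hx =>
    Integrable.of_integral_ne_zero (by rw [hκ x hx]; exact hκ0 x hx)
  have hmeas : AEStronglyMeasurable (fun z : E3 × ℝ => H z.1 * (K z.1 z.2 : ℂ))
      ((volume : Measure E3).prod (volume.restrict (Set.Ioi (0 : ℝ)))) :=
    hH.comp_fst.mul (Complex.measurable_ofReal.comp hK).aestronglyMeasurable
  have hint : Integrable (fun z : E3 × ℝ => H z.1 * (K z.1 z.2 : ℂ))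
      ((volume : Measure E3).prod (volume.restrict (Set.Ioi (0 : ℝ)))) := by
    rw [integrable_prod_iff hmeas]
    refine ⟨?_, ?_⟩
    · filter_upwards [hne] with x hx
      exact (hKi x hx).ofReal.const_mul _
    · refine hi.norm.congr ?_
      filter_upwards [hne] with x hx
      have h1 : ∀ᵐ t ∂(volume.restrict (Set.Ioi (0 : ℝ))), ‖H x * (K x t : ℂ)‖ = ‖H x‖ * K x t := by
        filter_upwards [ae_restrict_mem measurableSet_Ioi] with t ht
        rw [norm_mul, Complex.norm_real, Real.norm_of_nonneg (hK0 x t ht)]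
      rw [integral_congr_ae h1, integral_const_mul, hκ x hx, norm_mul, Complex.norm_real,
        Real.norm_of_nonneg]
      rw [← hκ x hx]
      exact setIntegral_nonneg measurableSet_Ioi (hK0 x)
  rw [← integral_integral_swap hint]
  refine integral_congr_ae ?_
  filter_upwards [hne] with x hx
  rw [integral_const_mul]
  congr 1
  rw [← hκ x hx]
  exact (integral_ofReal (𝕜 := ℂ)).symm

theorem polyEval_smul {p : MvPolynomial (Fin 3) ℝ} {k : ℕ} (hp : p.IsHomogeneous k) (r : ℝ)
    (x : E3) : polyEval p (r • x) = r ^ k * polyEval p x := by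
  unfold polyEval
  have : (fun i => (r • x) i) = r • (fun i => x i) := by ext i; simp
  rw [this, MvPolynomial.eval_eq, MvPolynomial.eval_eq, Finset.mul_sum]
  refine Finset.sum_congr rfl fun d hd => ?_
  have h1 : ∏ i ∈ d.support, (r • fun i => x i) i ^ d i = r ^ k * ∏ i ∈ d.support, x i ^ d i := by
    simp only [Pi.smul_apply, smul_eq_mul, mul_pow]
    rw [Finset.prod_mul_distrib, Finset.prod_pow_eq_pow_sum]
    congr 2
    exact (hp.degree_eq_sum_deg_support hd).symm
  rw [h1]
  ring

theorem exists_polyEval_le {p : MvPolynomial (Fin 3) ℝ} {k : ℕ} (hp : p.IsHomogeneous k) :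
    ∃ A : ℝ, 0 ≤ A ∧ ∀ x : E3, |polyEval p x| ≤ A * ‖x‖ ^ k := by
  obtain ⟨A, hA⟩ := (isCompact_closedBall (0 : E3) 1).exists_bound_of_continuousOn
    (continuous_polyEval p).continuousOn
  have hA0 : 0 ≤ A := (norm_nonneg _).trans (hA 0 (by simp))
  refine ⟨A, hA0, fun x => ?_⟩
  by_cases hx : x = 0
  · have h1 : x = (0 : ℝ) • x := by simp [hx]
    by_cases hk : k = 0
    · subst hk
      simpa [hx] using hA x (by simp [hx])
    · rw [h1, polyEval_smul hp]
      simp [hk]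
  · have hx' : 0 < ‖x‖ := norm_pos_iff.2 hx
    have h1 : x = ‖x‖ • (‖x‖⁻¹ • x) := by
      rw [smul_smul, mul_inv_cancel₀ hx'.ne', one_smul]
    have h2 := hA (‖x‖⁻¹ • x) (by simp [norm_smul, hx'.ne'])
    have h3 : polyEval p x = ‖x‖ ^ k * polyEval p (‖x‖⁻¹ • x) := by
      rw [← polyEval_smul hp, ← h1]
    rw [h3, abs_mul, abs_of_nonneg (by positivity : (0 : ℝ) ≤ ‖x‖ ^ k), mul_comm]
    exact mul_le_mul_of_nonneg_right h2 (by positivity)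

theorem integrableOn_inv_norm_sq_ball (r : ℝ) :
    IntegrableOn (fun x : E3 => (‖x‖ ^ 2)⁻¹) (Metric.ball 0 r) := by
  rw [integrableOn_fun_norm_addHaar volume (f := fun t : ℝ => (t ^ 2)⁻¹), finrank_E3]
  have h : IntegrableOn (fun _ : ℝ => (1 : ℝ)) (Set.Ioo 0 r) := by simp
  refine h.congr_fun (fun y hy => ?_) measurableSet_Ioo
  have : y ≠ 0 := hy.1.ne'
  simp only [smul_eq_mul]
  field_simp

/-- A function bounded by a constant times `1 + |x|⁻²` is integrable against bounded integrable
functions. -/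
theorem integrable_mul_of_le_inv_norm_sq {h : E3 → ℝ} (hm : AEStronglyMeasurable h volume) {A : ℝ}
    (hA : ∀ x : E3, x ≠ 0 → |h x| ≤ A * (1 + (‖x‖ ^ 2)⁻¹)) {g : E3 → ℂ} (hg : Integrable g)
    {B : ℝ} (hB : ∀ x, ‖g x‖ ≤ B) : Integrable fun x => (h x : ℂ) * g x := by
  have hne : ∀ᵐ x : E3, x ≠ 0 := Measure.ae_ne _ _
  have hA0 : 0 ≤ A := by
    have h1 := (abs_nonneg _).trans (hA (unitVec 0) fun h => by
      have := congrArg (fun v : E3 => v 0) h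
      simp [unitVec] at this)
    have h2 : 0 < 1 + (‖unitVec 0‖ ^ 2)⁻¹ := by positivity
    exact nonneg_of_mul_nonneg_left h1 h2
  have hB0 : 0 ≤ B := (norm_nonneg _).trans (hB 0)
  have hi : Integrable ((Metric.ball (0 : E3) 1).indicator fun x => (‖x‖ ^ 2)⁻¹) :=
    (integrableOn_inv_norm_sq_ball 1).integrable_indicator measurableSet_ball
  refine ((hg.norm.const_mul (2 * A)).add (hi.const_mul (A * B))).mono'
    ((Complex.continuous_ofReal.comp_aestronglyMeasurable hm).mul hg.aestronglyMeasurable) ?_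
  filter_upwards [hne] with x hx
  rw [norm_mul, Complex.norm_real, Real.norm_eq_abs]
  simp only [Pi.add_apply]
  have h0 := norm_nonneg (g x)
  by_cases hxb : x ∈ Metric.ball (0 : E3) 1
  · rw [Set.indicator_of_mem hxb]
    calc |h x| * ‖g x‖ ≤ A * (1 + (‖x‖ ^ 2)⁻¹) * ‖g x‖ := by gcongr; exact hA x hx
      _ = A * ‖g x‖ + A * (‖x‖ ^ 2)⁻¹ * ‖g x‖ := by ring
      _ ≤ 2 * A * ‖g x‖ + A * (‖x‖ ^ 2)⁻¹ * B := by
          gcongr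
          · linarith
          · exact hB x
      _ = _ := by ring
  · rw [Set.indicator_of_notMem hxb, mul_zero, add_zero]
    have h1 : 1 ≤ ‖x‖ := by simpa using hxb
    have h2 : (‖x‖ ^ 2)⁻¹ ≤ 1 := inv_le_one_of_one_le₀ (one_le_pow₀ h1)
    calc |h x| * ‖g x‖ ≤ A * (1 + (‖x‖ ^ 2)⁻¹) * ‖g x‖ := by gcongr; exact hA x hx
      _ ≤ A * (1 + 1) * ‖g x‖ := by gcongr
      _ = _ := by ring

theorem norm_fourier_le (φ : E3 → ℂ) (x : E3) :
    ‖fourier φ x‖ ≤ (2 * Real.pi) ^ (-(3 / 2) : ℝ) * ∫ ξ, ‖φ ξ‖ := by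
  unfold fourier
  rw [norm_mul, Complex.norm_real, Real.norm_of_nonneg (by positivity)]
  gcongr
  refine (norm_integral_le_integral_norm _).trans (le_of_eq ?_)
  refine integral_congr_ae (Eventually.of_forall fun ξ => ?_)
  simp only [norm_mul]
  rw [norm_exp_neg_I_mul, mul_one]

/-- The multiplication formula for a Gaussian times a harmonic polynomial. -/
theorem integral_gaussian_polyEval_mul_fourier {p : MvPolynomial (Fin 3) ℝ} {k : ℕ}
    (hp : p.IsHomogeneous k) (hΔ : polyLaplacian p = 0) {φ : E3 → ℂ} (hφ : Integrable φ)
    {t : ℝ} (ht : 0 < t) :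
    ∫ x, (polyEval p x : ℂ) * fourier φ x * ((Real.exp (-(‖x‖ ^ 2 / 2 * t)) : ℝ) : ℂ) =
    (((t ^ (3 / 2 : ℝ))⁻¹ * (t ^ k)⁻¹ : ℝ) : ℂ) * (-Complex.I) ^ k *
      ∫ ξ, (polyEval p ξ : ℂ) * φ ξ * ((Real.exp (-(‖ξ‖ ^ 2 / (2 * t))) : ℝ) : ℂ) := by
  set c : ℝ := (2 * Real.pi) ^ (-(3 / 2) : ℝ) with hc
  have hi : Integrable (fun z : E3 × E3 => ((polyEval p z.1 *
      Real.exp (-(t / 2 * ‖z.1‖ ^ 2)) : ℝ) : ℂ) * φ z.2 *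
      Complex.exp (-(Complex.I * ((inner ℝ z.1 z.2 : ℝ) : ℂ)))) (volume.prod volume) := by
    refine ((integrable_polyEval_mul_exp p (t / 2) (by positivity)).ofReal.mul_prod hφ).mul_bdd
      (c := 1) (Continuous.aestronglyMeasurable (by fun_prop)) (Eventually.of_forall fun z => ?_)
    exact (norm_exp_neg_I_mul _).le
  calc ∫ x, (polyEval p x : ℂ) * fourier φ x * ((Real.exp (-(‖x‖ ^ 2 / 2 * t)) : ℝ) : ℂ)
      = ∫ x, (c : ℂ) * ∫ ξ, ((polyEval p x * Real.exp (-(t / 2 * ‖x‖ ^ 2)) : ℝ) : ℂ) * φ ξ *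
          Complex.exp (-(Complex.I * ((inner ℝ x ξ : ℝ) : ℂ))) := by
        refine integral_congr_ae (Eventually.of_forall fun x => ?_)
        simp only [fourier, mul_assoc]
        rw [integral_const_mul, ← hc]
        rw [show ‖x‖ ^ 2 / 2 * t = t / 2 * ‖x‖ ^ 2 by ring]
        push_cast
        ring
    _ = (c : ℂ) * ∫ ξ, ∫ x, ((polyEval p x * Real.exp (-(t / 2 * ‖x‖ ^ 2)) : ℝ) : ℂ) * φ ξ *
          Complex.exp (-(Complex.I * ((inner ℝ x ξ : ℝ) : ℂ))) := by
        rw [integral_const_mul, integral_integral_swap hi]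
    _ = (c : ℂ) * ∫ ξ, φ ξ * ∫ x, heckeIntegrand t p ξ x := by
        congr 1
        refine integral_congr_ae (Eventually.of_forall fun ξ => ?_)
        simp only
        rw [← integral_const_mul]
        refine integral_congr_ae (Eventually.of_forall fun x => ?_)
        simp only [heckeIntegrand]
        rw [real_inner_comm]
        ring
    _ = (c : ℂ) * ∫ ξ, ((((2 * Real.pi / t) ^ (3 / 2 : ℝ) : ℝ) : ℂ) * (-Complex.I / t) ^ k) *
          ((polyEval p ξ : ℂ) * φ ξ * ((Real.exp (-(‖ξ‖ ^ 2 / (2 * t))) : ℝ) : ℂ)) := by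
        congr 1
        refine integral_congr_ae (Eventually.of_forall fun ξ => ?_)
        simp only
        rw [integral_heckeIntegrand ht k p hp hΔ ξ]
        push_cast
        ring
    _ = _ := by
        rw [integral_const_mul, ← mul_assoc]
        congr 1
        have h1 : c * (2 * Real.pi / t) ^ (3 / 2 : ℝ) = (t ^ (3 / 2 : ℝ))⁻¹ := by
          rw [hc, Real.div_rpow (by positivity) ht.le, Real.rpow_neg (by positivity)]
          have : (2 * Real.pi) ^ (3 / 2 : ℝ) ≠ 0 := by positivity
          field_simp
        rw [← mul_assoc, ← Complex.ofReal_mul, h1, div_pow]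
        push_cast
        ring

/-- The constant of the Fourier transform of `p(x/|x|) / |x|`. -/
def bochnerConst (k : ℕ) : ℝ :=
  Real.sqrt 2 * Real.Gamma ((k + 2 : ℝ) / 2) / Real.Gamma ((k + 1 : ℝ) / 2)

theorem abs_polyEval_div_le {p : MvPolynomial (Fin 3) ℝ} {k : ℕ} {A : ℝ}
    (hA : ∀ x : E3, |polyEval p x| ≤ A * ‖x‖ ^ k) (n : ℕ) {x : E3} (hx : x ≠ 0) :
    |polyEval p x * (‖x‖ ^ (k + n))⁻¹| ≤ A * (‖x‖ ^ n)⁻¹ := by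
  have hx' : 0 < ‖x‖ := norm_pos_iff.2 hx
  rw [abs_mul, abs_of_pos (by positivity : 0 < (‖x‖ ^ (k + n))⁻¹)]
  calc |polyEval p x| * (‖x‖ ^ (k + n))⁻¹ ≤ A * ‖x‖ ^ k * (‖x‖ ^ (k + n))⁻¹ := by
        gcongr; exact hA x
    _ = _ := by rw [pow_add]; field_simp

theorem inv_norm_le_one_add (x : E3) : ‖x‖⁻¹ ≤ 1 + (‖x‖ ^ 2)⁻¹ := by
  rw [← inv_pow]
  nlinarith [sq_nonneg (‖x‖⁻¹ - 1), inv_nonneg.2 (norm_nonneg x)]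

theorem aestronglyMeasurable_polyEval_div (p : MvPolynomial (Fin 3) ℝ) (n : ℕ) :
    AEStronglyMeasurable (fun x : E3 => polyEval p x * (‖x‖ ^ n)⁻¹) volume :=
  ((continuous_polyEval p).measurable.mul
    ((measurable_norm.pow_const n).inv)).aestronglyMeasurable

theorem measurable_superposition_kernel (s : ℝ) (g : E3 → ℝ → ℝ)
    (hg : Measurable (Function.uncurry g)) :
    Measurable (Function.uncurry fun (x : E3) (t : ℝ) => t ^ s * Real.exp (-(g x t))) :=
  (measurable_snd.pow_const s).mul (Real.measurable_exp.comp hg.neg)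

/-- **Bochner's formula**: the Fourier transform of `p(x/|x|) / |x|` is a multiple of
`p(ξ/|ξ|) / |ξ|²`. -/
theorem integral_polyEval_div_mul_fourier {p : MvPolynomial (Fin 3) ℝ} {k : ℕ}
    (hp : p.IsHomogeneous k) (hΔ : polyLaplacian p = 0) {φ : E3 → ℂ} (hφ : Integrable φ)
    {B : ℝ} (hB : ∀ x, ‖φ x‖ ≤ B) (hφ' : Integrable (fourier φ)) :
    ∫ x, ((polyEval p x * (‖x‖ ^ (k + 1))⁻¹ : ℝ) : ℂ) * fourier φ x =
      (bochnerConst k : ℂ) * (-Complex.I) ^ k *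
        ∫ ξ, ((polyEval p ξ * (‖ξ‖ ^ (k + 2))⁻¹ : ℝ) : ℂ) * φ ξ := by
  obtain ⟨A, hA0, hA⟩ := exists_polyEval_le hp
  let a : ℝ := (k + 1 : ℝ) / 2
  let b : ℝ := (k + 2 : ℝ) / 2
  have ha : 0 < a := by positivity
  have hb : 0 < b := by positivity
  let ca : ℝ := 2 ^ a * Real.Gamma a
  let cb : ℝ := 2 ^ b * Real.Gamma b
  have hca : 0 < ca := mul_pos (by positivity) (Real.Gamma_pos_of_pos ha)
  have hcb : 0 < cb := mul_pos (by positivity) (Real.Gamma_pos_of_pos hb)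
  have hiL : Integrable fun x => ((polyEval p x * (‖x‖ ^ (k + 1))⁻¹ : ℝ) : ℂ) * fourier φ x := by
    refine integrable_mul_of_le_inv_norm_sq (aestronglyMeasurable_polyEval_div p (k + 1)) (A := A)
      (fun x hx => ?_) hφ' (norm_fourier_le φ)
    refine (abs_polyEval_div_le hA 1 hx).trans ?_
    rw [pow_one]
    exact mul_le_mul_of_nonneg_left (inv_norm_le_one_add x) hA0
  have hiR : Integrable fun ξ => ((polyEval p ξ * (‖ξ‖ ^ (k + 2))⁻¹ : ℝ) : ℂ) * φ ξ := by
    refine integrable_mul_of_le_inv_norm_sq (aestronglyMeasurable_polyEval_div p (k + 2)) (A := A)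
      (fun x hx => ?_) hφ hB
    refine (abs_polyEval_div_le hA 2 hx).trans ?_
    exact mul_le_mul_of_nonneg_left (by linarith) hA0
  have hpm : AEStronglyMeasurable (fun x : E3 => (polyEval p x : ℂ)) volume :=
    (Complex.continuous_ofReal.comp (continuous_polyEval p)).aestronglyMeasurable
  have hL := integral_mul_superposition (H := fun x => (polyEval p x : ℂ) * fourier φ x)
    (K := fun x t => t ^ (a - 1) * Real.exp (-(‖x‖ ^ 2 / 2 * t)))
    (κ := fun x => ca * (‖x‖ ^ (k + 1))⁻¹) (hpm.mul hφ'.aestronglyMeasurable)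
    (measurable_superposition_kernel _ _ (by fun_prop))
    (fun x t ht => mul_nonneg (Real.rpow_nonneg (le_of_lt ht) _) (Real.exp_pos _).le)
    (fun x hx => integral_rpow_mul_exp_scale k (norm_pos_iff.2 hx))
    (fun x hx => (mul_pos hca (by have := norm_pos_iff.2 hx; positivity)).ne')
    ((hiL.const_mul (ca : ℂ)).congr (Eventually.of_forall fun x => by push_cast; ring))
  have hR := integral_mul_superposition (H := fun x => (polyEval p x : ℂ) * φ x)
    (K := fun x t => t ^ (-1 - b) * Real.exp (-(‖x‖ ^ 2 / (2 * t))))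
    (κ := fun x => cb * (‖x‖ ^ (k + 2))⁻¹) (hpm.mul hφ.aestronglyMeasurable)
    (measurable_superposition_kernel _ _ (by fun_prop))
    (fun x t ht => mul_nonneg (Real.rpow_nonneg (le_of_lt ht) _) (Real.exp_pos _).le)
    (fun x hx => by
      have h := integral_rpow_mul_exp_scale_inv (k + 1) (norm_pos_iff.2 hx)
      have hbk : (((k + 1 : ℕ) : ℝ) + 1) / 2 = b := by simp only [b]; push_cast; ring
      rw [hbk] at h
      exact h)
    (fun x hx => (mul_pos hcb (by have := norm_pos_iff.2 hx; positivity)).ne')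
    ((hiR.const_mul (cb : ℂ)).congr (Eventually.of_forall fun x => by push_cast; ring))
  -- Both sides are integrals over `t > 0`, compared for each `t` by the Gaussian multiplication
  -- formula. The powers of `t` match because `(a - 1) - 3/2 - k = -1 - b`.
  have hLR : ∫ x, (polyEval p x : ℂ) * fourier φ x * ((ca * (‖x‖ ^ (k + 1))⁻¹ : ℝ) : ℂ) =
      (-Complex.I) ^ k * ∫ ξ, (polyEval p ξ : ℂ) * φ ξ * ((cb * (‖ξ‖ ^ (k + 2))⁻¹ : ℝ) : ℂ) := by
    rw [hL, hR, ← integral_const_mul]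
    refine setIntegral_congr_fun measurableSet_Ioi fun t ht => ?_
    have ht' : (0 : ℝ) < t := ht
    have h1 : ∀ (f : E3 → ℂ) (g : E3 → ℝ) (s : ℝ), ∫ x, f x * ((s * g x : ℝ) : ℂ) =
        (s : ℂ) * ∫ x, f x * (g x : ℂ) := by
      intro f g s
      rw [← integral_const_mul]
      refine integral_congr_ae (Eventually.of_forall fun x => ?_)
      simp only
      push_cast
      ring
    rw [h1, h1, integral_gaussian_polyEval_mul_fourier hp hΔ hφ ht']
    have h2 : t ^ (a - 1) * ((t ^ (3 / 2 : ℝ))⁻¹ * (t ^ k)⁻¹) = t ^ (-1 - b) := by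
      rw [← Real.rpow_natCast t k, ← Real.rpow_neg ht'.le, ← Real.rpow_neg ht'.le,
        ← Real.rpow_add ht', ← Real.rpow_add ht']
      congr 1
      simp only [a, b]
      ring
    rw [← h2]
    push_cast
    ring
  have hcL : ∫ x, (polyEval p x : ℂ) * fourier φ x * ((ca * (‖x‖ ^ (k + 1))⁻¹ : ℝ) : ℂ) =
      (ca : ℂ) * ∫ x, ((polyEval p x * (‖x‖ ^ (k + 1))⁻¹ : ℝ) : ℂ) * fourier φ x := by
    rw [← integral_const_mul]
    refine integral_congr_ae (Eventually.of_forall fun x => ?_)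
    simp only
    push_cast
    ring
  have hcR : ∫ ξ, (polyEval p ξ : ℂ) * φ ξ * ((cb * (‖ξ‖ ^ (k + 2))⁻¹ : ℝ) : ℂ) =
      (cb : ℂ) * ∫ ξ, ((polyEval p ξ * (‖ξ‖ ^ (k + 2))⁻¹ : ℝ) : ℂ) * φ ξ := by
    rw [← integral_const_mul]
    refine integral_congr_ae (Eventually.of_forall fun x => ?_)
    simp only
    push_cast
    ring
  rw [hcL, hcR] at hLR
  have hquot : bochnerConst k = cb / ca := by
    simp only [bochnerConst, ca, cb]
    have h3 : b = a + 1 / 2 := by simp only [a, b]; ring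
    have h4 : (2 : ℝ) ^ b = 2 ^ a * Real.sqrt 2 := by
      rw [h3, Real.rpow_add (by norm_num), Real.sqrt_eq_rpow]
    rw [h4]
    have h5 : (2 : ℝ) ^ a ≠ 0 := by positivity
    have h6 : Real.Gamma a ≠ 0 := (Real.Gamma_pos_of_pos ha).ne'
    change Real.sqrt 2 * Real.Gamma b / Real.Gamma a = _
    field_simp
  have hca' : (ca : ℂ) ≠ 0 := by exact_mod_cast hca.ne'
  apply mul_left_cancel₀ hca'
  rw [hLR, hquot]
  push_cast
  field_simp

/-! ### The space of harmonic polynomials of a given degree -/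

/-- The space of homogeneous harmonic polynomials of degree `k`. -/
def harmonicSubmodule (k : ℕ) : Submodule ℝ (MvPolynomial (Fin 3) ℝ) where
  carrier := {p | p.IsHomogeneous k ∧ polyLaplacian p = 0}
  add_mem' := by
    rintro p q ⟨hp, hp'⟩ ⟨hq, hq'⟩
    refine ⟨hp.add hq, ?_⟩
    unfold polyLaplacian at *
    simp only [map_add, Finset.sum_add_distrib, hp', hq', add_zero]
  zero_mem' := ⟨MvPolynomial.isHomogeneous_zero _ _ _, by simp [polyLaplacian]⟩
  smul_mem' := by
    rintro c p ⟨hp, hp'⟩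
    refine ⟨(MvPolynomial.homogeneousSubmodule (Fin 3) ℝ k).smul_mem c hp, ?_⟩
    unfold polyLaplacian at *
    simp only [Derivation.map_smul, ← Finset.smul_sum, hp', smul_zero]

/-- The coefficient of the Laplace equation at `m` is a linear relation between the coefficients at
`m + 2eᵢ`. Iterating it, a harmonic polynomial is determined by its terms of degree at most one in
the last variable, which bounds the dimension. -/
theorem coeff_add_two_eq_zero {p : MvPolynomial (Fin 3) ℝ} (hp : polyLaplacian p = 0)
    {m : Fin 3 →₀ ℕ}
    (h0 : MvPolynomial.coeff (m + Finsupp.single 0 1 + Finsupp.single 0 1) p = 0)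
    (h1 : MvPolynomial.coeff (m + Finsupp.single 1 1 + Finsupp.single 1 1) p = 0) :
    MvPolynomial.coeff (m + Finsupp.single 2 1 + Finsupp.single 2 1) p = 0 := by
  have h := congrArg (MvPolynomial.coeff m) hp
  unfold polyLaplacian at h
  rw [MvPolynomial.coeff_sum, Fin.sum_univ_three] at h
  simp only [MvPolynomial.coeff_pderiv, h0, h1, zero_mul, zero_add, MvPolynomial.coeff_zero] at h
  rw [mul_assoc] at h
  refine (mul_eq_zero.1 h).resolve_right ?_
  positivity

theorem harmonic_coeff_eq_zero {k : ℕ} {p : MvPolynomial (Fin 3) ℝ} (hp : p ∈ harmonicSubmodule k)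
    (h : ∀ m : Fin 3 →₀ ℕ, m 2 ≤ 1 → MvPolynomial.coeff m p = 0) (c : ℕ) :
    ∀ m : Fin 3 →₀ ℕ, m 2 = c → MvPolynomial.coeff m p = 0 := by
  induction c using Nat.strong_induction_on with
  | _ c ih =>
    intro m hm
    by_cases hc : c ≤ 1
    · exact h m (hm.trans_le hc)
    · obtain ⟨n, rfl⟩ : ∃ n, m = n + Finsupp.single 2 1 + Finsupp.single 2 1 := by
        refine ⟨m - Finsupp.single 2 2, ?_⟩
        rw [add_assoc, ← Finsupp.single_add, tsub_add_cancel_of_le]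
        rw [Finsupp.single_le_iff]
        omega
      simp only [Finsupp.add_apply, Finsupp.single_eq_same] at hm
      refine coeff_add_two_eq_zero hp.2 (ih (n 2) (by omega) _ ?_) (ih (n 2) (by omega) _ ?_) <;>
      simp

/-- The coefficients of a harmonic polynomial of degree at most one in the last variable. -/
def harmonicData (k : ℕ) :
    harmonicSubmodule k →ₗ[ℝ] (Fin (k + 1) → ℝ) × (Fin (k + 1) → ℝ) where
  toFun p := (fun j => MvPolynomial.coeff
      (Finsupp.single 0 (j : ℕ) + Finsupp.single 1 (k - j)) (p : MvPolynomial (Fin 3) ℝ),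
    -- For `j = k` the truncated subtraction gives a monomial of degree `k + 1`, whose coefficient
    -- is zero. This redundant slot is harmless, as only linear growth of the dimension matters.
    fun j => MvPolynomial.coeff (Finsupp.single 0 (j : ℕ) + Finsupp.single 1 (k - 1 - j) +
      Finsupp.single 2 1) (p : MvPolynomial (Fin 3) ℝ))
  map_add' p q := by ext <;> simp
  map_smul' c p := by ext <;> simp

theorem injective_harmonicData (k : ℕ) : Function.Injective (harmonicData k) := by
  rw [injective_iff_map_eq_zero]
  rintro ⟨p, hp⟩ h
  have h1 : ∀ j : Fin (k + 1), MvPolynomial.coeff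
      (Finsupp.single 0 (j : ℕ) + Finsupp.single 1 (k - j)) p = 0 := fun j =>
    congrFun (congrArg Prod.fst h) j
  have h2 : ∀ j : Fin (k + 1), MvPolynomial.coeff (Finsupp.single 0 (j : ℕ) +
      Finsupp.single 1 (k - 1 - j) + Finsupp.single 2 1) p = 0 := fun j =>
    congrFun (congrArg Prod.snd h) j
  have h3 : ∀ m : Fin 3 →₀ ℕ, m 2 ≤ 1 → MvPolynomial.coeff m p = 0 := by
    intro m hm
    by_cases hd : m.degree = k
    · rw [Finsupp.degree_eq_sum, Fin.sum_univ_three] at hd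
      rcases Nat.le_one_iff_eq_zero_or_eq_one.1 hm with h0 | h0
      · have hm' : m = Finsupp.single 0 (m 0) + Finsupp.single 1 (k - m 0) := by
          ext i
          fin_cases i <;> simp <;> omega
        rw [hm']
        exact h1 ⟨m 0, by omega⟩
      · have hm' : m = Finsupp.single 0 (m 0) + Finsupp.single 1 (k - 1 - m 0) +
            Finsupp.single 2 1 := by
          ext i
          fin_cases i <;> simp <;> omega
        rw [hm']
        exact h2 ⟨m 0, by omega⟩
    · exact hp.1.coeff_eq_zero hd
  have h4 : p = 0 := by
    ext m
    simpa using harmonic_coeff_eq_zero hp h3 _ m rfl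
  exact Subtype.ext h4

instance (k : ℕ) : FiniteDimensional ℝ (harmonicSubmodule k) :=
  Module.Finite.of_injective (harmonicData k) (injective_harmonicData k)

theorem finrank_harmonicSubmodule_le (k : ℕ) :
    Module.finrank ℝ (harmonicSubmodule k) ≤ 2 * (k + 1) := by
  have h := LinearMap.finrank_le_finrank_of_injective (injective_harmonicData k)
  simp only [Module.finrank_prod, Module.finrank_fintype_fun_eq_card, Fintype.card_fin] at h
  omega

/-! ### Rotation of harmonic polynomials -/

/-- The polynomial `x ↦ p (R x)`. -/
def polyRotate (R : E3 ≃ₗᵢ[ℝ] E3) : MvPolynomial (Fin 3) ℝ →ₐ[ℝ] MvPolynomial (Fin 3) ℝ :=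
  MvPolynomial.aeval fun i => ∑ j, MvPolynomial.C (R (unitVec j) i) * MvPolynomial.X j

theorem sum_smul_unitVec (x : E3) : ∑ j, x j • unitVec j = x := by
  ext i
  simp [unitVec_apply]

theorem polyEval_polyRotate (R : E3 ≃ₗᵢ[ℝ] E3) (p : MvPolynomial (Fin 3) ℝ) (x : E3) :
    polyEval (polyRotate R p) x = polyEval p (R x) := by
  induction p using MvPolynomial.induction_on with
  | C a => simp [polyRotate]
  | add p q hp hq => simp [hp, hq]
  | mul_X p i hp =>
    rw [map_mul, polyEval_mul, polyEval_mul, hp, polyEval_X]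
    congr 1
    simp only [polyRotate, MvPolynomial.aeval_X, polyEval_sum, polyEval_mul, polyEval_C, polyEval_X]
    conv_rhs => rw [← sum_smul_unitVec x, map_sum]
    simp [mul_comm]

theorem isHomogeneous_polyRotate (R : E3 ≃ₗᵢ[ℝ] E3) {p : MvPolynomial (Fin 3) ℝ} {k : ℕ}
    (hp : p.IsHomogeneous k) : (polyRotate R p).IsHomogeneous k := by
  have h := hp.aeval (fun i => ∑ j, MvPolynomial.C (R (unitVec j) i) * MvPolynomial.X j)
    (n := 1) fun i => MvPolynomial.IsHomogeneous.sum _ _ _ fun j _ =>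
      MvPolynomial.isHomogeneous_C_mul_X _ _
  simpa [polyRotate] using h

theorem pderiv_polyRotate (R : E3 ≃ₗᵢ[ℝ] E3) (p : MvPolynomial (Fin 3) ℝ) (j : Fin 3) :
    MvPolynomial.pderiv j (polyRotate R p) =
      ∑ i, MvPolynomial.C (R (unitVec j) i) * polyRotate R (MvPolynomial.pderiv i p) := by
  induction p using MvPolynomial.induction_on with
  | C a => simp [polyRotate]
  | add p q hp hq => simp [hp, hq, mul_add, Finset.sum_add_distrib]
  | mul_X p l hp =>
    have hX : MvPolynomial.pderiv j (polyRotate R (MvPolynomial.X l)) =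
        MvPolynomial.C (R (unitVec j) l) := by
      simp [polyRotate, MvPolynomial.pderiv_X, Pi.single_apply]
    have hR : ∀ i, MvPolynomial.C (R (unitVec j) i) *
        polyRotate R (MvPolynomial.pderiv i (p * MvPolynomial.X l)) =
        MvPolynomial.C (R (unitVec j) i) * polyRotate R (MvPolynomial.pderiv i p) *
          polyRotate R (MvPolynomial.X l) +
        if i = l then polyRotate R p * MvPolynomial.C (R (unitVec j) l) else 0 := by
      intro i
      rw [MvPolynomial.pderiv_mul, map_add, map_mul, mul_add, mul_assoc, map_mul]
      congr 1
      split_ifs with h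
      · subst h
        rw [MvPolynomial.pderiv_X_self, map_one, mul_one, mul_comm]
      · rw [MvPolynomial.pderiv_X_of_ne (Ne.symm h), map_zero, mul_zero, mul_zero]
    rw [map_mul, MvPolynomial.pderiv_mul, hp, hX, Finset.sum_congr rfl fun i _ => hR i,
      Finset.sum_add_distrib, Finset.sum_mul, Finset.sum_ite_eq']
    simp

theorem sum_isometry_mul (R : E3 ≃ₗᵢ[ℝ] E3) (i l : Fin 3) :
    ∑ j, R (unitVec j) i * R (unitVec j) l = if i = l then 1 else 0 := by
  have h1 : ∀ i j, R (unitVec j) i = R.symm (unitVec i) j := by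
    intro i j
    rw [← inner_unitVec i, ← inner_unitVec j, real_inner_comm,
      LinearIsometryEquiv.inner_map_eq_flip]
  have h2 : inner ℝ (R.symm (unitVec i)) (R.symm (unitVec l)) =
      ∑ j, R.symm (unitVec i) j * R.symm (unitVec l) j := by
    rw [PiLp.inner_apply]
    exact Finset.sum_congr rfl fun j _ => mul_comm _ _
  simp_rw [h1]
  rw [← h2, LinearIsometryEquiv.inner_map_map, inner_unitVec, unitVec_apply]

/-- The chain rule applied twice produces the products of the matrix of `R` with its transpose,
which is the identity. -/
theorem polyLaplacian_polyRotate (R : E3 ≃ₗᵢ[ℝ] E3) (p : MvPolynomial (Fin 3) ℝ) :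
    polyLaplacian (polyRotate R p) = polyRotate R (polyLaplacian p) := by
  unfold polyLaplacian
  simp only [pderiv_polyRotate, map_sum, MvPolynomial.pderiv_mul, MvPolynomial.pderiv_C, zero_mul,
    zero_add, Finset.mul_sum]
  have h : ∀ i l j : Fin 3, MvPolynomial.C (R (unitVec j) i) * (MvPolynomial.C (R (unitVec j) l) *
      polyRotate R (MvPolynomial.pderiv l (MvPolynomial.pderiv i p))) =
      MvPolynomial.C (R (unitVec j) i * R (unitVec j) l) *
      polyRotate R (MvPolynomial.pderiv l (MvPolynomial.pderiv i p)) := by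
    intro i l j
    rw [map_mul, mul_assoc]
  simp_rw [h]
  rw [Finset.sum_comm]
  refine Finset.sum_congr rfl fun i _ => ?_
  rw [Finset.sum_comm]
  simp_rw [← Finset.sum_mul, ← map_sum, sum_isometry_mul]
  rw [Finset.sum_eq_single i]
  · simp
  · intro l _ hl
    simp [Ne.symm hl]
  · simp

theorem polyRotate_mem (R : E3 ≃ₗᵢ[ℝ] E3) {k : ℕ} {p : MvPolynomial (Fin 3) ℝ}
    (hp : p ∈ harmonicSubmodule k) : polyRotate R p ∈ harmonicSubmodule k :=
  ⟨isHomogeneous_polyRotate R hp.1, by rw [polyLaplacian_polyRotate, hp.2, map_zero]⟩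

/-! ### Invariance of the surface measure -/

/-- The action of a linear isometry on the sphere. -/
def sphereMap (R : E3 ≃ₗᵢ[ℝ] E3) (ω : S2) : S2 := ⟨R ω, by simp⟩

theorem continuous_sphereMap (R : E3 ≃ₗᵢ[ℝ] E3) : Continuous (sphereMap R) :=
  Continuous.subtype_mk (R.continuous.comp continuous_subtype_val) _

-- Surface measure is a multiple of the volume of the cone over a set, and `R` preserves volume and
-- maps cones to cones.
open scoped Pointwise in
theorem measurePreserving_sphereMap (R : E3 ≃ₗᵢ[ℝ] E3) :
    MeasurePreserving (sphereMap R) surfaceMeasure surfaceMeasure := by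
  refine ⟨(continuous_sphereMap R).measurable, ?_⟩
  ext s hs
  rw [Measure.map_apply (continuous_sphereMap R).measurable hs]
  unfold surfaceMeasure
  rw [Measure.toSphere_apply' _ ((continuous_sphereMap R).measurable hs),
    Measure.toSphere_apply' _ hs]
  congr 1
  have hset : (Set.Ioo (0 : ℝ) 1 • ((↑) '' (sphereMap R ⁻¹' s) : Set E3)) =
      R ⁻¹' (Set.Ioo (0 : ℝ) 1 • ((↑) '' s : Set E3)) := by
    ext x
    simp only [Set.mem_smul, Set.mem_image, Set.mem_preimage]
    constructor
    · rintro ⟨r, hr, _, ⟨ω, hω, rfl⟩, rfl⟩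
      exact ⟨r, hr, _, ⟨_, hω, rfl⟩, by simp [sphereMap]⟩
    · rintro ⟨r, hr, _, ⟨ω, hω, rfl⟩, h⟩
      refine ⟨r, hr, _, ⟨sphereMap R.symm ω, ?_, rfl⟩, ?_⟩
      · have : sphereMap R (sphereMap R.symm ω) = ω := Subtype.ext (by simp [sphereMap])
        rwa [this]
      · apply R.injective
        rw [← h]
        simp [sphereMap]
  rw [hset]
  exact R.measurePreserving.measure_preimage_emb R.toHomeomorph.measurableEmbedding _

instance : IsFiniteMeasure surfaceMeasure := by unfold surfaceMeasure; infer_instance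

instance : surfaceMeasure.IsOpenPosMeasure := by unfold surfaceMeasure; infer_instance

/-! ### The supremum bound for spherical harmonics -/

/-- The restriction of a harmonic polynomial to the sphere. -/
def restrictSphere (k : ℕ) : harmonicSubmodule k →ₗ[ℝ] C(S2, ℝ) where
  toFun p := ⟨fun ω => polyEval p ω, (continuous_polyEval p).comp continuous_subtype_val⟩
  map_add' p q := by ext; simp
  map_smul' c p := by ext; simp [polyEval]

/-- An orthonormal family of spherical harmonics of degree `k` spanning all of them. -/
theorem exists_orthonormal_harmonics (k : ℕ) : ∃ (n : ℕ) (f : Fin n → harmonicSubmodule k),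
    n ≤ 2 * (k + 1) ∧
    (∀ i, ∫ ω : S2, polyEval (f i) ω ^ 2 ∂surfaceMeasure = 1) ∧
    (∀ a : Fin n → ℝ, ∫ ω : S2, polyEval (∑ i, a i • f i : harmonicSubmodule k) ω ^ 2
      ∂surfaceMeasure = ∑ i, a i ^ 2) ∧
    ∀ p : harmonicSubmodule k, ∃ a : Fin n → ℝ,
      (∀ ω : S2, polyEval p ω = ∑ i, a i * polyEval (f i) ω) ∧
      ∑ i, a i ^ 2 = ∫ ω : S2, polyEval p ω ^ 2 ∂surfaceMeasure := by
  let T : harmonicSubmodule k →ₗ[ℝ] Lp ℝ 2 surfaceMeasure :=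
    (ContinuousMap.toLp (E := ℝ) 2 surfaceMeasure ℝ).toLinearMap ∘ₗ restrictSphere k
  have hT : ∀ p q, inner ℝ (T p) (T q) =
      ∫ ω : S2, polyEval p ω * polyEval q ω ∂surfaceMeasure := by
    intro p q
    have h := ContinuousMap.inner_toLp (𝕜 := ℝ) surfaceMeasure (restrictSphere k p)
      (restrictSphere k q)
    refine h.trans (integral_congr_ae (Eventually.of_forall fun ω => ?_))
    simp [restrictSphere, mul_comm]
  let V : Submodule ℝ (Lp ℝ 2 surfaceMeasure) := LinearMap.range T
  have hV : Module.finrank ℝ V ≤ 2 * (k + 1) :=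
    (LinearMap.finrank_range_le T).trans (finrank_harmonicSubmodule_le k)
  let e := stdOrthonormalBasis ℝ V
  have hmem : ∀ i, ∃ p, T p = e i := fun i => LinearMap.mem_range.1 (e i).2
  choose f hf using hmem
  refine ⟨_, f, hV, fun i => ?_, fun a => ?_, fun p => ?_⟩
  · have h := hT (f i) (f i)
    rw [hf i] at h
    simp_rw [sq]
    rw [← h]
    have h1 : ‖(e i : Lp ℝ 2 surfaceMeasure)‖ = 1 := e.orthonormal.1 i
    rw [real_inner_self_eq_norm_sq, h1, one_pow]
  · simp_rw [sq (polyEval _ _)]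
    rw [← hT]
    have h1 : T (∑ i, a i • f i) = ((∑ i, a i • e i : V) : Lp ℝ 2 surfaceMeasure) := by
      rw [map_sum]
      simp only [map_smul, hf]
      simp
    rw [h1, ← Submodule.coe_inner, e.orthonormal.inner_sum]
    exact Finset.sum_congr rfl fun i _ => (sq _).symm
  · let v : V := ⟨T p, LinearMap.mem_range_self T p⟩
    refine ⟨fun i => inner ℝ (e i) v, ?_, ?_⟩
    · have h1 : T p = T (∑ i, (inner ℝ (e i) v) • f i) := by
        have h2 : ((∑ i, inner ℝ (e i) v • e i : V) : Lp ℝ 2 surfaceMeasure) = T p :=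
          congrArg Subtype.val (e.sum_repr' v)
        rw [map_sum, ← h2]
        simp only [map_smul, hf]
        simp
      have h3 : restrictSphere k p = restrictSphere k (∑ i, (inner ℝ (e i) v) • f i) :=
        ContinuousMap.toLp_injective surfaceMeasure h1
      intro ω
      have h4 := congrArg (fun g : C(S2, ℝ) => g ω) h3
      rw [map_sum] at h4
      simpa [restrictSphere] using h4
    · have h1 := e.sum_sq_norm_inner_right v
      have h2 : ‖v‖ ^ 2 = ∫ ω : S2, polyEval p ω ^ 2 ∂surfaceMeasure := by
        simp_rw [sq (polyEval _ _)]
        rw [← hT, real_inner_self_eq_norm_sq]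
        rfl
      rw [← h2, ← h1]
      simp

/-- The isometry is the reflection in the plane orthogonal to `ω - η`. -/
theorem exists_isometry_map_eq (ω η : S2) : ∃ R : E3 ≃ₗᵢ[ℝ] E3, R ω = η :=
  ⟨_, Submodule.reflection_sub (v := (ω : E3)) (w := η) (by simp)⟩

/-- A spherical harmonic of degree `k` is bounded by its `L²` norm, with a constant of order
`√k`. -/
theorem exists_sq_polyEval_le : ∃ C : ℝ, 0 ≤ C ∧ ∀ (k : ℕ) (p : MvPolynomial (Fin 3) ℝ),
    p.IsHomogeneous k → polyLaplacian p = 0 → ∀ ω : S2,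
    polyEval p ω ^ 2 ≤ C * (k + 1) * ∫ η : S2, polyEval p η ^ 2 ∂surfaceMeasure := by
  have hσ : 0 < surfaceMeasure.real Set.univ := by
    have : Nonempty S2 := (NormedSpace.sphere_nonempty.2 zero_le_one).to_subtype
    exact ENNReal.toReal_pos (isOpen_univ.measure_ne_zero _ Set.univ_nonempty) (measure_ne_top _ _)
  refine ⟨2 / surfaceMeasure.real Set.univ, by positivity, fun k p hp hΔ ω => ?_⟩
  obtain ⟨n, f, hn, hnorm, hsq, hspan⟩ := exists_orthonormal_harmonics k
  let S : S2 → ℝ := fun ω => ∑ i, polyEval (f i) ω ^ 2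
  have hS0 : ∀ ω, 0 ≤ S ω := fun ω => Finset.sum_nonneg fun i _ => sq_nonneg _
  have hcontf : ∀ i, Continuous fun ω : S2 => polyEval (f i) ω := fun i =>
    (continuous_polyEval _).comp continuous_subtype_val
  have hSint : Integrable S surfaceMeasure :=
    integrable_finsetSum _ fun i _ => ((hcontf i).pow 2).integrable_of_hasCompactSupport
      (HasCompactSupport.of_compactSpace _)
  have hCS : ∀ (q : harmonicSubmodule k) (ω : S2),
      polyEval q ω ^ 2 ≤ (∫ η : S2, polyEval q η ^ 2 ∂surfaceMeasure) * S ω := by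
    intro q ω
    obtain ⟨a, ha, ha2⟩ := hspan q
    rw [ha ω, ← ha2]
    exact Finset.sum_mul_sq_le_sq_mul_sq _ _ _
  -- The harmonic `q` with coefficients `f i ω` has squared norm `S ω` and value `S ω` at `ω`. An
  -- isometry moves that value to `η` without changing the norm, and Cauchy–Schwarz at `η` gives `(S
  -- ω)² ≤ S ω * S η`. Hence `S` is constant.
  have hmono : ∀ ω η : S2, S ω ≤ S η := by
    intro ω η
    obtain ⟨R, hR⟩ := exists_isometry_map_eq η ω
    let q : harmonicSubmodule k := ∑ i, polyEval (f i) ω • f i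
    have hq : ∀ ζ : S2, polyEval q ζ = ∑ i, polyEval (f i) ω * polyEval (f i) ζ := by
      intro ζ
      have : (q : MvPolynomial (Fin 3) ℝ) =
          ∑ i, polyEval (f i) ω • (f i : MvPolynomial (Fin 3) ℝ) := by simp [q]
      rw [this, polyEval_sum]
      refine Finset.sum_congr rfl fun i _ => ?_
      simp [polyEval]
    have hqω : polyEval q ω = S ω := by
      rw [hq]
      exact Finset.sum_congr rfl fun i _ => (sq _).symm
    let q' : harmonicSubmodule k := ⟨polyRotate R q, polyRotate_mem R q.2⟩
    have hq'η : polyEval q' η = S ω := by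
      rw [← hqω, ← hR]
      exact polyEval_polyRotate R q η
    have hint : ∫ ζ : S2, polyEval q' ζ ^ 2 ∂surfaceMeasure =
        ∫ ζ : S2, polyEval q ζ ^ 2 ∂surfaceMeasure := by
      have h1 : ∀ ζ : S2, polyEval q' ζ ^ 2 = (fun ζ : S2 => polyEval q ζ ^ 2) (sphereMap R ζ) := by
        intro ζ
        simp only [q', polyEval_polyRotate]
        rfl
      simp_rw [h1]
      have h2 := integral_map (μ := surfaceMeasure)
        (measurePreserving_sphereMap R).measurable.aemeasurable
        (f := fun ζ : S2 => polyEval q ζ ^ 2) (Continuous.aestronglyMeasurable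
          (((continuous_polyEval _).comp continuous_subtype_val).pow 2))
      rw [← h2, (measurePreserving_sphereMap R).map_eq]
    have h2 := hCS q' η
    have h3 : ∫ ζ : S2, polyEval q ζ ^ 2 ∂surfaceMeasure = S ω := hsq _
    rw [hq'η, hint, h3, sq] at h2
    rcases (hS0 ω).eq_or_lt with h0 | h0
    · exact h0 ▸ hS0 η
    · exact le_of_mul_le_mul_left h2 h0
  -- The integral of the constant function `S` counts the orthonormal family, so the dimension bound
  -- controls its value.
  have hSbound : S ω * surfaceMeasure.real Set.univ ≤ 2 * (k + 1) := by
    calc S ω * surfaceMeasure.real Set.univ = ∫ _, S ω ∂surfaceMeasure := by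
          rw [integral_const, smul_eq_mul, mul_comm]
      _ ≤ ∫ η, S η ∂surfaceMeasure := integral_mono (integrable_const _) hSint (hmono ω)
      _ = (n : ℝ) := by
          have h := integral_finsetSum (μ := surfaceMeasure) Finset.univ
            (f := fun i (ω : S2) => polyEval (f i) ω ^ 2) fun i _ =>
            ((hcontf i).pow 2).integrable_of_hasCompactSupport
            (HasCompactSupport.of_compactSpace _)
          refine h.trans ?_
          simp [hnorm]
      _ ≤ 2 * (k + 1) := by exact_mod_cast hn
  have h3 := hCS ⟨p, hp, hΔ⟩ ω
  have h4 : 0 ≤ ∫ η : S2, polyEval p η ^ 2 ∂surfaceMeasure := integral_nonneg fun _ => sq_nonneg _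
  refine h3.trans ?_
  rw [mul_comm]
  refine mul_le_mul_of_nonneg_right ?_ h4
  rw [div_mul_eq_mul_div, le_div_iff₀ hσ]
  exact hSbound

/-! ### The expansion of the profile into spherical harmonics -/

theorem bochnerConst_nonneg (k : ℕ) : 0 ≤ bochnerConst k := by
  unfold bochnerConst
  have h1 : 0 < Real.Gamma (((k : ℝ) + 2) / 2) := Real.Gamma_pos_of_pos (by positivity)
  have h2 : 0 < Real.Gamma (((k : ℝ) + 1) / 2) := Real.Gamma_pos_of_pos (by positivity)
  positivity

/-- Log-convexity of the Gamma function at the midpoint of `x` and `x + 1` gives `Γ(x + 1/2) ≤ √x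
Γ(x)`. -/
theorem bochnerConst_le (k : ℕ) : bochnerConst k ≤ √((k : ℝ) + 1) := by
  unfold bochnerConst
  set x : ℝ := ((k : ℝ) + 1) / 2 with hx
  have hx0 : 0 < x := by positivity
  have hΓ : 0 < Real.Gamma x := Real.Gamma_pos_of_pos hx0
  have h := Real.Gamma_mul_add_mul_le_rpow_Gamma_mul_rpow_Gamma hx0
    (by positivity : 0 < x + 1) (by norm_num : (0 : ℝ) < 1 / 2) (by norm_num : (0 : ℝ) < 1 / 2)
    (by norm_num)
  rw [Real.Gamma_add_one hx0.ne', Real.mul_rpow hx0.le hΓ.le, ← mul_assoc,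
    mul_comm (Real.Gamma x ^ _), mul_assoc, ← Real.rpow_add hΓ, ← Real.sqrt_eq_rpow] at h
  norm_num at h
  have hx2 : ((k : ℝ) + 2) / 2 = 1 / 2 * x + 1 / 2 * (x + 1) := by rw [hx]; ring
  rw [hx2, div_le_iff₀ hΓ]
  calc √2 * Real.Gamma (1 / 2 * x + 1 / 2 * (x + 1)) ≤ √2 * (√x * Real.Gamma x) := by gcongr
    _ = √((k : ℝ) + 1) * Real.Gamma x := by
      rw [← mul_assoc, ← Real.sqrt_mul (by norm_num), hx, mul_div_cancel₀ _ (by norm_num)]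

/-- Split `(k + 1) √(N k)` as `(k + 1)ˢ √(N k)` times `(k + 1)^(1 - s)`. The first factor is square
summable by the Sobolev condition, the second exactly when `2s - 2 > 1`, which is where `s > 3/2`
comes from. -/
theorem summable_mul_sqrt {s : ℝ} (hs : 3 / 2 < s) {N : ℕ → ℝ} (hN : ∀ k, 0 ≤ N k)
    (hsum : Summable fun k : ℕ => (1 + √((k : ℝ) * (k + 1))) ^ (2 * s) * N k) :
    Summable fun k : ℕ => ((k : ℝ) + 1) * √(N k) := by
  have h1 : Summable fun k : ℕ => ((k : ℝ) + 1) ^ (2 - 2 * s) := by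
    have h := (summable_nat_add_iff 1).2 (Real.summable_nat_rpow.2 (by linarith : 2 - 2 * s < -1))
    simpa using h
  refine Summable.of_nonneg_of_le (fun k => by positivity) (fun k => ?_) (hsum.add h1)
  have hk : (0 : ℝ) < (k : ℝ) + 1 := by positivity
  have hle : (k : ℝ) + 1 ≤ 1 + √((k : ℝ) * (k + 1)) := by
    have : (k : ℝ) ≤ √((k : ℝ) * (k + 1)) :=
      Real.le_sqrt_of_sq_le (by nlinarith [k.cast_nonneg (α := ℝ)])
    linarith
  have hA : ((k : ℝ) + 1) ^ (2 * s) * N k ≤ (1 + √((k : ℝ) * (k + 1))) ^ (2 * s) * N k :=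
    mul_le_mul_of_nonneg_right (Real.rpow_le_rpow hk.le hle (by linarith)) (hN k)
  refine le_trans ?_ (add_le_add_left hA _)
  have e1 : ((k : ℝ) + 1) ^ (2 * s) * N k = (((k : ℝ) + 1) ^ s * √(N k)) ^ 2 := by
    rw [mul_pow, Real.sq_sqrt (hN k), ← Real.rpow_natCast, ← Real.rpow_mul hk.le, mul_comm s]
    norm_num
  have e2 : ((k : ℝ) + 1) ^ (2 - 2 * s) = (((k : ℝ) + 1) ^ (1 - s)) ^ 2 := by
    rw [← Real.rpow_natCast, ← Real.rpow_mul hk.le]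
    congr 1
    push_cast
    ring
  have e3 : ((k : ℝ) + 1) * √(N k) = ((k : ℝ) + 1) ^ s * √(N k) * ((k : ℝ) + 1) ^ (1 - s) := by
    rw [mul_right_comm, ← Real.rpow_add hk]
    norm_num
  rw [e1, e2, e3]
  nlinarith [sq_nonneg (((k : ℝ) + 1) ^ s * √(N k) - ((k : ℝ) + 1) ^ (1 - s)),
    sq_nonneg (((k : ℝ) + 1) ^ s * √(N k)), sq_nonneg (((k : ℝ) + 1) ^ (1 - s))]

/-- A continuous function in `Hˢ(𝕊²)`, `s > 3/2`, has a uniformly convergent expansion into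
spherical harmonics, which stays convergent after multiplication with the constants in Bochner's
formula. -/
theorem exists_harmonic_expansion {s : ℝ} (hs : 3 / 2 < s) {Ψ : S2 → ℝ} (hcont : Continuous Ψ)
    (hsob : MemSobolevSphere s Ψ) :
    ∃ (p : ℕ → MvPolynomial (Fin 3) ℝ) (u : ℕ → ℝ), (∀ k, (p k).IsHomogeneous k) ∧
      (∀ k, polyLaplacian (p k) = 0) ∧ Summable u ∧
      (∀ k (ω : S2), |polyEval (p k) ω| ≤ u k) ∧
      (∀ k (ω : S2), bochnerConst k * |polyEval (p k) ω| ≤ u k) ∧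
      ∀ ω : S2, HasSum (fun k => polyEval (p k) ω) (Ψ ω) := by
  obtain ⟨-, Y, hY, hlim, hsum⟩ := hsob
  choose p hp hΔ hYp using hY
  obtain ⟨C, hC, hbound⟩ := exists_sq_polyEval_le
  obtain rfl : Y = fun k (ω : S2) => polyEval (p k) ω := by
    ext k ω
    exact hYp k ω
  set N : ℕ → ℝ := fun k => ∫ ω : S2, polyEval (p k) ω ^ 2 ∂surfaceMeasure
  have hN : ∀ k, 0 ≤ N k := fun k => integral_nonneg fun _ => sq_nonneg _
  -- One factor `√(k + 1)` is reserved for the constant in Bochner's formula, the other comes from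
  -- the supremum bound.
  have hw : ∀ (k : ℕ) (ω : S2), √((k : ℝ) + 1) * |polyEval (p k) ω| ≤ √C * (((k : ℝ) + 1) * √(N k)) := by
    intro k ω
    have h1 : |polyEval (p k) ω| ≤ √(C * (k + 1) * N k) :=
      Real.abs_le_sqrt (hbound k (p k) (hp k) (hΔ k) ω)
    have hk : (0 : ℝ) ≤ (k : ℝ) + 1 := by positivity
    calc √((k : ℝ) + 1) * |polyEval (p k) ω| ≤ √((k : ℝ) + 1) * √(C * (k + 1) * N k) := by gcongr
      _ = √C * ((√((k : ℝ) + 1) * √((k : ℝ) + 1)) * √(N k)) := by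
          rw [Real.sqrt_mul (by positivity), Real.sqrt_mul hC]
          ring
      _ = √C * (((k : ℝ) + 1) * √(N k)) := by rw [Real.mul_self_sqrt hk]
  have hsumw := (summable_mul_sqrt hs hN hsum).mul_left √C
  have hle1 : ∀ (k : ℕ) (ω : S2), |polyEval (p k) ω| ≤ √C * (((k : ℝ) + 1) * √(N k)) := fun k ω =>
    le_trans (le_mul_of_one_le_left (abs_nonneg _) (Real.one_le_sqrt.2 (by simp))) (hw k ω)
  have hle2 : ∀ (k : ℕ) (ω : S2), bochnerConst k * |polyEval (p k) ω| ≤ √C * (((k : ℝ) + 1) * √(N k)) :=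
    fun k ω => le_trans (mul_le_mul_of_nonneg_right (bochnerConst_le k) (abs_nonneg _)) (hw k ω)
  refine ⟨p, _, hp, hΔ, hsumw, hle1, hle2, ?_⟩
  have hcontY : ∀ k, Continuous fun ω : S2 => polyEval (p k) ω := fun k =>
    (continuous_polyEval _).comp continuous_subtype_val
  have hsumY : ∀ ω : S2, Summable fun k => polyEval (p k) ω := fun ω =>
    Summable.of_norm_bounded hsumw fun k => hle1 k ω
  have hcont' : Continuous fun ω : S2 => ∑' k, polyEval (p k) ω :=
    continuous_tsum hcontY hsumw fun k ω => hle1 k ω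
  -- The uniform sum is identified with `Ψ` almost everywhere along a subsequence of the
  -- `L²`-convergent partial sums, then everywhere by continuity.
  have hmeas : TendstoInMeasure surfaceMeasure
      (fun (n : ℕ) (ω : S2) => ∑ k ∈ Finset.range n, polyEval (p k) ω) atTop Ψ := by
    refine tendstoInMeasure_of_tendsto_eLpNorm (p := 2) (by norm_num) (fun n => ?_)
      hcont.aestronglyMeasurable ?_
    · exact (continuous_finsetSum _ fun k _ => hcontY k).aestronglyMeasurable
    · refine hlim.congr fun n => ?_
      exact eLpNorm_sub_comm Ψ (fun ω : S2 => ∑ k ∈ Finset.range n, polyEval (p k) ω) _ _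
  obtain ⟨ns, hns, hae⟩ := hmeas.exists_seq_tendsto_ae
  have heq : Ψ =ᵐ[surfaceMeasure] fun ω : S2 => ∑' k, polyEval (p k) ω := by
    filter_upwards [hae] with ω hω
    exact tendsto_nhds_unique hω ((hsumY ω).hasSum.tendsto_sum_nat.comp hns.tendsto_atTop)
  have heq' := (hcont.ae_eq_iff_eq surfaceMeasure hcont').1 heq
  intro ω
  rw [heq']
  exact (hsumY ω).hasSum

/-- The expansion of an even function contains only harmonics of even degree. -/
theorem exists_even_harmonic_expansion {s : ℝ} (hs : 3 / 2 < s) {Ψ : S2 → ℝ}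
    (hcont : Continuous Ψ) (heven : ∀ ω, Ψ (-ω) = Ψ ω) (hsob : MemSobolevSphere s Ψ) :
    ∃ (p : ℕ → MvPolynomial (Fin 3) ℝ) (u : ℕ → ℝ), (∀ k, (p k).IsHomogeneous k) ∧
      (∀ k, polyLaplacian (p k) = 0) ∧ (∀ k, ¬ Even k → p k = 0) ∧ Summable u ∧
      (∀ k (ω : S2), |polyEval (p k) ω| ≤ u k) ∧
      (∀ k (ω : S2), bochnerConst k * |polyEval (p k) ω| ≤ u k) ∧
      ∀ ω : S2, HasSum (fun k => polyEval (p k) ω) (Ψ ω) := by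
  obtain ⟨p, u, hp, hΔ, hu, h1, h2, h3⟩ := exists_harmonic_expansion hs hcont hsob
  have hu0 : ∀ (ω : S2) k, 0 ≤ u k := fun ω k => (abs_nonneg _).trans (h1 k ω)
  refine ⟨fun k => if Even k then p k else 0, u, fun k => ?_, fun k => ?_, fun k hk => if_neg hk,
    hu, fun k ω => ?_, fun k ω => ?_, fun ω => ?_⟩
  · dsimp only
    split_ifs
    exacts [hp k, MvPolynomial.isHomogeneous_zero _ _ _]
  · dsimp only
    split_ifs
    exacts [hΔ k, by simp [polyLaplacian]]
  · dsimp only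
    split_ifs
    exacts [h1 k ω, by simpa using hu0 ω k]
  · dsimp only
    split_ifs
    exacts [h2 k ω, by simpa using hu0 ω k]
  -- Averaging the expansions at `ω` and `-ω` keeps `Ψ` and kills the odd degrees.
  · have h4 := ((h3 ω).add (h3 (-ω))).mul_left (1 / 2 : ℝ)
    rw [heven ω] at h4
    have e1 : (1 / 2 : ℝ) * (Ψ ω + Ψ ω) = Ψ ω := by ring
    rw [e1] at h4
    refine h4.congr_fun ?_
    intro k
    have e2 : polyEval (p k) ((-ω : S2) : E3) = (-1) ^ k * polyEval (p k) ω := by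
      rw [← polyEval_smul (hp k)]
      simp
    dsimp only
    rw [e2]
    split_ifs with hk
    · rw [hk.neg_one_pow]
      ring
    · rw [(Nat.not_even_iff_odd.1 hk).neg_one_pow]
      simp

/-! ### The Fourier profile -/

/-- Termwise integration, with `u k (1 + |x|⁻²) |g|` dominating the terms. The weight covers both
homogeneities `-1` and `-2`, so the lemma serves `W` and its transform alike. -/
theorem hasSum_integral_mul {h : ℕ → E3 → ℝ} {H : E3 → ℝ} {u : ℕ → ℝ} (hu : Summable u)
    (hm : ∀ k, AEStronglyMeasurable (h k) volume)
    (hle : ∀ k x, x ≠ 0 → |h k x| ≤ u k * (1 + (‖x‖ ^ 2)⁻¹))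
    (hH : ∀ x, HasSum (fun k => h k x) (H x)) {g : E3 → ℂ} (hg : Integrable g) {B : ℝ}
    (hB : ∀ x, ‖g x‖ ≤ B) :
    Integrable (fun x => (H x : ℂ) * g x) ∧
      HasSum (fun k => ∫ x, (h k x : ℂ) * g x) (∫ x, (H x : ℂ) * g x) := by
  have hne : ∀ᵐ x : E3, x ≠ 0 := by
    simp [ae_iff]
  have hmH : AEStronglyMeasurable H volume :=
    aestronglyMeasurable_of_tendsto_ae atTop
      (f := fun n x => ∑ k ∈ Finset.range n, h k x)
      (fun n => Finset.aestronglyMeasurable_fun_sum _ fun k _ => hm k)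
      (Eventually.of_forall fun x => (hH x).tendsto_sum_nat)
  have hleH : ∀ x, x ≠ 0 → |H x| ≤ (∑' k, u k) * (1 + (‖x‖ ^ 2)⁻¹) := by
    intro x hx
    have h1 := tsum_of_norm_bounded (hu.mul_right (1 + (‖x‖ ^ 2)⁻¹)).hasSum
      (f := fun k => h k x) fun k => hle k x hx
    rwa [(hH x).tsum_eq, tsum_mul_right] at h1
  refine ⟨integrable_mul_of_le_inv_norm_sq hmH hleH hg hB, ?_⟩
  have hint : ∀ k, Integrable fun x => (h k x : ℂ) * g x := fun k =>
    integrable_mul_of_le_inv_norm_sq (hm k) (hle k) hg hB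
  have hwt : Integrable fun x : E3 => ((1 + (‖x‖ ^ 2)⁻¹ : ℝ) : ℂ) * g x := by
    refine integrable_mul_of_le_inv_norm_sq (A := 1) ?_ (fun x _ => ?_) hg hB
    · exact Measurable.aestronglyMeasurable (by fun_prop)
    · rw [abs_of_nonneg (by positivity), one_mul]
  have hsum : Summable fun k => ∫ x, ‖(h k x : ℂ) * g x‖ := by
    refine Summable.of_nonneg_of_le (fun k => integral_nonneg fun _ => norm_nonneg _) (fun k => ?_)
      (hu.mul_right (∫ x, ‖((1 + (‖x‖ ^ 2)⁻¹ : ℝ) : ℂ) * g x‖))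
    rw [← integral_const_mul]
    refine integral_mono_ae (hint k).norm (hwt.norm.const_mul _) ?_
    filter_upwards [hne] with x hx
    rw [norm_mul, norm_mul, ← mul_assoc, Complex.norm_real, Complex.norm_real]
    refine mul_le_mul_of_nonneg_right ?_ (norm_nonneg _)
    rw [Real.norm_of_nonneg (by positivity : 0 ≤ 1 + (‖x‖ ^ 2)⁻¹)]
    exact hle k x hx
  have hsum' := hasSum_integral_of_summable_integral_norm hint hsum
  suffices ∫ x, ∑' k, (h k x : ℂ) * g x = ∫ x, (H x : ℂ) * g x by rwa [this] at hsum'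
  refine integral_congr_ae (Eventually.of_forall fun x => ?_)
  have h1 : HasSum (fun k => (h k x : ℂ) * g x) ((H x : ℂ) * g x) :=
    (Complex.hasSum_ofReal.2 (hH x)).mul_right _
  exact h1.tsum_eq

theorem polyEval_mul_inv_norm_pow {p : MvPolynomial (Fin 3) ℝ} {k : ℕ} (hp : p.IsHomogeneous k)
    (m : ℕ) {x : E3} (hx : x ≠ 0) :
    polyEval p x * (‖x‖ ^ (k + m))⁻¹ = polyEval p (direction x hx) * (‖x‖ ^ m)⁻¹ := by
  have h0 : ‖x‖ ≠ 0 := norm_ne_zero_iff.2 hx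
  change _ = polyEval p (‖x‖⁻¹ • x) * _
  rw [polyEval_smul hp]
  rw [pow_add, inv_pow]
  field_simp

theorem exists_hasFourierProfile {s : ℝ} (hs : 3 / 2 < s) {Ψ : S2 → ℝ}
    (hcont : Continuous Ψ) (heven : ∀ ω, Ψ (-ω) = Ψ ω) (hpos : ∀ ω, 0 < Ψ ω)
    (hsob : MemSobolevSphere s Ψ) : ∃ F : E3 → ℝ, HasFourierProfile Ψ F := by
  obtain ⟨p, u, hp, hΔ, hodd, hu, h1, h2, h3⟩ := exists_even_harmonic_expansion hs hcont heven hsob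
  -- For even `k` the factor `(-i)ᵏ` is the real sign `(-1)^(k/2)`; for odd `k` the polynomial is
  -- zero and the value of `c k` is irrelevant.
  set c : ℕ → ℝ := fun k => (-1) ^ (k / 2) * bochnerConst k with hc
  have hcabs : ∀ k, |c k| = bochnerConst k := by
    intro k
    simp [hc, abs_mul, abs_of_nonneg (bochnerConst_nonneg k)]
  set f : ℕ → E3 → ℝ := fun k x => polyEval (p k) x * (‖x‖ ^ (k + 1))⁻¹ with hf
  set G : ℕ → E3 → ℝ := fun k x => c k * (polyEval (p k) x * (‖x‖ ^ (k + 2))⁻¹) with hG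
  have hu0 : ∀ k, 0 ≤ u k := fun k =>
    (abs_nonneg _).trans (h1 k ⟨unitVec 0, by simp [unitVec]⟩)
  -- The convention `0⁻¹ = 0` makes the terms vanish at the origin, in agreement with `(⊤ :
  -- ℝ≥0∞).toReal = 0`.
  have hf0 : ∀ k, f k 0 = 0 := fun k => by simp [hf]
  have hG0 : ∀ k, G k 0 = 0 := fun k => by simp [hG]
  have hfsum : ∀ x, HasSum (fun k => f k x) (potential Ψ x).toReal := by
    intro x
    by_cases hx : x = 0
    · subst hx
      simp only [hf0]
      simp [potential]
    · rw [potential_of_ne hx, ENNReal.toReal_ofReal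
        (mul_nonneg (inv_nonneg.2 (norm_nonneg _)) (hpos _).le), mul_comm]
      have h := (h3 (direction x hx)).mul_right ‖x‖⁻¹
      refine h.congr_fun fun k => ?_
      simp only [hf]
      rw [polyEval_mul_inv_norm_pow (hp k) 1 hx, pow_one]
  have hfle : ∀ k x, x ≠ 0 → |f k x| ≤ u k * (1 + (‖x‖ ^ 2)⁻¹) := by
    intro k x hx
    simp only [hf]
    rw [polyEval_mul_inv_norm_pow (hp k) 1 hx, pow_one, abs_mul,
      abs_of_nonneg (inv_nonneg.2 (norm_nonneg x))]
    exact mul_le_mul (h1 k _) (inv_norm_le_one_add x) (by positivity) (hu0 k)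
  have hGle' : ∀ k x, x ≠ 0 → |G k x| ≤ u k * (‖x‖ ^ 2)⁻¹ := by
    intro k x hx
    simp only [hG]
    rw [polyEval_mul_inv_norm_pow (hp k) 2 hx, abs_mul, hcabs, abs_mul, ← mul_assoc,
      abs_of_nonneg (inv_nonneg.2 (sq_nonneg ‖x‖))]
    exact mul_le_mul_of_nonneg_right (h2 k _) (by positivity)
  have hGle : ∀ k x, x ≠ 0 → |G k x| ≤ u k * (1 + (‖x‖ ^ 2)⁻¹) := fun k x hx =>
    (hGle' k x hx).trans (mul_le_mul_of_nonneg_left (by linarith) (hu0 k))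
  have hGsum : ∀ x, HasSum (fun k => G k x) (∑' k, G k x) := by
    intro x
    by_cases hx : x = 0
    · subst hx
      simp only [hG0]
      exact summable_zero.hasSum
    · exact (Summable.of_norm_bounded (hu.mul_right _) fun k => hGle' k x hx).hasSum
  have hGm : ∀ k, AEStronglyMeasurable (G k) volume := fun k =>
    (aestronglyMeasurable_polyEval_div (p k) (k + 2)).const_mul _
  refine ⟨fun x => ∑' k, G k x, ⟨?_, ?_, ?_, ?_⟩⟩
  -- Away from the origin the sum is `|x|⁻²` times a series in the direction that converges
  -- uniformly.
  · refine ContinuousOn.congr (f := fun x : E3 =>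
      (∑' k, c k * polyEval (p k) (‖x‖⁻¹ • x)) * (‖x‖ ^ 2)⁻¹) ?_ fun x hx => ?_
    · refine ContinuousOn.mul ?_ ?_
      · refine continuousOn_tsum (u := u) (fun k => ?_) hu fun k x hx => ?_
        · refine ContinuousOn.mul continuousOn_const ((continuous_polyEval _).comp_continuousOn ?_)
          exact (continuousOn_id.norm.inv₀ fun x hx => norm_ne_zero_iff.2 hx).smul continuousOn_id
        · rw [Real.norm_eq_abs, abs_mul, hcabs]
          exact h2 k (direction x hx)
      · exact (continuousOn_id.norm.pow 2).inv₀ fun x hx =>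
          pow_ne_zero _ (norm_ne_zero_iff.2 hx)
    · dsimp only
      rw [← tsum_mul_right]
      refine tsum_congr fun k => ?_
      simp only [hG]
      rw [polyEval_mul_inv_norm_pow (hp k) 2 hx, ← mul_assoc]
      rfl
  · intro t ht ξ
    rw [← tsum_mul_left]
    refine tsum_congr fun k => ?_
    simp only [hG]
    rw [polyEval_smul (hp k), norm_smul, Real.norm_of_nonneg ht.le]
    by_cases hξ : ξ = 0
    · simp [hξ]
    · have := norm_ne_zero_iff.2 hξ
      rw [mul_pow, pow_add t]
      field_simp
  · simp only [hG0, tsum_zero]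
  · rintro φ hφc ⟨B, hB⟩ hφ hφ'
    obtain ⟨i1, s1⟩ := hasSum_integral_mul hu
      (fun k => aestronglyMeasurable_polyEval_div (p k) (k + 1)) hfle hfsum hφ'
      fun x => norm_fourier_le φ x
    obtain ⟨i2, s2⟩ := hasSum_integral_mul hu hGm hGle hGsum hφ hB
    refine ⟨i1, i2, ?_⟩
    refine s1.unique (s2.congr_fun fun k => ?_)
    by_cases hk : Even k
    · have h := integral_polyEval_div_mul_fourier (hp k) (hΔ k) hφ hB hφ'
      simp only [hG]
      rw [h]
      have hI : (-Complex.I) ^ k = (-1) ^ (k / 2) := by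
        obtain ⟨j, rfl⟩ := hk
        rw [← two_mul, pow_mul, Nat.mul_div_cancel_left _ two_pos, neg_sq, Complex.I_sq]
      rw [hI, ← integral_const_mul]
      refine integral_congr_ae (Eventually.of_forall fun x => ?_)
      simp only [hc]
      push_cast
      ring
    · simp [hG, hodd k hk]

/-! ### Schwartz test functions and the sign of the profile -/

open scoped FourierTransform in
theorem fourier_schwartz_eq (φ : 𝓢(E3, ℂ)) (ξ : E3) :
    fourier φ ξ = (((2 * Real.pi) ^ (-(3 / 2) : ℝ) : ℝ) : ℂ) *
      (𝓕 φ : 𝓢(E3, ℂ)) ((2 * Real.pi)⁻¹ • ξ) := by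
  unfold fourier
  congr 1
  rw [SchwartzMap.fourier_coe, Real.fourier_eq']
  refine integral_congr_ae (Eventually.of_forall fun x => ?_)
  dsimp only
  rw [smul_eq_mul, mul_comm, inner_smul_right, real_inner_comm]
  congr 2
  have : (Real.pi : ℂ) ≠ 0 := Complex.ofReal_ne_zero.2 Real.pi_ne_zero
  push_cast
  field_simp

theorem integrable_fourier_schwartz (φ : 𝓢(E3, ℂ)) : Integrable (fourier φ) := by
  have h : fourier φ = fun ξ => (((2 * Real.pi) ^ (-(3 / 2) : ℝ) : ℝ) : ℂ) *
      (FourierTransform.fourier φ : 𝓢(E3, ℂ)) ((2 * Real.pi)⁻¹ • ξ) :=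
    funext (fourier_schwartz_eq φ)
  rw [h]
  exact ((SchwartzMap.integrable _).comp_smul (by positivity)).const_mul _

theorem HasFourierProfile.isFourierTransform {Ψ : S2 → ℝ} {F : E3 → ℝ}
    (hF : HasFourierProfile Ψ F) :
    IsFourierTransform (fun x => (potential Ψ x).toReal) F := by
  intro φ
  obtain ⟨B, hB⟩ := φ.decay 0 0
  exact hF.pairing φ φ.continuous ⟨B, fun x => by simpa using hB.2 x⟩ φ.integrable
    (integrable_fourier_schwartz φ)

/-- The profile is an admissible representative in the sign hypothesis, which applies on the sphere;
homogeneity of degree `-2` spreads the sign along rays. -/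
theorem HasFourierProfile.nonneg {Ψ : S2 → ℝ} {F : E3 → ℝ} (hF : HasFourierProfile Ψ F)
    (h : FourierNonnegOnSphere Ψ) (ξ : E3) : 0 ≤ F ξ := by
  by_cases hξ : ξ = 0
  · rw [hξ, hF.map_zero]
  · have h1 := h F hF.continuousOn hF.isFourierTransform (direction ξ hξ)
    have h0 : 0 < ‖ξ‖ := norm_pos_iff.2 hξ
    have h2 : F ξ = (‖ξ‖ ^ 2)⁻¹ * F (direction ξ hξ) := by
      rw [← hF.homogeneous _ h0]
      simp [direction, smul_smul, h0.ne']
    rw [h2]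
    positivity

end AnisotropicEnergy

end

theorem mainTheorem2 (s : ℝ) (hs : 3 / 2 < s)
    (Ψ : AnisotropicEnergy.S2 → ℝ)
    (hcont : Continuous Ψ)
    (heven : ∀ ω, Ψ (-ω) = Ψ ω)
    (hpos : ∀ ω, 0 < Ψ ω)
    (hsob : AnisotropicEnergy.MemSobolevSphere s Ψ)
    (hfourier : AnisotropicEnergy.FourierNonnegOnSphere Ψ) :
    (∃! μ₀ : ProbabilityMeasure AnisotropicEnergy.E3, AnisotropicEnergy.IsMinimiser Ψ μ₀) ∧
    (∀ μ₀ : ProbabilityMeasure AnisotropicEnergy.E3, AnisotropicEnergy.IsMinimiser Ψ μ₀ →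
      IsCompact (μ₀ : Measure AnisotropicEnergy.E3).support) ∧
    (∀ μ₀ : ProbabilityMeasure AnisotropicEnergy.E3,
      AnisotropicEnergy.IsMinimiser Ψ μ₀ ↔ AnisotropicEnergy.EulerLagrange Ψ μ₀) := by
  obtain ⟨F, hF⟩ := AnisotropicEnergy.exists_hasFourierProfile hs hcont heven hpos hsob
  exact hF.main hcont hpos heven (hF.nonneg hfourier)
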